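/- Notation. Let $\mathbb{N}=\{1,2,\dots\}$ and $2=\{0,1\}$; all vector spaces are real. For a set $\Lambda$, a \emph{tree on $\Lambda$} is a set of finite sequences of elements of $\Lambda$ which is closed under taking initial segments; it is \emph{ill-founded} if some infinite sequence $\nu\in\Lambda^{\mathbb{N}}$ (an \emph{infinite branch}) has all its initial segments $\nu|_\ell=(\nu(1),\dots,\nu(\ell))$ in the tree. The set of infinite branches of $T$ is denoted by $[T]$. For a tree $\mathcal{T}$ on $2\times\mathbb{N}$ (whose elements are regarded as pairs of finite sequences of the same length) and $\sigma\in 2^{\mathbb{N}}$, let $\mathcal{T}(\sigma)=\{\nu : (\sigma|_{|\nu|},\nu)\in\mathcal{T}\}$, a tree on $\mathbb{N}$. For a finite or infinite sequence $\nu=(n_1,n_2,\dots)$ in $\mathbb{N}$, let $\tilde\nu=\{n_1,\,n_1+n_2,\,n_1+n_2+n_3,\dots\}\subset\mathbb{N}$. For a tree $T$ on $\mathbb{N}$, let $\mathcal{M}_T=\{\tilde\nu : \nu\in T\cup[T] \text{ or } |\nu|\le 3\}$. For a system $\mathcal{M}$ of subsets of $\mathbb{N}$, a family $E_1,\dots,E_n$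 of non-empty finite subsets of $\mathbb{N}$ is \emph{$\mathcal{M}$-admissible} if some element of $\mathcal{M}$ contains numbers $m_1,\dots,m_n$ with $m_1\le E_1<m_2\le E_2<\dots<m_n\le E_n$. Let $\Theta_{\mathcal{M}}$ be the smallest absolutely convex subset of $c_{00}(\mathbb{N})$ which contains every basic vector $e_i$ and satisfies $\frac12\sum_{k=1}^{n}\mathbf{1}_{E_k}x_k\in\Theta_{\mathcal{M}}$ whenever $E_1,\dots,E_n$ is $\mathcal{M}$-admissible and $x_1,\dots,x_n\in\Theta_{\mathcal{M}}$. Let $\|\cdot\|_{\mathcal{M}}$ be the Minkowski gauge of $\Theta_{\mathcal{M}}$. For a tree $\mathcal{T}$ on $2\times\mathbb{N}$, let $E_{\mathcal{T}}$ be the completion of $c_{00}(2^{<\mathbb{N}}\setminus\{\emptyset\})$ with the norm $$\|x\|_{\mathcal{T}}=\sup_{\sigma\in 2^{\mathbb{N}}}\Big\|\sum_{\ell=1}^{\infty}x(\sigma|_\ell)e_\ell\Big\|_{\mathcal{M}_{\mathcal{T}(\sigma)}},$$ and let $E_{\mathcal{T}}^*$ be its dual Banach space. Let $X$ be a Banach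 space. For a bounded sequence $(x_n)$ in $X$, let $\mathrm{ca}(x_n)=\inf_{m}\operatorname{diam}\{x_n:n\ge m\}$ and $\delta(x_n)=\sup_{x^*\in X^*,\|x^*\|\le1}\inf_m\operatorname{diam}\{x^*(x_n):n\ge m\}$. For $C\ge 1$, $X$ has the \emph{$C$-Schur property} if $\mathrm{ca}(x_n)\le C\,\delta(x_n)$ for every bounded sequence $(x_n)$ in $X$. $X$ has the \emph{Schur property} if every weakly convergent sequence in $X$ is norm convergent. $X$ has the \emph{Dunford--Pettis property} if every bounded linear operator from $X$ into a Banach space $Y$ which is weakly compact (i.e., the image of the unit ball is relatively weakly compact) maps weakly convergent sequences to norm convergent ones. Proposition. Let $\mathcal{T}$ be a tree on $2\times\mathbb{N}$. (1) If $\mathcal{T}(\sigma)$ is ill-founded for every $\sigma\in2^{\mathbb{N}}$, then $E_{\mathcal{T}}^*$ has the $6$-Schur property, and it has the Schur property and the Dunford--Pettis property. (2) Otherwise, $E_{\mathcal{T}}^*$ contains a complemented infinite-dimensional reflexive subspace, and it has neither the Schur property nor the Dunford--Pettis property. -/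

import Mathlib

open Filter Topology Set

universe u v

noncomputable section

namespace TreeSpace

open scoped Pointwise

/-! ### Schur-type properties, the Dunford-Pettis property and reflexivity (real Banach spaces) -/

section Properties

/-- `ca(x)`: the infimum over `m` of the diameters of the tails `{x n : n ≥ m}`. -/
def ca {X : Type*} [PseudoMetricSpace X] (x : ℕ → X) : ℝ :=
  ⨅ m : ℕ, Metric.diam (x '' Ici m)

/-- `δ(x)`: the supremum of `ca (f ∘ x)` over all functionals `f` in the closed dual unit ball. -/
def weakCa {X : Type*} [NormedAddCommGroup X] [NormedSpace ℝ X] (x : ℕ → X) : ℝ :=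
  ⨆ f : Metric.closedBall (0 : StrongDual ℝ X) 1, ca fun n => (f : StrongDual ℝ X) (x n)

/-- The `C`-Schur property: `ca(x) ≤ C δ(x)` for every bounded sequence `x`. -/
def HasQuantitativeSchurProperty (C : ℝ) (X : Type*) [NormedAddCommGroup X]
    [NormedSpace ℝ X] : Prop :=
  ∀ x : ℕ → X, Bornology.IsBounded (range x) → ca x ≤ C * weakCa x

/-- The sequence `x` converges to `a` in the weak topology. -/
def WeaklyTendsto {X : Type*} [NormedAddCommGroup X] [NormedSpace ℝ X] (x : ℕ → X) (a : X) :
    Prop :=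
  Tendsto (fun n => toWeakSpace ℝ X (x n)) atTop (𝓝 (toWeakSpace ℝ X a))

/-- The Schur property: every weakly convergent sequence is norm convergent. -/
def HasSchurProperty (X : Type*) [NormedAddCommGroup X] [NormedSpace ℝ X] : Prop :=
  ∀ (x : ℕ → X) (a : X), WeaklyTendsto x a → ∃ b : X, Tendsto x atTop (𝓝 b)

/-- A bounded operator is weakly compact if the image of the unit ball is relatively weakly
compact. -/
def IsWeaklyCompactOperator {X Y : Type*} [NormedAddCommGroup X] [NormedSpace ℝ X]
    [NormedAddCommGroup Y] [NormedSpace ℝ Y] (S : X →L[ℝ] Y) : Prop :=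
  IsCompact (closure (toWeakSpace ℝ Y '' (S '' Metric.closedBall 0 1)))

/-- A bounded operator is completely continuous if it maps weakly convergent sequences to norm
convergent ones. -/
def IsCompletelyContinuous {X Y : Type*} [NormedAddCommGroup X] [NormedSpace ℝ X]
    [NormedAddCommGroup Y] [NormedSpace ℝ Y] (S : X →L[ℝ] Y) : Prop :=
  ∀ (x : ℕ → X) (a : X), WeaklyTendsto x a → ∃ b : Y, Tendsto (fun n => S (x n)) atTop (𝓝 b)

/-- The Dunford-Pettis property: every weakly compact operator into a Banach space is completely
continuous. The target spaces range over an arbitrary universe `v`. -/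
def HasDunfordPettisProperty (X : Type u) [NormedAddCommGroup X] [NormedSpace ℝ X] :
    Prop :=
  ∀ (Y : Type v) [NormedAddCommGroup Y] [NormedSpace ℝ Y] [CompleteSpace Y] (S : X →L[ℝ] Y),
    IsWeaklyCompactOperator S → IsCompletelyContinuous S

/-- Reflexivity: the canonical embedding into the bidual is onto. -/
def IsReflexiveSpace (X : Type*) [NormedAddCommGroup X] [NormedSpace ℝ X] : Prop :=
  Function.Surjective (NormedSpace.inclusionInDoubleDual ℝ X)

end Properties

/-! ### Trees

The positive integers `ℕ+` play the role of `ℕ = {1, 2, …}`, and `Bool` that of `2 = {0, 1}`.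
Trees are those of `Descriptive.tree`: sets of finite sequences closed under initial segments.
The entries of an infinite sequence are indexed from `0`, so its `ℓ`-th entry is `σ (ℓ - 1)`. -/

/-- The initial segment of length `ℓ` of an infinite sequence. -/
def initSeg {A : Type*} (σ : ℕ → A) (ℓ : ℕ) : List A := List.ofFn fun i : Fin ℓ => σ i

theorem length_initSeg {A : Type*} (σ : ℕ → A) (ℓ : ℕ) : (initSeg σ ℓ).length = ℓ := by
  simp [initSeg]

theorem initSeg_succ {A : Type*} (σ : ℕ → A) (ℓ : ℕ) :
    initSeg σ (ℓ + 1) = initSeg σ ℓ ++ [σ ℓ] := by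
  unfold initSeg
  rw [List.ofFn_succ_last]
  rfl

/-- The infinite branches of a tree. -/
def branches {A : Type*} (T : Descriptive.tree A) : Set (ℕ → A) :=
  {ν | ∀ ℓ, initSeg ν ℓ ∈ T}

/-- A tree is ill-founded if it has an infinite branch. -/
def IllFounded {A : Type*} (T : Descriptive.tree A) : Prop := (branches T).Nonempty

/-- The section `T(σ)` of a tree `T` on `A × B`: all finite sequences `ν` in `B` such that the
pair `(σ|_{|ν|}, ν)`, read as a sequence of pairs, belongs to `T`. -/
def treeSection {A B : Type*} (T : Descriptive.tree (A × B)) (σ : ℕ → A) : Descriptive.tree B :=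
  ⟨{ν | (initSeg σ ν.length).zip ν ∈ T}, by
    intro ν b h
    have h' : (initSeg σ (ν ++ [b]).length).zip (ν ++ [b]) ∈ T := h
    rw [List.length_append, List.length_singleton, initSeg_succ,
      List.zip_append (length_initSeg σ ν.length)] at h'
    exact Descriptive.Tree.mem_of_append h'⟩

/-- The set of partial sums `{n₁, n₁ + n₂, …, n₁ + ⋯ + n_k}` of a finite sequence. -/
def finPartialSums (ν : List ℕ+) : Set ℕ+ :=
  {m | ∃ j, 1 ≤ j ∧ j ≤ ν.length ∧ (m : ℕ) = ((ν.take j).map fun n : ℕ+ => (n : ℕ)).sum}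

/-- The set of partial sums `{n₁, n₁ + n₂, …}` of an infinite sequence. -/
def infPartialSums (ν : ℕ → ℕ+) : Set ℕ+ :=
  {m | ∃ j, 1 ≤ j ∧ (m : ℕ) = ∑ i ∈ Finset.range j, (ν i : ℕ)}

/-- The system `M_T` of the sets of partial sums of all elements of `T`, of all infinite branches
of `T` and of all finite sequences of length at most `3`. -/
def setSystem (T : Descriptive.tree ℕ+) : Set (Set ℕ+) :=
  {A | (∃ ν : List ℕ+, (ν ∈ T ∨ ν.length ≤ 3) ∧ A = finPartialSums ν) ∨
    ∃ ν ∈ branches T, A = infPartialSums ν}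

/-! ### Tsirelson type norms -/

/-- The family `E₁, …, Eₙ` of nonempty finite sets is `M`-admissible if some element of `M`
contains numbers with `m₁ ≤ E₁ < m₂ ≤ E₂ < ⋯ < mₙ ≤ Eₙ`. -/
def IsAdmissible (M : Set (Set ℕ+)) {n : ℕ} (E : Fin n → Finset ℕ+) : Prop :=
  (∀ k, (E k).Nonempty) ∧ ∃ A ∈ M, ∃ m : Fin n → ℕ+, (∀ k, m k ∈ A) ∧
    (∀ k, ∀ i ∈ E k, m k ≤ i) ∧ ∀ j k, j < k → ∀ i ∈ E j, i < m k

/-- The closure properties in the definition of `Θ_M`. Here `(x k).filter (· ∈ E k)` is the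
restriction `E_k x_k` of `x_k` to `E_k`. -/
def IsTsirelsonClosed (M : Set (Set ℕ+)) (S : Set (ℕ+ →₀ ℝ)) : Prop :=
  AbsConvex ℝ S ∧ (∀ i, Finsupp.single i 1 ∈ S) ∧
    ∀ (n : ℕ) (E : Fin n → Finset ℕ+) (x : Fin n → ℕ+ →₀ ℝ), IsAdmissible M E →
      (∀ k, x k ∈ S) → (1 / 2 : ℝ) • ∑ k, (x k).filter (· ∈ E k) ∈ S

/-- `Θ_M`: the smallest absolutely convex set of finitely supported sequences that contains all
basic vectors and is closed under the admissible averages above. -/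
def theta (M : Set (Set ℕ+)) : Set (ℕ+ →₀ ℝ) := ⋂₀ {S | IsTsirelsonClosed M S}

/-- `‖x‖_M`: the Minkowski gauge of `Θ_M`. -/
def tsirelsonNorm (M : Set (Set ℕ+)) (x : ℕ+ →₀ ℝ) : ℝ := gauge (theta M) x

theorem isTsirelsonClosed_theta (M : Set (Set ℕ+)) : IsTsirelsonClosed M (theta M) := by
  refine ⟨⟨?_, convex_sInter fun S hS => hS.1.2⟩, fun i S hS => hS.2.1 i, ?_⟩
  · rw [balanced_iff_smul_mem]
    intro a ha x hx S hS
    exact balanced_iff_smul_mem.1 hS.1.1 ha (hx S hS)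
  · intro n E x hE hx S hS
    exact hS.2.2 n E x hE fun k => hx k S hS

theorem absorbent_theta (M : Set (Set ℕ+)) : Absorbent ℝ (theta M) := by
  obtain ⟨⟨hb, hc⟩, he, -⟩ := isTsirelsonClosed_theta M
  have key : ∀ x : ℕ+ →₀ ℝ, ∃ r : ℝ, 0 < r ∧ x ∈ r • theta M := by
    intro x
    induction x using Finsupp.induction_linear with
    | zero =>
      refine ⟨1, one_pos, ?_⟩
      rw [one_smul]
      exact hb.zero_mem ⟨_, he 1⟩
    | add x y hx hy =>
      obtain ⟨r, hr, hx⟩ := hx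
      obtain ⟨s, hs, hy⟩ := hy
      refine ⟨r + s, add_pos hr hs, ?_⟩
      rw [hc.add_smul hr.le hs.le]
      exact add_mem_add hx hy
    | single i a =>
      have ha : ‖a‖ ≤ ‖|a| + 1‖ := by
        rw [Real.norm_eq_abs, Real.norm_eq_abs, abs_of_pos (by positivity : 0 < |a| + 1)]
        linarith
      refine ⟨|a| + 1, by positivity, hb.smul_mono ha ⟨Finsupp.single i 1, he i, ?_⟩⟩
      simp
  intro x
  obtain ⟨r, hr, hx⟩ := key x
  filter_upwards [eventually_cobounded_le_norm (E := ℝ) r] with a ha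
  rw [singleton_subset_iff]
  refine hb.smul_mono ?_ hx
  rwa [Real.norm_of_nonneg hr.le]

theorem tsirelsonNorm_add_le (M : Set (Set ℕ+)) (x y : ℕ+ →₀ ℝ) :
    tsirelsonNorm M (x + y) ≤ tsirelsonNorm M x + tsirelsonNorm M y :=
  gauge_add_le (isTsirelsonClosed_theta M).1.2 (absorbent_theta M) x y

theorem tsirelsonNorm_smul (M : Set (Set ℕ+)) (a : ℝ) (x : ℕ+ →₀ ℝ) :
    tsirelsonNorm M (a • x) = |a| * tsirelsonNorm M x := by
  have := gauge_smul (𝕜 := ℝ) (isTsirelsonClosed_theta M).1.1 a x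
  simpa [tsirelsonNorm] using this

theorem tsirelsonNorm_nonneg (M : Set (Set ℕ+)) (x : ℕ+ →₀ ℝ) : 0 ≤ tsirelsonNorm M x :=
  gauge_nonneg x

theorem tsirelsonNorm_single_le (M : Set (Set ℕ+)) (i : ℕ+) (a : ℝ) :
    tsirelsonNorm M (Finsupp.single i a) ≤ |a| := by
  have h1 : tsirelsonNorm M (Finsupp.single i 1) ≤ 1 :=
    gauge_le_one_of_mem ((isTsirelsonClosed_theta M).2.1 i)
  have h2 : Finsupp.single i a = a • Finsupp.single i (1 : ℝ) := by simp
  rw [h2, tsirelsonNorm_smul]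
  exact mul_le_of_le_one_right (abs_nonneg a) h1

theorem abs_apply_le_tsirelsonNorm (M : Set (Set ℕ+)) (x : ℕ+ →₀ ℝ) (i : ℕ+) :
    |x i| ≤ tsirelsonNorm M x := by
  have hcl : IsTsirelsonClosed M {y : ℕ+ →₀ ℝ | ∀ j, |y j| ≤ 1} := by
    refine ⟨⟨?_, ?_⟩, ?_, ?_⟩
    · rw [balanced_iff_smul_mem]
      intro a ha y hy j
      rw [Finsupp.smul_apply, smul_eq_mul, abs_mul]
      exact mul_le_one₀ ha (abs_nonneg _) (hy j)
    · intro y hy z hz a b ha hb hab j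
      have h1 := hy j
      have h2 := hz j
      rw [Finsupp.add_apply, Finsupp.smul_apply, Finsupp.smul_apply, smul_eq_mul, smul_eq_mul]
      calc |a * y j + b * z j| ≤ |a * y j| + |b * z j| := abs_add_le _ _
        _ = a * |y j| + b * |z j| := by rw [abs_mul, abs_mul, abs_of_nonneg ha, abs_of_nonneg hb]
        _ ≤ a * 1 + b * 1 := by gcongr
        _ = 1 := by linarith
    · intro i j
      by_cases h : i = j <;> simp [h]
    · rintro n E y ⟨-, A, -, m, -, hm1, hm2⟩ hy j
      have hdisj : ∀ k l, j ∈ E k → j ∈ E l → k = l := by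
        intro k l hk hl
        rcases lt_trichotomy k l with h | h | h
        · exact absurd (hm2 k l h j hk) (not_lt.2 (hm1 l j hl))
        · exact h
        · exact absurd (hm2 l k h j hl) (not_lt.2 (hm1 k j hk))
      have hsum : |∑ k, ((y k).filter (· ∈ E k)) j| ≤ 1 := by
        by_cases hk : ∃ k, j ∈ E k
        · obtain ⟨k, hk⟩ := hk
          rw [Finset.sum_eq_single k]
          · rw [Finsupp.filter_apply_pos _ _ hk]
            exact hy k j
          · intro l _ hl
            exact Finsupp.filter_apply_neg _ _ fun h => hl (hdisj l k h hk)
          · simp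
        · rw [Finset.sum_eq_zero]
          · simp
          · intro k _
            exact Finsupp.filter_apply_neg _ _ fun h => hk ⟨k, h⟩
      rw [Finsupp.smul_apply, Finsupp.finsetSum_apply, smul_eq_mul, abs_mul,
        abs_of_pos (by norm_num : (0 : ℝ) < 1 / 2)]
      linarith
  refine le_csInf ((absorbent_theta M).gauge_set_nonempty) ?_
  rintro r ⟨hr, y, hy, rfl⟩
  have := hy _ hcl i
  rw [Finsupp.smul_apply, smul_eq_mul, abs_mul, abs_of_pos hr]
  exact mul_le_of_le_one_right (le_of_lt hr) this

/-! ### The tree space -/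

/-- The index set `2^{<ℕ} \ {∅}`. -/
abbrev Node : Type := {η : List Bool // η ≠ []}

/-- The `ℓ`-th node `σ|_ℓ` of the branch given by `σ`. -/
def branchNode (σ : ℕ → Bool) (ℓ : ℕ+) : Node :=
  ⟨initSeg σ ℓ, fun h => ℓ.ne_zero (by simpa [length_initSeg] using congrArg List.length h)⟩

theorem branchNode_injective (σ : ℕ → Bool) : Function.Injective (branchNode σ) := by
  intro k l h
  have := congrArg (fun η : Node => η.1.length) h
  simpa [branchNode, length_initSeg] using this

/-- The finitely supported sequence `∑ x(σ|_ℓ) e_ℓ` of the values of `x` along the branch `σ`. -/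
def alongBranch (σ : ℕ → Bool) : (Node →₀ ℝ) →ₗ[ℝ] (ℕ+ →₀ ℝ) :=
  Finsupp.lcomapDomain (branchNode σ) (branchNode_injective σ)

theorem alongBranch_apply (σ : ℕ → Bool) (x : Node →₀ ℝ) (ℓ : ℕ+) :
    alongBranch σ x ℓ = x (branchNode σ ℓ) := rfl

/-- `‖x‖_T`: the supremum over all `σ` of the Tsirelson type norm, with respect to the system
given by the section `T(σ)`, of `x` along the branch `σ`. -/
def treeNorm (T : Descriptive.tree (Bool × ℕ+)) (x : Node →₀ ℝ) : ℝ :=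
  ⨆ σ : ℕ → Bool, tsirelsonNorm (setSystem (treeSection T σ)) (alongBranch σ x)

theorem treeNorm_zero (T : Descriptive.tree (Bool × ℕ+)) : treeNorm T 0 = 0 := by
  simp [treeNorm, tsirelsonNorm]

theorem bddAbove_treeNorm (T : Descriptive.tree (Bool × ℕ+)) (x : Node →₀ ℝ) :
    BddAbove (range fun σ : ℕ → Bool =>
      tsirelsonNorm (setSystem (treeSection T σ)) (alongBranch σ x)) := by
  induction x using Finsupp.induction_linear with
  | zero =>
    refine ⟨0, ?_⟩
    rintro _ ⟨σ, rfl⟩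
    simp [tsirelsonNorm]
  | add x y hx hy =>
    obtain ⟨r, hr⟩ := hx
    obtain ⟨s, hs⟩ := hy
    refine ⟨r + s, ?_⟩
    rintro _ ⟨σ, rfl⟩
    simp only [map_add]
    exact (tsirelsonNorm_add_le _ _ _).trans (add_le_add (hr ⟨σ, rfl⟩) (hs ⟨σ, rfl⟩))
  | single η a =>
    refine ⟨|a|, ?_⟩
    rintro _ ⟨σ, rfl⟩
    by_cases h : ∃ ℓ, branchNode σ ℓ = η
    · obtain ⟨ℓ, rfl⟩ := h
      have : alongBranch σ (Finsupp.single (branchNode σ ℓ) a) = Finsupp.single ℓ a := by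
        ext k
        simp [alongBranch_apply, Finsupp.single_apply, (branchNode_injective σ).eq_iff]
      simp only [this]
      exact tsirelsonNorm_single_le _ _ _
    · have : alongBranch σ (Finsupp.single η a) = 0 := by
        ext k
        rw [alongBranch_apply, Finsupp.single_apply, if_neg fun hk => h ⟨k, hk.symm⟩,
          Finsupp.zero_apply]
      simp [this, tsirelsonNorm]

theorem exists_branchNode_eq (η : Node) : ∃ (σ : ℕ → Bool) (ℓ : ℕ+), branchNode σ ℓ = η := by
  obtain ⟨l, hl⟩ := η
  refine ⟨fun i => l.getD i false, ⟨l.length, List.length_pos_iff.2 hl⟩, Subtype.ext ?_⟩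
  refine List.ext_getElem (by simp [branchNode, initSeg]) ?_
  intro i h1 h2
  simp [branchNode, initSeg]

/-- The space `c₀₀(2^{<ℕ} \ {∅})`, to be equipped with the norm `‖·‖_T`. -/
def PreTreeSpace (_T : Descriptive.tree (Bool × ℕ+)) : Type := Node →₀ ℝ

instance (T : Descriptive.tree (Bool × ℕ+)) : AddCommGroup (PreTreeSpace T) :=
  inferInstanceAs (AddCommGroup (Node →₀ ℝ))

instance (T : Descriptive.tree (Bool × ℕ+)) : Module ℝ (PreTreeSpace T) :=
  inferInstanceAs (Module ℝ (Node →₀ ℝ))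

instance (T : Descriptive.tree (Bool × ℕ+)) : Norm (PreTreeSpace T) := ⟨treeNorm T⟩

theorem preTreeSpace_core (T : Descriptive.tree (Bool × ℕ+)) :
    NormedSpace.Core ℝ (PreTreeSpace T) where
  norm_nonneg x := Real.iSup_nonneg fun _ => tsirelsonNorm_nonneg _ _
  norm_smul a x := by
    change treeNorm T (a • (x : Node →₀ ℝ)) = ‖a‖ * treeNorm T x
    have h (σ : ℕ → Bool) : alongBranch σ (a • (x : Node →₀ ℝ)) = a • alongBranch σ x :=
      map_smul (alongBranch σ) a (x : Node →₀ ℝ)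
    simp only [treeNorm, Real.norm_eq_abs]
    rw [Real.mul_iSup_of_nonneg (abs_nonneg a)]
    congr 1
    funext σ
    rw [← tsirelsonNorm_smul, ← h]
  norm_triangle x y := by
    refine ciSup_le fun σ => ?_
    have : alongBranch σ (x + y) = alongBranch σ x + alongBranch σ y :=
      map_add (alongBranch σ) (x : Node →₀ ℝ) y
    rw [this]
    exact (tsirelsonNorm_add_le _ _ _).trans
      (add_le_add (le_ciSup (bddAbove_treeNorm T x) σ) (le_ciSup (bddAbove_treeNorm T y) σ))
  norm_eq_zero_iff x := by
    change treeNorm T (x : Node →₀ ℝ) = 0 ↔ (x : Node →₀ ℝ) = 0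
    constructor
    · intro h
      refine Finsupp.ext fun η => ?_
      obtain ⟨σ, ℓ, rfl⟩ := exists_branchNode_eq η
      have h1 := abs_apply_le_tsirelsonNorm (setSystem (treeSection T σ)) (alongBranch σ x) ℓ
      have h2 := le_ciSup (bddAbove_treeNorm T x) σ
      have h3 : |alongBranch σ x ℓ| ≤ 0 := h ▸ h1.trans h2
      exact abs_nonpos_iff.1 h3
    · intro h
      rw [h]
      exact treeNorm_zero T

instance (T : Descriptive.tree (Bool × ℕ+)) : NormedAddCommGroup (PreTreeSpace T) :=
  NormedAddCommGroup.ofCore (preTreeSpace_core T)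

instance (T : Descriptive.tree (Bool × ℕ+)) : NormedSpace ℝ (PreTreeSpace T) :=
  NormedSpace.ofCore (preTreeSpace_core T)

/-- The Banach space `E_T`: the completion of `c₀₀(2^{<ℕ} \ {∅})` with the norm `‖·‖_T`. -/
abbrev TreeBanachSpace (T : Descriptive.tree (Bool × ℕ+)) : Type :=
  UniformSpace.Completion (PreTreeSpace T)

end TreeSpace

end

/-!
For ill-founded sections the dual of `E_T` behaves like `ℓ₁`, and for a branch `σ` with a
well-founded section the functionals that live on `σ` form a complemented reflexive subspace.

**Shrinking.** Every three-element set belongs to every system `M_{T(σ)}`, so three consecutive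
blocks of norm one have a sum of norm at most `2`. Hence the tails of a functional tend to zero in
norm (`exists_dualNormOn_levelGE_le`).

**Ill-founded sections.** Suppose `6 δ(f_n) < c < ca(f_n)`. Some differences `g_m` of the `f_n` have
norm greater than `c` and a weak* limit `H` along an ultrafilter, with `‖H‖ ≤ δ`. The functionals
`h_m = g_m - H` tend to zero coordinatewise, so the numbers `‖h_m‖` restricted to the cones of the
Cantor tree become additive in the limit and define a finite measure on `2^ℕ`
(`exists_limit_cone`, `exists_measure_initSeg`). Since each `σ` has a branch in `T(σ)`, a sequence
`b` of bounds exists such that, up to a small measure, every initial segment is accompanied by an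
element of `T` with entries bounded by `b` (`exists_boundedNodes`). Blocks supported by such nodes
and far enough apart are separated along each branch by the partial sums of a single element of
`T(σ)`, and their sums have norm at most `2`; the remaining parts of the blocks contribute at most
`1` (`treeNorm_sum_blocks_le`). So a subsequence of `(h_m)` is almost normed by blocks all of whose
signed sums have norm at most `3` (`exists_blocks`), and a weak* limit of such sums in the bidual
gives `δ ≥ (c - δ + 3 δ) / 6 > δ`, a contradiction (`hasQuantitativeSchurProperty`).

**A well-founded section.** The set `Θ` of `M_{T(σ)}` is the convex hull of vectors, called
generators here, that are built by finitely many steps. If `T(σ)` has no infinite branch, then a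
tail of any pointwise limit of generators is half of such a limit (`exists_two_mul_tail_mem`).
Therefore normalized functionals with supports moving to infinity tend to zero on all these limits.
A bounded sequence of partial sums is represented by a probability measure on the compact set of
these limits, and dominated convergence shows that the unit vectors on `σ` are boundedly complete
(`tendsto_pairing_of_mem_theta`, `cauchySeq_sum_branchVec`). Being also shrinking, they span a
reflexive space, and so do the coefficient functionals (`isReflexiveSpace_branchDual`). The latter
are weakly null without being norm null, which together with the projection onto their span refutes
the Schur and the Dunford-Pettis property.
-/

open Filter Topology Set

noncomputable section

namespace TreeSpace

/-! ### Restrictions and separated sums in Tsirelson type norms -/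

section Restrict

variable {ι : Type*}

/-- The restriction of a finitely supported family to a set of indices, extended by zero. -/
def restrict (S : Set ι) : (ι →₀ ℝ) →ₗ[ℝ] (ι →₀ ℝ) where
  toFun x := letI := Classical.decPred (· ∈ S); x.filter (· ∈ S)
  map_add' _ _ := letI := Classical.decPred (· ∈ S); Finsupp.filter_add
  map_smul' _ _ := letI := Classical.decPred (· ∈ S); Finsupp.filter_smul

theorem restrict_apply_of_mem {S : Set ι} {i : ι} (hi : i ∈ S) (x : ι →₀ ℝ) :
    restrict S x i = x i :=
  letI := Classical.decPred (· ∈ S)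
  Finsupp.filter_apply_pos _ _ hi

theorem restrict_apply_of_notMem {S : Set ι} {i : ι} (hi : i ∉ S) (x : ι →₀ ℝ) :
    restrict S x i = 0 :=
  letI := Classical.decPred (· ∈ S)
  Finsupp.filter_apply_neg _ _ hi

theorem mem_of_restrict_apply_ne_zero {S : Set ι} {i : ι} {x : ι →₀ ℝ}
    (h : restrict S x i ≠ 0) : i ∈ S := by
  by_contra hi
  exact h (restrict_apply_of_notMem hi x)

theorem apply_ne_zero_of_restrict {S : Set ι} {i : ι} {x : ι →₀ ℝ}
    (h : restrict S x i ≠ 0) : x i ≠ 0 := by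
  rwa [restrict_apply_of_mem (mem_of_restrict_apply_ne_zero h)] at h

theorem restrict_eq_self {S : Set ι} {x : ι →₀ ℝ} (h : ∀ i, x i ≠ 0 → i ∈ S) :
    restrict S x = x := by
  ext i
  by_cases hi : i ∈ S
  · exact restrict_apply_of_mem hi x
  · rw [restrict_apply_of_notMem hi]
    by_contra h'
    exact hi (h i (Ne.symm h'))

theorem restrict_restrict (S S' : Set ι) (x : ι →₀ ℝ) :
    restrict S (restrict S' x) = restrict (S ∩ S') x := by
  ext i
  by_cases hi : i ∈ S <;> by_cases hi' : i ∈ S' <;>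
    simp [restrict_apply_of_mem, restrict_apply_of_notMem, hi, hi']

theorem restrict_add_restrict {S S' : Set ι} (h : Disjoint S S') (x : ι →₀ ℝ) :
    restrict S x + restrict S' x = restrict (S ∪ S') x := by
  ext i
  by_cases hi : i ∈ S
  · have hi' : i ∉ S' := fun h' => Set.disjoint_left.1 h hi h'
    simp [restrict_apply_of_mem, restrict_apply_of_notMem, hi, hi']
  · by_cases hi' : i ∈ S' <;>
      simp [restrict_apply_of_mem, restrict_apply_of_notMem, hi, hi']

theorem restrict_univ (x : ι →₀ ℝ) : restrict univ x = x :=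
  restrict_eq_self fun _ _ => mem_univ _

theorem restrict_single_of_mem {S : Set ι} {i : ι} (hi : i ∈ S) (a : ℝ) :
    restrict S (Finsupp.single i a) = Finsupp.single i a := by
  classical
  refine restrict_eq_self fun j hj => ?_
  by_cases h : i = j
  · exact h ▸ hi
  · simp [h] at hj

theorem restrict_single_of_notMem {S : Set ι} {i : ι} (hi : i ∉ S) (a : ℝ) :
    restrict S (Finsupp.single i a) = 0 := by
  classical
  ext j
  by_cases h : j ∈ S
  · rw [restrict_apply_of_mem h, Finsupp.single_apply, if_neg (by rintro rfl; exact hi h)]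
    rfl
  · rw [restrict_apply_of_notMem h]; rfl

end Restrict

section Theta

variable {M M' : Set (Set ℕ+)}

theorem smul_mem_theta {a : ℝ} (ha : |a| ≤ 1) {x : ℕ+ →₀ ℝ} (hx : x ∈ theta M) :
    a • x ∈ theta M :=
  balanced_iff_smul_mem.1 (isTsirelsonClosed_theta M).1.1 ha hx

theorem zero_mem_theta : (0 : ℕ+ →₀ ℝ) ∈ theta M := by
  simpa using smul_mem_theta (a := 0) (by simp) ((isTsirelsonClosed_theta M).2.1 1)

/-- Half of a sum of elements of `Θ_M` whose supports are separated by elements of a single member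
of `M` lies in `Θ_M`. Vanishing terms need no separating element. -/
theorem half_sum_mem_theta {ι : Type*} [LinearOrder ι] {A : Set ℕ+} (hA : A ∈ M) (I : Finset ι)
    (x : ι → ℕ+ →₀ ℝ) (m : ι → ℕ+) (hx : ∀ k ∈ I, x k ∈ theta M)
    (hm : ∀ k ∈ I, x k ≠ 0 → m k ∈ A) (h1 : ∀ k ∈ I, ∀ i, x k i ≠ 0 → m k ≤ i)
    (h2 : ∀ j ∈ I, ∀ k ∈ I, j < k → x k ≠ 0 → ∀ i, x j i ≠ 0 → i < m k) :
    (1 / 2 : ℝ) • ∑ k ∈ I, x k ∈ theta M := by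
  classical
  set J := I.filter fun k => x k ≠ 0 with hJ
  have hJI : ∀ k ∈ J, k ∈ I := fun k hk => (Finset.mem_filter.1 hk).1
  have hJ0 : ∀ k ∈ J, x k ≠ 0 := fun k hk => (Finset.mem_filter.1 hk).2
  have hsum : ∑ k ∈ I, x k = ∑ k ∈ J, x k := by
    rw [hJ, Finset.sum_filter_ne_zero]
  let e := J.orderIsoOfFin rfl
  have hsum2 : ∑ k ∈ J, x k = ∑ i : Fin J.card, x (e i) := by
    rw [← Finset.sum_coe_sort]
    exact (e.toEquiv.sum_comp fun k : J => x k).symm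
  have key := (isTsirelsonClosed_theta M).2.2 J.card (fun i => (x (e i)).support)
    (fun i => x (e i)) ?_ fun i => hx _ (hJI _ (e i).2)
  · rw [hsum, hsum2]
    convert key using 3 with i
    exact ((Finsupp.filter_eq_self_iff _ _).2 fun j hj => Finsupp.mem_support_iff.2 hj).symm
  · refine ⟨fun i => Finsupp.support_nonempty_iff.2 (hJ0 _ (e i).2), A, hA, fun i => m (e i),
      fun i => hm _ (hJI _ (e i).2) (hJ0 _ (e i).2), ?_, ?_⟩
    · intro i j hj
      exact h1 _ (hJI _ (e i).2) _ (Finsupp.mem_support_iff.1 hj)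
    · intro i j hij l hl
      exact h2 _ (hJI _ (e i).2) _ (hJI _ (e j).2) (e.strictMono hij) (hJ0 _ (e j).2) l
        (Finsupp.mem_support_iff.1 hl)

/-- `Θ_M` is stable under restrictions. -/
theorem restrict_mem_theta (S : Set ℕ+) {x : ℕ+ →₀ ℝ} (hx : x ∈ theta M) :
    restrict S x ∈ theta M := by
  obtain ⟨⟨hb, hc⟩, he, hs⟩ := isTsirelsonClosed_theta M
  refine hx {x | restrict S x ∈ theta M} ⟨⟨?_, ?_⟩, ?_, ?_⟩
  · rw [balanced_iff_smul_mem]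
    intro a ha x hx
    have := balanced_iff_smul_mem.1 hb ha hx
    rwa [← map_smul] at this
  · intro y hy z hz a b ha hb hab
    have := hc hy hz ha hb hab
    rwa [← map_smul, ← map_smul, ← map_add] at this
  · intro i
    by_cases hi : i ∈ S
    · simpa only [mem_ofPred_eq, restrict_single_of_mem hi] using he i
    · simpa only [mem_ofPred_eq, restrict_single_of_notMem hi] using zero_mem_theta
  · intro n E x hE hx
    have := hs n E (fun k => restrict S (x k)) hE hx
    rw [mem_ofPred_eq, map_smul, map_sum]
    convert this using 3 with k
    ext i
    by_cases hi : i ∈ S <;> by_cases hi' : i ∈ E k <;>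
      simp [restrict_apply_of_mem, restrict_apply_of_notMem, hi, hi']

/-- Restriction to `S` maps `Θ_M` into `Θ_{M'}`, provided that each finite part of a member of `M`
all of whose elements are bounded by elements of `S` is contained in a member of `M'`. -/
theorem restrict_mem_theta_of_forall {S : Set ℕ+}
    (h : ∀ A ∈ M, ∀ F : Finset ℕ+, (∀ m ∈ F, m ∈ A ∧ ∃ i ∈ S, m ≤ i) → ∃ A' ∈ M', ∀ m ∈ F, m ∈ A')
    {x : ℕ+ →₀ ℝ} (hx : x ∈ theta M) : restrict S x ∈ theta M' := by
  classical
  obtain ⟨⟨hb, hc⟩, he, hs⟩ := isTsirelsonClosed_theta M'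
  refine hx {x | restrict S x ∈ theta M'} ⟨⟨?_, ?_⟩, ?_, ?_⟩
  · rw [balanced_iff_smul_mem]
    intro a ha x hx
    have := balanced_iff_smul_mem.1 hb ha hx
    rwa [← map_smul] at this
  · intro y hy z hz a b ha hb hab
    have := hc hy hz ha hb hab
    rwa [← map_smul, ← map_smul, ← map_add] at this
  · intro i
    by_cases hi : i ∈ S
    · simpa only [mem_ofPred_eq, restrict_single_of_mem hi] using he i
    · simpa only [mem_ofPred_eq, restrict_single_of_notMem hi] using zero_mem_theta
  · rintro n E x ⟨-, A, hA, m, hmA, hm1, hm2⟩ hx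
    have hEx : ∀ k i, restrict S ((x k).filter (· ∈ E k)) i ≠ 0 → i ∈ S ∧ i ∈ E k := by
      intro k i hi
      refine ⟨mem_of_restrict_apply_ne_zero hi, ?_⟩
      by_contra h'
      exact apply_ne_zero_of_restrict hi (Finsupp.filter_apply_neg _ _ h')
    set J : Finset (Fin n) := Finset.univ.filter
      fun k => restrict S ((x k).filter (· ∈ E k)) ≠ 0 with hJ
    obtain ⟨A', hA', hFA'⟩ := h A hA (J.image m) (by
      intro _ hmF
      obtain ⟨k, hk, rfl⟩ := Finset.mem_image.1 hmF
      refine ⟨hmA k, ?_⟩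
      obtain ⟨i, hi⟩ := Finsupp.ne_iff.1 (Finset.mem_filter.1 hk).2
      exact ⟨i, (hEx k i hi).1, hm1 k i (hEx k i hi).2⟩)
    rw [mem_ofPred_eq, map_smul, map_sum]
    refine half_sum_mem_theta hA' Finset.univ _ m ?_ ?_ ?_ ?_
    · intro k _
      have : restrict S ((x k).filter (· ∈ E k)) = restrict ↑(E k) (restrict S (x k)) := by
        ext i
        by_cases hi : i ∈ S <;> by_cases hi' : i ∈ E k <;>
          simp [restrict_apply_of_mem, restrict_apply_of_notMem, hi, hi']
      rw [this]
      exact restrict_mem_theta _ (hx k)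
    · intro k _ hk
      exact hFA' _ (Finset.mem_image_of_mem _ (Finset.mem_filter.2 ⟨Finset.mem_univ _, hk⟩))
    · intro k _ i hi
      exact hm1 k i (hEx k i hi).2
    · intro j _ k _ hjk _ i hi
      exact hm2 j k hjk i (hEx j i hi).2

theorem mem_theta_of_tsirelsonNorm_lt_one {x : ℕ+ →₀ ℝ} (h : tsirelsonNorm M x < 1) :
    x ∈ theta M :=
  setOfPred_gauge_lt_one_subset_self (isTsirelsonClosed_theta M).1.2 zero_mem_theta
    (absorbent_theta M) h

theorem tsirelsonNorm_le_one {x : ℕ+ →₀ ℝ} (hx : x ∈ theta M) : tsirelsonNorm M x ≤ 1 :=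
  gauge_le_one_of_mem hx

theorem tsirelsonNorm_zero : tsirelsonNorm M 0 = 0 := gauge_zero

theorem tsirelsonNorm_le_of_smul_mem {x : ℕ+ →₀ ℝ} {r : ℝ} (hr : 0 ≤ r)
    (h : ∀ s > r, s⁻¹ • x ∈ theta M) : tsirelsonNorm M x ≤ r := by
  refine le_of_forall_gt_imp_ge_of_dense fun s hs => ?_
  have hs0 : 0 < s := hr.trans_lt hs
  have := tsirelsonNorm_le_one (h s hs)
  rw [tsirelsonNorm_smul, abs_of_pos (inv_pos.2 hs0), inv_mul_le_iff₀ hs0, mul_one] at this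
  exact this

theorem inv_smul_mem_theta {x : ℕ+ →₀ ℝ} {s : ℝ} (h : tsirelsonNorm M x < s) :
    s⁻¹ • x ∈ theta M := by
  have hs0 : 0 < s := (tsirelsonNorm_nonneg M x).trans_lt h
  refine mem_theta_of_tsirelsonNorm_lt_one ?_
  rw [tsirelsonNorm_smul, abs_of_pos (inv_pos.2 hs0)]
  exact (inv_mul_lt_one₀ hs0).2 h

theorem tsirelsonNorm_map_le (L : (ℕ+ →₀ ℝ) →ₗ[ℝ] (ℕ+ →₀ ℝ))
    (h : ∀ x ∈ theta M, L x ∈ theta M') (x : ℕ+ →₀ ℝ) :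
    tsirelsonNorm M' (L x) ≤ tsirelsonNorm M x := by
  refine tsirelsonNorm_le_of_smul_mem (tsirelsonNorm_nonneg M x) fun s hs => ?_
  rw [← map_smul]
  exact h _ (inv_smul_mem_theta hs)

theorem tsirelsonNorm_restrict_le (S : Set ℕ+) (x : ℕ+ →₀ ℝ) :
    tsirelsonNorm M (restrict S x) ≤ tsirelsonNorm M x :=
  tsirelsonNorm_map_le _ (fun _ => restrict_mem_theta S) x

/-- A sum of vectors of norm at most `r` whose supports are separated by elements of a single
member of `M` has norm at most `2 r`. -/
theorem tsirelsonNorm_sum_le {ι : Type*} [LinearOrder ι] {A : Set ℕ+} (hA : A ∈ M) (I : Finset ι)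
    (x : ι → ℕ+ →₀ ℝ) (m : ι → ℕ+) {r : ℝ} (hr : 0 ≤ r)
    (hx : ∀ k ∈ I, tsirelsonNorm M (x k) ≤ r)
    (hm : ∀ k ∈ I, x k ≠ 0 → m k ∈ A) (h1 : ∀ k ∈ I, ∀ i, x k i ≠ 0 → m k ≤ i)
    (h2 : ∀ j ∈ I, ∀ k ∈ I, j < k → x k ≠ 0 → ∀ i, x j i ≠ 0 → i < m k) :
    tsirelsonNorm M (∑ k ∈ I, x k) ≤ 2 * r := by
  refine tsirelsonNorm_le_of_smul_mem (by positivity) fun s hs => ?_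
  have h0 : ∀ {k i}, ((s / 2)⁻¹ • x k) i ≠ 0 → x k i ≠ 0 := fun h h' => h (by simp [h'])
  have h0' : ∀ {k}, (s / 2)⁻¹ • x k ≠ 0 → x k ≠ 0 := fun h h' => h (by simp [h'])
  have := half_sum_mem_theta hA I (fun k => (s / 2)⁻¹ • x k) m
    (fun k hk => inv_smul_mem_theta ((hx k hk).trans_lt (by linarith)))
    (fun k hk h => hm k hk (h0' h)) (fun k hk i hi => h1 k hk i (h0 hi))
    (fun j hj k hk hjk h i hi => h2 j hj k hk hjk (h0' h) i (h0 hi))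
  rw [← Finset.smul_sum, smul_smul] at this
  convert this using 2
  rw [inv_div]
  ring

end Theta

/-! ### Restrictions of functionals on the tree space -/

section DualNorm

variable {T : Descriptive.tree (Bool × ℕ+)}

theorem tsirelsonNorm_alongBranch_le (T : Descriptive.tree (Bool × ℕ+)) (σ : ℕ → Bool)
    (x : Node →₀ ℝ) :
    tsirelsonNorm (setSystem (treeSection T σ)) (alongBranch σ x) ≤ treeNorm T x :=
  le_ciSup (bddAbove_treeNorm T x) σ

theorem treeNorm_le {x : Node →₀ ℝ} {r : ℝ}
    (h : ∀ σ, tsirelsonNorm (setSystem (treeSection T σ)) (alongBranch σ x) ≤ r) :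
    treeNorm T x ≤ r :=
  ciSup_le h

theorem treeNorm_nonneg (x : Node →₀ ℝ) : 0 ≤ treeNorm T x :=
  Real.iSup_nonneg fun _ => tsirelsonNorm_nonneg _ _

theorem alongBranch_restrict (σ : ℕ → Bool) (S : Set Node) (x : Node →₀ ℝ) :
    alongBranch σ (restrict S x) = restrict (branchNode σ ⁻¹' S) (alongBranch σ x) := by
  ext i
  rw [alongBranch_apply]
  by_cases hi : branchNode σ i ∈ S
  · rw [restrict_apply_of_mem hi, restrict_apply_of_mem (mem_preimage.2 hi), alongBranch_apply]
  · rw [restrict_apply_of_notMem hi, restrict_apply_of_notMem (fun h => hi (mem_preimage.1 h))]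

theorem treeNorm_restrict_le (S : Set Node) (x : Node →₀ ℝ) :
    treeNorm T (restrict S x) ≤ treeNorm T x :=
  treeNorm_le fun σ => by
    rw [alongBranch_restrict]
    exact (tsirelsonNorm_restrict_le _ _).trans (tsirelsonNorm_alongBranch_le T σ x)

/-- The identification of `c₀₀` with the normed space `PreTreeSpace T`. -/
def ofFinsupp (T : Descriptive.tree (Bool × ℕ+)) : (Node →₀ ℝ) ≃ₗ[ℝ] PreTreeSpace T :=
  LinearEquiv.refl ℝ (Node →₀ ℝ)

theorem norm_ofFinsupp (x : Node →₀ ℝ) : ‖ofFinsupp T x‖ = treeNorm T x := rfl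

theorem treeNorm_add_le (x y : Node →₀ ℝ) : treeNorm T (x + y) ≤ treeNorm T x + treeNorm T y := by
  simpa only [← norm_ofFinsupp, map_add] using norm_add_le (ofFinsupp T x) (ofFinsupp T y)

theorem treeNorm_smul (a : ℝ) (x : Node →₀ ℝ) : treeNorm T (a • x) = |a| * treeNorm T x := by
  have := norm_smul a (ofFinsupp T x)
  rwa [Real.norm_eq_abs, ← map_smul] at this

theorem treeNorm_single_le (η : Node) (a : ℝ) : treeNorm T (Finsupp.single η a) ≤ |a| := by
  refine treeNorm_le fun σ => ?_
  by_cases h : ∃ ℓ, branchNode σ ℓ = η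
  · obtain ⟨ℓ, rfl⟩ := h
    have : alongBranch σ (Finsupp.single (branchNode σ ℓ) a) = Finsupp.single ℓ a := by
      ext k
      simp [alongBranch_apply, Finsupp.single_apply, (branchNode_injective σ).eq_iff]
    rw [this]
    exact tsirelsonNorm_single_le _ _ _
  · have : alongBranch σ (Finsupp.single η a) = 0 := by
      ext k
      rw [alongBranch_apply, Finsupp.single_apply, if_neg fun hk => h ⟨k, hk.symm⟩,
        Finsupp.zero_apply]
    rw [this, tsirelsonNorm_zero]
    exact abs_nonneg a

theorem abs_apply_le_treeNorm (x : Node →₀ ℝ) (η : Node) : |x η| ≤ treeNorm T x := by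
  obtain ⟨σ, ℓ, rfl⟩ := exists_branchNode_eq η
  exact (abs_apply_le_tsirelsonNorm _ (alongBranch σ x) ℓ).trans
    (tsirelsonNorm_alongBranch_le T σ x)

/-- Restriction to a set of nodes, as a bounded operator. -/
def restrictL (T : Descriptive.tree (Bool × ℕ+)) (S : Set Node) :
    PreTreeSpace T →L[ℝ] PreTreeSpace T :=
  LinearMap.mkContinuous ((ofFinsupp T).toLinearMap ∘ₗ restrict S ∘ₗ (ofFinsupp T).symm.toLinearMap)
    1 fun x => by
      rw [one_mul]
      exact treeNorm_restrict_le S ((ofFinsupp T).symm x)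

theorem restrictL_ofFinsupp (S : Set Node) (x : Node →₀ ℝ) :
    restrictL T S (ofFinsupp T x) = ofFinsupp T (restrict S x) := rfl

theorem ext_ofFinsupp {F : Type*} [NormedAddCommGroup F] [NormedSpace ℝ F]
    {f g : PreTreeSpace T →L[ℝ] F} (h : ∀ x, f (ofFinsupp T x) = g (ofFinsupp T x)) : f = g :=
  ContinuousLinearMap.ext fun x => h ((ofFinsupp T).symm x)

/-- The norm of the restriction of a functional to a set of nodes. -/
def dualNormOn (h : StrongDual ℝ (PreTreeSpace T)) (S : Set Node) : ℝ := ‖h.comp (restrictL T S)‖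

variable (h : StrongDual ℝ (PreTreeSpace T)) {S S' : Set Node}

theorem dualNormOn_nonneg : 0 ≤ dualNormOn h S := norm_nonneg _

variable {h} in
theorem dualNormOn_le {r : ℝ} (hr : 0 ≤ r)
    (hx : ∀ x : Node →₀ ℝ, (∀ η, x η ≠ 0 → η ∈ S) → |h (ofFinsupp T x)| ≤ r * treeNorm T x) :
    dualNormOn h S ≤ r := by
  refine ContinuousLinearMap.opNorm_le_bound _ hr fun x => ?_
  refine (hx (restrict S ((ofFinsupp T).symm x)) fun η => mem_of_restrict_apply_ne_zero).trans ?_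
  exact mul_le_mul_of_nonneg_left (treeNorm_restrict_le _ _) hr

theorem abs_le_dualNormOn {x : Node →₀ ℝ} (hx : ∀ η, x η ≠ 0 → η ∈ S) :
    |h (ofFinsupp T x)| ≤ dualNormOn h S * treeNorm T x := by
  have := (h.comp (restrictL T S)).le_opNorm (ofFinsupp T x)
  rwa [ContinuousLinearMap.comp_apply, restrictL_ofFinsupp, restrict_eq_self hx] at this

theorem dualNormOn_mono (hS : S ⊆ S') : dualNormOn h S ≤ dualNormOn h S' :=
  dualNormOn_le (dualNormOn_nonneg h) fun _ hx => abs_le_dualNormOn h fun η hη => hS (hx η hη)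

theorem dualNormOn_univ : dualNormOn h univ = ‖h‖ := by
  have : h.comp (restrictL T univ) = h := ext_ofFinsupp fun x => by
    rw [ContinuousLinearMap.comp_apply, restrictL_ofFinsupp, restrict_univ]
  rw [dualNormOn, this]

theorem dualNormOn_le_norm : dualNormOn h S ≤ ‖h‖ := by
  rw [← dualNormOn_univ h]
  exact dualNormOn_mono h (subset_univ S)

theorem dualNormOn_union_le : dualNormOn h (S ∪ S') ≤ dualNormOn h S + dualNormOn h S' := by
  refine dualNormOn_le (add_nonneg (dualNormOn_nonneg h) (dualNormOn_nonneg h)) fun x hx => ?_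
  have hx' : x = restrict S x + restrict (S' \ S) x := by
    rw [restrict_add_restrict disjoint_sdiff_right, union_sdiff_self, restrict_eq_self hx]
  have h1 := abs_le_dualNormOn h (S := S) (x := restrict S x)
    fun η => mem_of_restrict_apply_ne_zero
  have h2 := abs_le_dualNormOn h (S := S') (x := restrict (S' \ S) x)
    fun η hη => (mem_of_restrict_apply_ne_zero hη).1
  calc |h (ofFinsupp T x)|
      = |h (ofFinsupp T (restrict S x)) + h (ofFinsupp T (restrict (S' \ S) x))| := by
        rw [← map_add, ← map_add, ← hx']
    _ ≤ _ := abs_add_le _ _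
    _ ≤ dualNormOn h S * treeNorm T x + dualNormOn h S' * treeNorm T x := by
        gcongr
        · exact h1.trans (mul_le_mul_of_nonneg_left (treeNorm_restrict_le _ _)
            (dualNormOn_nonneg h))
        · exact h2.trans (mul_le_mul_of_nonneg_left (treeNorm_restrict_le _ _)
            (dualNormOn_nonneg h))
    _ = _ := (add_mul _ _ _).symm

theorem dualNormOn_empty : dualNormOn h ∅ = 0 := by
  refine le_antisymm (dualNormOn_le le_rfl fun x hx => ?_) (dualNormOn_nonneg h)
  have : x = 0 := by
    ext η
    by_contra hη
    exact hx η hη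
  simp [this]

theorem dualNormOn_biUnion_le {κ : Type*} (I : Finset κ) (S : κ → Set Node) :
    dualNormOn h (⋃ i ∈ I, S i) ≤ ∑ i ∈ I, dualNormOn h (S i) := by
  classical
  induction I using Finset.induction_on with
  | empty => simp [dualNormOn_empty]
  | insert i I hi ih =>
    rw [Finset.set_biUnion_insert, Finset.sum_insert hi]
    exact (dualNormOn_union_le h).trans (by gcongr)

theorem dualNormOn_singleton_le (η : Node) :
    dualNormOn h {η} ≤ |h (ofFinsupp T (Finsupp.single η 1))| := by
  refine dualNormOn_le (abs_nonneg _) fun x hx => ?_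
  have : x = x η • Finsupp.single η 1 := by
    ext ζ
    by_cases hζ : ζ = η
    · subst hζ; simp
    · have : x ζ = 0 := by
        by_contra h'
        exact hζ (hx ζ h')
      simp [this, Ne.symm hζ]
  rw [this, map_smul, map_smul, smul_eq_mul, abs_mul, ← this, mul_comm]
  exact mul_le_mul_of_nonneg_left (abs_apply_le_treeNorm x η) (abs_nonneg _)

theorem exists_lt_of_lt_dualNormOn {a : ℝ} (ha : a < dualNormOn h S) :
    ∃ x : Node →₀ ℝ, (∀ η, x η ≠ 0 → η ∈ S) ∧ treeNorm T x ≤ 1 ∧ a < h (ofFinsupp T x) := by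
  rcases lt_or_ge a 0 with h0 | h0
  · refine ⟨0, by simp, ?_, by simpa using h0⟩
    rw [treeNorm_zero]
    exact zero_le_one
  obtain ⟨x, hx1, hx2⟩ := (h.comp (restrictL T S)).exists_lt_apply_of_lt_opNorm ha
  have hn : treeNorm T (restrict S ((ofFinsupp T).symm x)) ≤ 1 :=
    (treeNorm_restrict_le _ _).trans hx1.le
  have hs : ∀ η, restrict S ((ofFinsupp T).symm x) η ≠ 0 → η ∈ S :=
    fun η => mem_of_restrict_apply_ne_zero
  change a < |h (ofFinsupp T (restrict S ((ofFinsupp T).symm x)))| at hx2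
  rcases lt_abs.1 hx2 with h' | h'
  · exact ⟨_, hs, hn, h'⟩
  · refine ⟨(-1 : ℝ) • restrict S ((ofFinsupp T).symm x), fun η hη => hs η fun h0 => hη ?_, ?_, ?_⟩
    · simp [h0]
    · rw [treeNorm_smul]; simpa using hn
    · simpa using h'

/-- On sets of nodes that no branch meets simultaneously, the norm of the tree space is a maximum,
so that the dual norm is additive. -/
theorem add_dualNormOn_le
    (hS : ∀ σ k l, branchNode σ k ∈ S → branchNode σ l ∉ S') :
    dualNormOn h S + dualNormOn h S' ≤ dualNormOn h (S ∪ S') := by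
  refine le_of_forall_pos_lt_add fun ε hε => ?_
  obtain ⟨x, hx1, hx2, hx3⟩ := exists_lt_of_lt_dualNormOn h (S := S)
    (sub_lt_self _ (half_pos hε))
  obtain ⟨y, hy1, hy2, hy3⟩ := exists_lt_of_lt_dualNormOn h (S := S')
    (sub_lt_self _ (half_pos hε))
  have hxy : treeNorm T (x + y) ≤ 1 := by
    refine treeNorm_le fun σ => ?_
    by_cases hσ : ∃ k, branchNode σ k ∈ S
    · obtain ⟨k, hk⟩ := hσ
      have : alongBranch σ y = 0 := by
        ext l
        by_contra hl
        exact hS σ k l hk (hy1 _ hl)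
      rw [map_add, this, add_zero]
      exact (tsirelsonNorm_alongBranch_le T σ x).trans hx2
    · have : alongBranch σ x = 0 := by
        ext l
        by_contra hl
        exact hσ ⟨l, hx1 _ hl⟩
      rw [map_add, this, zero_add]
      exact (tsirelsonNorm_alongBranch_le T σ y).trans hy2
  have := abs_le_dualNormOn h (S := S ∪ S') (x := x + y) fun η hη => by
    by_cases h' : x η = 0
    · exact Or.inr (hy1 η fun h'' => hη (by simp [h', h'']))
    · exact Or.inl (hx1 η h')
  have h2 := mul_le_mul_of_nonneg_left hxy (dualNormOn_nonneg h (S := S ∪ S'))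
  have h3 := le_abs_self (h (ofFinsupp T (x + y)))
  rw [map_add, map_add] at h3
  rw [map_add, map_add] at this
  linarith

/-! ### The basis of the tree space is shrinking -/

/-- The set of all nodes of level at least `p`. -/
def levelGE (p : ℕ) : Set Node := {η | p ≤ η.1.length}

theorem length_branchNode (σ : ℕ → Bool) (ℓ : ℕ+) : (branchNode σ ℓ).1.length = ℓ :=
  length_initSeg σ ℓ

theorem exists_mem_setSystem_triple (T : Descriptive.tree ℕ+) {p q r : ℕ+} (hpq : p < q)
    (hqr : q < r) : ∃ A ∈ setSystem T, p ∈ A ∧ q ∈ A ∧ r ∈ A := by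
  have hpq' : (p : ℕ) < q := hpq
  have hqr' : (q : ℕ) < r := hqr
  refine ⟨finPartialSums [p, q - p, r - q], Or.inl ⟨_, Or.inr (by simp), rfl⟩,
    ⟨1, le_rfl, by simp, by simp⟩, ⟨2, by simp, by simp, ?_⟩, ⟨3, by simp, by simp, ?_⟩⟩ <;>
  · simp [PNat.sub_coe, hpq, hqr]
    omega

/-- Three consecutive blocks of norm at most `c` have a sum of norm at most `2 c`, since every
three-element set belongs to every one of the set systems. -/
theorem treeNorm_add_add_le {x y z : Node →₀ ℝ} {p q r : ℕ+} {c : ℝ} (hc : 0 ≤ c) (hpq : p < q)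
    (hqr : q < r) (hx : treeNorm T x ≤ c) (hy : treeNorm T y ≤ c) (hz : treeNorm T z ≤ c)
    (hx' : ∀ η, x η ≠ 0 → (p : ℕ) ≤ η.1.length ∧ η.1.length < q)
    (hy' : ∀ η, y η ≠ 0 → (q : ℕ) ≤ η.1.length ∧ η.1.length < r)
    (hz' : ∀ η, z η ≠ 0 → (r : ℕ) ≤ η.1.length) :
    treeNorm T (x + y + z) ≤ 2 * c := by
  refine treeNorm_le fun σ => ?_
  obtain ⟨A, hA, hp, hq, hr⟩ := exists_mem_setSystem_triple (treeSection T σ) hpq hqr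
  have key := tsirelsonNorm_sum_le hA Finset.univ
    ![alongBranch σ x, alongBranch σ y, alongBranch σ z] ![p, q, r] hc ?_ ?_ ?_ ?_
  · simpa [Fin.sum_univ_three] using key
  · intro k _
    fin_cases k
    · exact (tsirelsonNorm_alongBranch_le T σ x).trans hx
    · exact (tsirelsonNorm_alongBranch_le T σ y).trans hy
    · exact (tsirelsonNorm_alongBranch_le T σ z).trans hz
  · intro k _ _
    fin_cases k
    exacts [hp, hq, hr]
  · intro k _ i hi
    fin_cases k
    · simpa [length_branchNode] using (hx' (branchNode σ i) hi).1
    · simpa [length_branchNode] using (hy' (branchNode σ i) hi).1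
    · simpa [length_branchNode] using hz' (branchNode σ i) hi
  · intro j _ k _ hjk _ i hi
    have h0 : j = 0 → (i : ℕ) < q := by
      rintro rfl
      simpa [length_branchNode] using (hx' (branchNode σ i) hi).2
    have h1 : j = 1 → (i : ℕ) < r := by
      rintro rfl
      simpa [length_branchNode] using (hy' (branchNode σ i) hi).2
    have hqr' : (q : ℕ) < r := hqr
    fin_cases k
    · simp at hjk
    · have : j = 0 := (by decide : ∀ j : Fin 3, j < 1 → j = 0) j hjk
      exact h0 this
    · rcases (by decide : ∀ j : Fin 3, j < 2 → j = 0 ∨ j = 1) j hjk with h' | h'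
      · exact (h0 h').trans hqr'
      · exact h1 h'

theorem exists_level_bound (x : Node →₀ ℝ) : ∃ q : ℕ, ∀ η, x η ≠ 0 → η.1.length < q := by
  refine ⟨x.support.sup (fun η => η.1.length) + 1, fun η hη => Nat.lt_succ_of_le ?_⟩
  exact Finset.le_sup (f := fun η : Node => η.1.length) (Finsupp.mem_support_iff.2 hη)

/-- The norms of the restrictions of a functional to the nodes of large level tend to zero: three
blocks on which the functional is almost as large as on all of `levelGE p` have a sum of norm at
most `2`. -/
theorem exists_dualNormOn_levelGE_le {ε : ℝ} (hε : 0 < ε) :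
    ∃ p, dualNormOn h (levelGE p) ≤ ε := by
  by_contra! hcon
  have hbdd : BddBelow (range fun p => dualNormOn h (levelGE p)) :=
    ⟨0, by rintro _ ⟨p, rfl⟩; exact dualNormOn_nonneg h⟩
  set t := ⨅ p, dualNormOn h (levelGE p) with ht
  have ht0 : 0 < t := hε.trans_le (le_ciInf fun p => (hcon p).le)
  -- The constants satisfy `3 * 0.9 > 2 * 1.1`.
  obtain ⟨p, hp⟩ := exists_lt_of_ciInf_lt (show t < 1.1 * t by linarith)
  have block : ∀ q : ℕ, ∃ (x : Node →₀ ℝ) (r : ℕ), q < r ∧ treeNorm T x ≤ 1 ∧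
      (∀ η, x η ≠ 0 → q ≤ η.1.length ∧ η.1.length < r) ∧ 0.9 * t < h (ofFinsupp T x) := by
    intro q
    have hq : 0.9 * t < dualNormOn h (levelGE q) :=
      lt_of_lt_of_le (by linarith) (ciInf_le hbdd q)
    obtain ⟨x, hx1, hx2, hx3⟩ := exists_lt_of_lt_dualNormOn h hq
    obtain ⟨r, hr⟩ := exists_level_bound x
    exact ⟨x, max r (q + 1), by simp, hx2, fun η hη => ⟨hx1 η hη,
      (hr η hη).trans_le (le_max_left _ _)⟩, hx3⟩
  obtain ⟨x, q, hpq, hx, hxs, hxh⟩ := block (p + 1)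
  obtain ⟨y, r, hqr, hy, hys, hyh⟩ := block q
  obtain ⟨z, s, -, hz, hzs, hzh⟩ := block r
  have hn := treeNorm_add_add_le (T := T) (p := ⟨p + 1, p.succ_pos⟩) (q := ⟨q, by omega⟩)
    (r := ⟨r, by omega⟩) zero_le_one hpq hqr hx hy hz hxs hys fun η hη => (hzs η hη).1
  have hle := abs_le_dualNormOn h (S := levelGE p) (x := x + y + z) fun η hη => by
    by_cases h1 : x η = 0
    · by_cases h2 : y η = 0
      · have h3 : z η ≠ 0 := fun h3 => hη (by simp [h1, h2, h3])
        have := (hzs η h3).1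
        exact (show p ≤ η.1.length by omega)
      · have := (hys η h2).1
        exact (show p ≤ η.1.length by omega)
    · have := (hxs η h1).1
      exact (show p ≤ η.1.length by omega)
  have h2 := mul_le_mul hp.le hn (treeNorm_nonneg _) (by positivity)
  have h3 := le_abs_self (h (ofFinsupp T (x + y + z)))
  rw [map_add, map_add, map_add, map_add] at h3
  rw [map_add, map_add, map_add, map_add] at hle
  linarith

end DualNorm

/-! ### Bounded branches carry almost all of a finite measure -/

theorem initSeg_take {A : Type*} (σ : ℕ → A) {l n : ℕ} (h : l ≤ n) :
    (initSeg σ n).take l = initSeg σ l := by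
  refine List.ext_getElem (by simp [length_initSeg, h]) fun i _ _ => ?_
  simp [initSeg]

/-- The nodes `η` of the Cantor tree that are completed to an element of `T` by a sequence with
entries bounded by `b`. -/
def boundedNodes (T : Descriptive.tree (Bool × ℕ+)) (b : ℕ → ℕ) : Set (List Bool) :=
  {η | ∃ ν : List ℕ+, ν.length = η.length ∧ (∀ i (hi : i < ν.length), (ν[i] : ℕ) ≤ b i) ∧
    η.zip ν ∈ T}

theorem take_mem_boundedNodes {T : Descriptive.tree (Bool × ℕ+)} {b : ℕ → ℕ} {η : List Bool}
    (h : η ∈ boundedNodes T b) (n : ℕ) : η.take n ∈ boundedNodes T b := by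
  obtain ⟨ν, h1, h2, h3⟩ := h
  refine ⟨ν.take n, by simp [h1], fun i hi => ?_, ?_⟩
  · rw [List.getElem_take]
    exact h2 i _
  · have : (η.take n).zip (ν.take n) = (η.zip ν).take n := List.take_zipWith.symm
    rw [this]
    exact Descriptive.Tree.mem_of_prefix (List.take_prefix _ _) h3

/-- A finitely additive function on the nodes of the Cantor tree is given by a measure. -/
theorem exists_measure_initSeg {μ : List Bool → ℝ} (h0 : ∀ η, 0 ≤ μ η)
    (hadd : ∀ η, μ η = μ (η ++ [false]) + μ (η ++ [true])) :
    ∃ m : MeasureTheory.FiniteMeasure (ℕ → Bool), ∀ (l : ℕ) (D : Set (List Bool)),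
      (m : MeasureTheory.Measure (ℕ → Bool)).real {σ | initSeg σ l ∈ D} =
        ∑ s : Fin l → Bool, D.indicator μ (List.ofFn s) := by
  classical
  -- Sums over level `n` of functions of the first `l` entries reduce to sums over level `l`.
  have hQ : ∀ (g : List Bool → ℝ) (l n : ℕ), l ≤ n →
      ∑ s : Fin n → Bool, μ (List.ofFn s) * g ((List.ofFn s).take l) =
        ∑ s : Fin l → Bool, μ (List.ofFn s) * g (List.ofFn s) := by
    intro g l n hln
    induction n, hln using Nat.le_induction with
    | base =>
      refine Finset.sum_congr rfl fun s _ => ?_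
      rw [List.take_of_length_le (by simp)]
    | succ n hn ih =>
      rw [← ih, ← (Fin.snocEquiv fun _ : Fin (n + 1) => Bool).sum_comp, Fintype.sum_prod_type_right]
      refine Finset.sum_congr rfl fun s _ => ?_
      have hs : ∀ a : Bool, List.ofFn ((Fin.snocEquiv fun _ : Fin (n + 1) => Bool) (a, s)) =
          List.ofFn s ++ [a] := fun a => by
        rw [List.ofFn_succ_last]
        simp [Fin.snocEquiv]
      simp only [hs, Fintype.univ_bool, Finset.mem_singleton, Bool.true_eq_false, not_false_eq_true,
        Finset.sum_insert, Finset.sum_singleton]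
      rw [List.take_append_of_le_length (by simpa using hn),
        List.take_append_of_le_length (by simpa using hn), hadd (List.ofFn s)]
      ring
  let ext : ∀ n : ℕ, (Fin n → Bool) → ℕ → Bool :=
    fun n s i => if hi : i < n then s ⟨i, hi⟩ else false
  have hext : ∀ (n : ℕ) (s : Fin n → Bool), initSeg (ext n s) n = List.ofFn s := by
    intro n s
    simp [initSeg, ext]
  -- The measure is a weak cluster point of discrete measures on the finite sequences of length
  -- `n`, extended by `false`.
  let ν : ℕ → MeasureTheory.Measure (ℕ → Bool) := fun n =>
    ∑ s : Fin n → Bool, ENNReal.ofReal (μ (List.ofFn s)) • MeasureTheory.Measure.dirac (ext n s)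
  have hνfin : ∀ n, MeasureTheory.IsFiniteMeasure (ν n) := fun n => by
    constructor
    simp [ν, ENNReal.ofReal_lt_top]
  have hint : ∀ (n : ℕ) (f : BoundedContinuousFunction (ℕ → Bool) ℝ),
      ∫ σ, f σ ∂(ν n) = ∑ s : Fin n → Bool, μ (List.ofFn s) * f (ext n s) := by
    intro n f
    rw [MeasureTheory.integral_finsetSum_measure]
    · refine Finset.sum_congr rfl fun s _ => ?_
      rw [MeasureTheory.integral_smul_measure, MeasureTheory.integral_dirac,
        ENNReal.toReal_ofReal (h0 _), smul_eq_mul]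
    · intro s _
      exact (f.integrable (MeasureTheory.Measure.dirac (ext n s))).smul_measure
        ENNReal.ofReal_ne_top
  let ρ : ℕ → MeasureTheory.FiniteMeasure (ℕ → Bool) := fun n => ⟨ν n, hνfin n⟩
  have hmass : ∀ n, (ρ n).mass ≤ (μ []).toNNReal := by
    intro n
    have h1 : ν n univ = ENNReal.ofReal (μ []) := by
      simp only [ν, MeasureTheory.Measure.coe_finsetSum, Finset.sum_apply,
        MeasureTheory.Measure.smul_apply, MeasureTheory.measure_univ, smul_eq_mul, mul_one]
      rw [← ENNReal.ofReal_sum_of_nonneg fun s _ => h0 _]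
      congr 1
      simpa using hQ (fun _ => 1) 0 n (Nat.zero_le n)
    rw [← ENNReal.coe_le_coe, MeasureTheory.FiniteMeasure.ennreal_mass]
    exact h1.le
  obtain ⟨m, -, hm⟩ := (isCompact_setOfPred_finiteMeasure_le_of_compactSpace (ℕ → Bool)
    (μ []).toNNReal).ultrafilter_le_nhds' ((hyperfilter ℕ).map ρ)
    (by rw [Ultrafilter.mem_map]; exact Filter.univ_mem' hmass)
  refine ⟨m, fun l D => ?_⟩
  have hclopen : IsClopen {σ : ℕ → Bool | initSeg σ l ∈ D} := by
    have hc : Continuous fun (σ : ℕ → Bool) (i : Fin l) => σ i := by fun_prop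
    exact (isClopen_discrete {s : Fin l → Bool | List.ofFn s ∈ D}).preimage hc
  have hlim := MeasureTheory.FiniteMeasure.tendsto_iff_forall_integral_tendsto.1
    (show Tendsto ρ (hyperfilter ℕ) (𝓝 m) from hm) (BoundedContinuousFunction.indicator _ hclopen)
  have hev : ∀ᶠ n in (hyperfilter ℕ : Filter ℕ), ∫ σ,
      (BoundedContinuousFunction.indicator _ hclopen : BoundedContinuousFunction (ℕ → Bool) ℝ) σ
        ∂(ν n) = ∑ s : Fin l → Bool, D.indicator μ (List.ofFn s) := by
    have hle : (hyperfilter ℕ : Filter ℕ) ≤ atTop := Nat.hyperfilter_le_atTop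
    filter_upwards [hle (eventually_ge_atTop l)] with n hn
    rw [hint]
    have := hQ (D.indicator 1) l n hn
    rw [show ∑ s : Fin l → Bool, D.indicator μ (List.ofFn s) =
      ∑ s : Fin l → Bool, μ (List.ofFn s) * D.indicator 1 (List.ofFn s) by
        refine Finset.sum_congr rfl fun s _ => ?_
        by_cases hs : List.ofFn s ∈ D <;> simp [hs], ← this]
    refine Finset.sum_congr rfl fun s _ => ?_
    congr 1
    rw [← hext n s, initSeg_take _ hn]
    simp [Set.indicator_apply]
  have := tendsto_nhds_unique hlim (tendsto_const_nhds.congr' (hev.mono fun n hn => hn.symm))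
  rw [← this]
  have h2 : (fun σ => (BoundedContinuousFunction.indicator _ hclopen :
      BoundedContinuousFunction (ℕ → Bool) ℝ) σ) =
      {σ : ℕ → Bool | initSeg σ l ∈ D}.indicator 1 := by
    ext σ
    simp
  rw [h2, MeasureTheory.integral_indicator_one hclopen.isOpen.measurableSet]

/-- If all sections of `T` are ill-founded, then every finitely additive function on the nodes of
the Cantor tree is, up to `ε`, concentrated on the nodes with completions bounded by a single
sequence `b`. The entries of `b` are chosen one after the other, by continuity from below of the
measure on the sets of all `σ` with a branch of `T(σ)` whose first entries obey the bounds. These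
sets need not be measurable. -/
theorem exists_boundedNodes {T : Descriptive.tree (Bool × ℕ+)}
    (hT : ∀ σ : ℕ → Bool, IllFounded (treeSection T σ)) {μ : List Bool → ℝ} (h0 : ∀ η, 0 ≤ μ η)
    (hadd : ∀ η, μ η = μ (η ++ [false]) + μ (η ++ [true])) {ε : ℝ} (hε : 0 < ε) :
    ∃ b : ℕ → ℕ, ∀ l,
      ∑ s : Fin l → Bool, (boundedNodes T b)ᶜ.indicator μ (List.ofFn s) ≤ ε := by
  obtain ⟨m, hm⟩ := exists_measure_initSeg h0 hadd
  -- These sets may fail to be measurable, but a measure, extended to all sets as an outer measure,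
  -- is continuous from below on arbitrary increasing sequences.
  let A : (ℕ → ℕ) → ℕ → Set (ℕ → Bool) := fun b j =>
    {σ | ∃ ν ∈ branches (treeSection T σ), ∀ i < j, (ν i : ℕ) ≤ b i}
  have hA0 : ∀ b, A b 0 = univ := fun b => by
    refine eq_univ_of_forall fun σ => ?_
    obtain ⟨ν, hν⟩ := hT σ
    exact ⟨ν, hν, by simp⟩
  have hcongr : ∀ b b' j, (∀ i < j, b i = b' i) → A b j = A b' j := by
    intro b b' j hb
    ext σ
    exact ⟨fun ⟨ν, h1, h2⟩ => ⟨ν, h1, fun i hi => hb i hi ▸ h2 i hi⟩,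
      fun ⟨ν, h1, h2⟩ => ⟨ν, h1, fun i hi => hb i hi ▸ h2 i hi⟩⟩
  have step : ∀ (b : ℕ → ℕ) (j : ℕ), ∃ N : ℕ,
      (m : MeasureTheory.Measure (ℕ → Bool)).real (A b j) ≤
        (m : MeasureTheory.Measure (ℕ → Bool)).real (A (Function.update b j N) (j + 1)) +
          ε / 2 / 2 ^ j := by
    intro b j
    have hmono : Monotone fun N => A (Function.update b j N) (j + 1) := by
      rintro N N' hN σ ⟨ν, h1, h2⟩
      refine ⟨ν, h1, fun i hi => (h2 i hi).trans ?_⟩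
      by_cases hij : i = j
      · subst hij; simpa using hN
      · simp [hij]
    have hU : ⋃ N, A (Function.update b j N) (j + 1) = A b j := by
      ext σ
      simp only [mem_iUnion]
      constructor
      · rintro ⟨N, ν, h1, h2⟩
        refine ⟨ν, h1, fun i hi => ?_⟩
        simpa [hi.ne] using h2 i (hi.trans (Nat.lt_succ_self j))
      · rintro ⟨ν, h1, h2⟩
        refine ⟨ν j, ν, h1, fun i hi => ?_⟩
        rcases Nat.lt_succ_iff_lt_or_eq.1 hi with hi | rfl
        · simpa [hi.ne] using h2 i hi
        · simp
    have hlim := MeasureTheory.tendsto_measure_iUnion_atTop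
      (μ := (m : MeasureTheory.Measure (ℕ → Bool))) hmono
    rw [hU] at hlim
    have hlim' := (ENNReal.tendsto_toReal (MeasureTheory.measure_ne_top _ _)).comp hlim
    obtain ⟨N, hN⟩ := (hlim'.eventually (lt_mem_nhds (sub_lt_self
      ((m : MeasureTheory.Measure (ℕ → Bool)).real (A b j))
      (show 0 < ε / 2 / 2 ^ j by positivity)))).exists
    exact ⟨N, (sub_lt_iff_lt_add.1 hN).le⟩
  choose N hN using step
  let c : ℕ → ℕ → ℕ := fun j => Nat.rec (fun _ => 0) (fun j b => Function.update b j (N b j)) j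
  have hcs : ∀ j, c (j + 1) = Function.update (c j) j (N (c j) j) := fun j => rfl
  have hcst : ∀ j k, j ≤ k → ∀ i < j, c k i = c j i := by
    intro j k hjk
    induction k, hjk using Nat.le_induction with
    | base => exact fun _ _ => rfl
    | succ k hk ih =>
      intro i hi
      rw [hcs, Function.update_of_ne (by omega), ih i hi]
  let b : ℕ → ℕ := fun i => c (i + 1) i
  have hb : ∀ j, A b j = A (c j) j := fun j => hcongr _ _ _ fun i hi =>
    (hcst (i + 1) j hi i (Nat.lt_succ_self i)).symm
  have hstep : ∀ j, (m : MeasureTheory.Measure (ℕ → Bool)).real (A b j) ≤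
      (m : MeasureTheory.Measure (ℕ → Bool)).real (A b (j + 1)) + ε / 2 / 2 ^ j := fun j => by
    rw [hb, hb, hcs]
    exact hN (c j) j
  have htot : ∀ j, (m : MeasureTheory.Measure (ℕ → Bool)).real univ ≤
      (m : MeasureTheory.Measure (ℕ → Bool)).real (A b j) +
        ∑ i ∈ Finset.range j, ε / 2 / 2 ^ i := by
    intro j
    induction j with
    | zero => simp [hA0]
    | succ j ih =>
      rw [Finset.sum_range_succ]
      linarith [hstep j]
  refine ⟨b, fun l => ?_⟩
  have hsub : A b l ⊆ {σ | initSeg σ l ∈ boundedNodes T b} := by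
    rintro σ ⟨ν, h1, h2⟩
    refine ⟨initSeg ν l, by simp [length_initSeg], fun i hi => ?_, ?_⟩
    · rw [length_initSeg] at hi
      simpa [initSeg] using h2 i hi
    · have : (initSeg σ (initSeg ν l).length).zip (initSeg ν l) ∈ T := h1 l
      rwa [length_initSeg] at this
  have hge : (m : MeasureTheory.Measure (ℕ → Bool)).real (A b l) ≤
      (m : MeasureTheory.Measure (ℕ → Bool)).real {σ | initSeg σ l ∈ boundedNodes T b} :=
    MeasureTheory.measureReal_mono hsub
  have hgeo : ∑ i ∈ Finset.range l, ε / 2 / 2 ^ i ≤ ε :=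
    ((summable_geometric_two' ε).sum_le_tsum _ fun i _ => by positivity).trans_eq
      (tsum_geometric_two' ε)
  have h3 := hm l univ
  rw [show {σ : ℕ → Bool | initSeg σ l ∈ (univ : Set (List Bool))} = univ by simp] at h3
  have h4 := hm l (boundedNodes T b)
  have h5 : ∑ s : Fin l → Bool, (univ : Set (List Bool)).indicator μ (List.ofFn s) =
      ∑ s : Fin l → Bool, (boundedNodes T b).indicator μ (List.ofFn s) +
        ∑ s : Fin l → Bool, (boundedNodes T b)ᶜ.indicator μ (List.ofFn s) := by
    rw [← Finset.sum_add_distrib]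
    refine Finset.sum_congr rfl fun s _ => ?_
    rw [indicator_univ]
    exact (congrFun (indicator_self_add_compl (boundedNodes T b) μ) _).symm
  linarith [htot l]

/-! ### Sums of blocks supported by bounded nodes -/

section Blocks

variable {T : Descriptive.tree (Bool × ℕ+)}

theorem mem_treeSection_of_zip_mem {σ : ℕ → Bool} {ℓ : ℕ} {ν : List ℕ+}
    (hν : ν.length = (initSeg σ ℓ).length) (h : (initSeg σ ℓ).zip ν ∈ T) :
    ν ∈ treeSection T σ := by
  have : (initSeg σ ν.length).zip ν ∈ T := by rwa [hν, length_initSeg]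
  exact this

/-- The sum of the first `n` entries of a sequence of positive integers, at least `1`. -/
def partialSum (ν : List ℕ+) (n : ℕ) : ℕ+ :=
  Nat.toPNat' ((ν.take n).map fun k : ℕ+ => (k : ℕ)).sum

theorem le_sum_take (ν : List ℕ+) {n : ℕ} (hn : n ≤ ν.length) :
    n ≤ ((ν.take n).map fun k : ℕ+ => (k : ℕ)).sum := by
  have := List.length_le_sum_of_one_le ((ν.take n).map fun k : ℕ+ => (k : ℕ)) (by
    intro i hi
    obtain ⟨k, -, rfl⟩ := List.mem_map.1 hi
    exact k.pos)
  simpa [hn] using this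

theorem coe_partialSum (ν : List ℕ+) {n : ℕ} (hn : n + 1 ≤ ν.length) :
    (partialSum ν (n + 1) : ℕ) = ((ν.take (n + 1)).map fun k : ℕ+ => (k : ℕ)).sum := by
  rw [partialSum, Nat.toPNat'_coe, if_pos ((Nat.succ_pos n).trans_le (le_sum_take ν hn))]

theorem partialSum_mem (ν : List ℕ+) {n : ℕ} (hn : n + 1 ≤ ν.length) :
    partialSum ν (n + 1) ∈ finPartialSums ν :=
  ⟨n + 1, by simp, hn, coe_partialSum ν hn⟩

theorem sum_take_le {ν : List ℕ+} {b : ℕ → ℕ}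
    (hb : ∀ i (hi : i < ν.length), (ν[i] : ℕ) ≤ b i) {n : ℕ} (hn : n ≤ ν.length) :
    ((ν.take n).map fun k : ℕ+ => (k : ℕ)).sum ≤ ∑ i ∈ Finset.range n, b i := by
  induction n with
  | zero => simp
  | succ n ih =>
    rw [Finset.sum_range_succ, List.take_succ_eq_append_getElem hn, List.map_append,
      List.sum_append]
    have := hb n hn
    simpa using add_le_add (ih (by omega)) this

/-- Blocks with supports in consecutive windows of levels, all of whose nodes are bounded by `b`
and whose windows are so far apart that every sequence bounded by `b` has a partial sum between any
two of them. Along every branch they are separated by the partial sums of a single sequence. -/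
theorem treeNorm_sum_boundedNodes_le {b q : ℕ → ℕ} (hq : Monotone q) {y : ℕ → Node →₀ ℝ}
    (hy : ∀ k, treeNorm T (y k) ≤ 1)
    (hlow : ∀ k η, y k η ≠ 0 → q k < η.1.length ∧ ∑ i ∈ Finset.range (q k + 1), b i ≤ η.1.length)
    (hup : ∀ k η, y k η ≠ 0 → η.1.length < q (k + 1))
    (hgood : ∀ k η, y k η ≠ 0 → η.1 ∈ boundedNodes T b) (K : ℕ) :
    treeNorm T (∑ k ∈ Finset.range K, y k) ≤ 2 := by
  classical
  refine treeNorm_le fun σ => ?_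
  set x : ℕ → ℕ+ →₀ ℝ := fun k => alongBranch σ (y k) with hxdef
  have hx : ∀ k i, x k i ≠ 0 → y k (branchNode σ i) ≠ 0 := fun k i h => h
  rw [map_sum]
  by_cases h0 : ∀ k ∈ Finset.range K, x k = 0
  · rw [Finset.sum_eq_zero h0, tsirelsonNorm_zero]
    exact zero_le_two
  push Not at h0
  -- The last nonzero block determines a sequence long enough to separate all the others.
  set J := (Finset.range K).filter fun k => x k ≠ 0 with hJ
  have hJne : J.Nonempty := by
    obtain ⟨k, hk, hk'⟩ := h0
    exact ⟨k, Finset.mem_filter.2 ⟨hk, hk'⟩⟩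
  obtain ⟨ℓ, hℓ⟩ := Finsupp.ne_iff.1 (Finset.mem_filter.1 (J.max'_mem hJne)).2
  obtain ⟨ν, hν1, hν2, hν3⟩ := hgood _ _ (hx _ _ hℓ)
  have hνlen : ν.length = ℓ := by rw [hν1, length_branchNode]
  have hlen : ∀ k ∈ Finset.range K, x k ≠ 0 → q k + 1 ≤ ν.length := by
    intro k hk hk0
    have h1 : k ≤ J.max' hJne := J.le_max' k (Finset.mem_filter.2 ⟨hk, hk0⟩)
    have h2 := (hlow _ _ (hx _ _ hℓ)).1
    rw [length_branchNode] at h2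
    have := hq h1
    omega
  have hne : ∀ k i, x k i ≠ 0 → x k ≠ 0 := fun k i h h' => h (by rw [h']; rfl)
  have key := tsirelsonNorm_sum_le (M := setSystem (treeSection T σ)) (A := finPartialSums ν)
    (Or.inl ⟨ν, Or.inl (mem_treeSection_of_zip_mem hν1 hν3), rfl⟩) (Finset.range K) x
    (fun k => partialSum ν (q k + 1)) zero_le_one
    (fun k _ => (tsirelsonNorm_alongBranch_le T σ (y k)).trans (hy k))
    (fun k hk hk0 => partialSum_mem ν (hlen k hk hk0)) ?_ ?_
  · simpa using key
  · intro k hk i hi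
    have h1 := hlen k hk (hne k i hi)
    have h2 := (hlow k _ (hx k i hi)).2
    rw [length_branchNode] at h2
    rw [← PNat.coe_le_coe, coe_partialSum ν h1]
    exact (sum_take_le hν2 h1).trans h2
  · intro j hj k hk hjk hk0 i hi
    have h1 := hlen k hk hk0
    have h2 := hup j _ (hx j i hi)
    rw [length_branchNode] at h2
    rw [← PNat.coe_lt_coe, coe_partialSum ν h1]
    have h3 := le_sum_take ν h1
    have h4 := hq (Nat.succ_le_of_lt hjk)
    simp only [Nat.succ_eq_add_one] at h4
    omega

theorem take_branchNode (σ : ℕ → Bool) (ℓ : ℕ+) {n : ℕ} (hn : n ≤ ℓ) :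
    (branchNode σ ℓ).1.take n = initSeg σ n :=
  initSeg_take σ hn

/-- If no branch meets two of the blocks, their sum has the norm of a single one. -/
theorem treeNorm_sum_le_of_forall_branch {y : ℕ → Node →₀ ℝ} {r : ℝ} (hr : 0 ≤ r)
    (hy : ∀ k, treeNorm T (y k) ≤ r)
    (hdisj : ∀ σ i l j k, j < k → y j (branchNode σ i) ≠ 0 → y k (branchNode σ l) = 0) (K : ℕ) :
    treeNorm T (∑ k ∈ Finset.range K, y k) ≤ r := by
  refine treeNorm_le fun σ => ?_
  rw [map_sum]
  by_cases h0 : ∀ k ∈ Finset.range K, alongBranch σ (y k) = 0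
  · rw [Finset.sum_eq_zero h0, tsirelsonNorm_zero]
    exact hr
  push Not at h0
  obtain ⟨k, hk, hk0⟩ := h0
  obtain ⟨i, hi⟩ := Finsupp.ne_iff.1 hk0
  rw [Finset.sum_eq_single k]
  · exact (tsirelsonNorm_alongBranch_le T σ (y k)).trans (hy k)
  · intro j _ hjk
    ext l
    by_contra hl
    rcases lt_or_gt_of_ne hjk with h | h
    · exact hi (hdisj σ l i j k h hl)
    · exact hl (hdisj σ i l k j h hi)
  · exact fun h => absurd hk h

/-- A variant of `treeNorm_sum_boundedNodes_le` in which only the initial segments up to the end of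
the previous window are bounded by `b`. The part of a block on the nodes not bounded by `b` is
incomparable with all later blocks. -/
theorem treeNorm_sum_blocks_le {b q : ℕ → ℕ} (hq : Monotone q) {y : ℕ → Node →₀ ℝ}
    (hy : ∀ k, treeNorm T (y k) ≤ 1)
    (hlow : ∀ k η, y k η ≠ 0 → q k < η.1.length ∧ ∑ i ∈ Finset.range (q k + 1), b i ≤ η.1.length)
    (hup : ∀ k η, y k η ≠ 0 → η.1.length < q (k + 1))
    (hgood : ∀ k η, y k η ≠ 0 → η.1.take (q k) ∈ boundedNodes T b) (K : ℕ) :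
    treeNorm T (∑ k ∈ Finset.range K, y k) ≤ 3 := by
  set G : Set Node := {η | η.1 ∈ boundedNodes T b} with hG
  have h1 := treeNorm_sum_boundedNodes_le (T := T) hq (y := fun k => restrict G (y k))
    (fun k => (treeNorm_restrict_le _ _).trans (hy k))
    (fun k η hη => hlow k η (apply_ne_zero_of_restrict hη))
    (fun k η hη => hup k η (apply_ne_zero_of_restrict hη))
    (fun k η hη => (mem_of_restrict_apply_ne_zero hη : η ∈ G)) K
  have h2 := treeNorm_sum_le_of_forall_branch (T := T) zero_le_one
    (y := fun k => restrict Gᶜ (y k)) (fun k => (treeNorm_restrict_le _ _).trans (hy k)) (by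
      intro σ i l j k hjk hj
      by_contra hk
      have hi : (branchNode σ i).1 ∉ boundedNodes T b :=
        (mem_of_restrict_apply_ne_zero hj : branchNode σ i ∈ Gᶜ)
      have h3 := hup j _ (apply_ne_zero_of_restrict hj)
      have h4 := hq (Nat.succ_le_of_lt hjk)
      have h5 := hlow k _ (apply_ne_zero_of_restrict hk)
      have h6 := take_mem_boundedNodes (hgood k _ (apply_ne_zero_of_restrict hk)) i
      rw [length_branchNode] at h3 h5
      simp only [Nat.succ_eq_add_one] at h4
      rw [take_branchNode σ l h5.1.le, initSeg_take σ (by omega)] at h6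
      exact hi h6) K
  have h3 : ∑ k ∈ Finset.range K, y k = ∑ k ∈ Finset.range K, restrict G (y k) +
      ∑ k ∈ Finset.range K, restrict Gᶜ (y k) := by
    rw [← Finset.sum_add_distrib]
    refine Finset.sum_congr rfl fun k _ => ?_
    rw [restrict_add_restrict disjoint_compl_right, union_compl_self, restrict_univ]
  rw [h3]
  exact (treeNorm_add_le _ _).trans (by linarith)

end Blocks

/-! ### Extracting a sequence of almost disjoint blocks -/

theorem exists_tendsto_of_abs_le {α : Type*} (U : Ultrafilter α) {f : α → ℝ} {C : ℝ}
    (h : ∀ k, |f k| ≤ C) : ∃ a, Tendsto f U (𝓝 a) := by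
  obtain ⟨a, -, ha⟩ := (isCompact_Icc (a := -C) (b := C)).ultrafilter_le_nhds' (U.map f)
    (by rw [Ultrafilter.mem_map]; exact Filter.univ_mem' fun k => abs_le.1 (h k))
  exact ⟨a, ha⟩

section Extraction

variable {T : Descriptive.tree (Bool × ℕ+)} {U : Ultrafilter ℕ}
  {h : ℕ → StrongDual ℝ (PreTreeSpace T)}

theorem tendsto_dualNormOn_finite
    (h0 : ∀ η, Tendsto (fun k => h k (ofFinsupp T (Finsupp.single η 1))) U (𝓝 0))
    {S : Set Node} (hS : S.Finite) : Tendsto (fun k => dualNormOn (h k) S) U (𝓝 0) := by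
  have h1 : Tendsto (fun k => ∑ η ∈ hS.toFinset, |h k (ofFinsupp T (Finsupp.single η 1))|) U
      (𝓝 0) := by
    have := tendsto_finsetSum hS.toFinset fun η _ => (h0 η).abs
    simpa using this
  refine squeeze_zero (fun k => dualNormOn_nonneg (h k)) (fun k => ?_) h1
  have h2 : S = ⋃ η ∈ hS.toFinset, {η} := by ext; simp
  calc dualNormOn (h k) S = dualNormOn (h k) (⋃ η ∈ hS.toFinset, {η}) := by rw [← h2]
    _ ≤ _ := dualNormOn_biUnion_le (h k) hS.toFinset fun η => {η}
    _ ≤ _ := Finset.sum_le_sum fun η _ => dualNormOn_singleton_le (h k) η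

/-- The set of all nodes extending a given finite sequence. -/
def cone (η : List Bool) : Set Node := {ζ | η <+: ζ.1}

theorem finite_setOf_length_lt (p : ℕ) : {ζ : Node | ζ.1.length < p}.Finite :=
  Set.Finite.preimage Subtype.val_injective.injOn (List.finite_length_lt Bool p)

/-- Along an ultrafilter that sends all coordinates of the functionals `h k` to zero, the norms on
the cones become additive. -/
theorem exists_limit_cone {C : ℝ} (hC : ∀ k, ‖h k‖ ≤ C)
    (h0 : ∀ η, Tendsto (fun k => h k (ofFinsupp T (Finsupp.single η 1))) U (𝓝 0)) :
    ∃ μ : List Bool → ℝ, (∀ η, 0 ≤ μ η) ∧ (∀ η, μ η = μ (η ++ [false]) + μ (η ++ [true])) ∧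
      ∀ η, Tendsto (fun k => dualNormOn (h k) (cone η)) U (𝓝 (μ η)) := by
  have hex : ∀ η, ∃ a, Tendsto (fun k => dualNormOn (h k) (cone η)) U (𝓝 a) := fun η =>
    exists_tendsto_of_abs_le U (C := C) fun k => by
      rw [abs_of_nonneg (dualNormOn_nonneg _)]
      exact (dualNormOn_le_norm (h k)).trans (hC k)
  choose μ hμ using hex
  refine ⟨μ, fun η => ge_of_tendsto' (hμ η) fun k => dualNormOn_nonneg _, fun η => ?_, hμ⟩
  have hcone : cone η ⊆ {ζ | ζ.1.length < η.length + 1} ∪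
      (cone (η ++ [false]) ∪ cone (η ++ [true])) := by
    rintro ζ ⟨t, ht⟩
    rcases t with _ | ⟨a, t⟩
    · left
      rw [List.append_nil] at ht
      exact (ht ▸ Nat.lt_succ_self _ : ζ.1.length < η.length + 1)
    · right
      cases a
      · exact Or.inl ⟨t, by simpa using ht⟩
      · exact Or.inr ⟨t, by simpa using ht⟩
  have hcone' : cone (η ++ [false]) ∪ cone (η ++ [true]) ⊆ cone η := by
    rintro ζ (hζ | hζ) <;> exact (List.prefix_append _ _).trans hζ
  have hdisj : ∀ σ k l, branchNode σ k ∈ cone (η ++ [false]) →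
      branchNode σ l ∉ cone (η ++ [true]) := by
    intro σ k l hk hl
    have hk' : η ++ [false] <+: initSeg σ k := hk
    have hl' : η ++ [true] <+: initSeg σ l := hl
    have h1 := hk'.length_le
    have h2 := hl'.length_le
    rw [length_initSeg, List.length_append, List.length_singleton] at h1 h2
    rw [List.prefix_iff_eq_take, List.length_append, List.length_singleton,
      initSeg_take σ (by assumption)] at hk' hl'
    rw [← hk'] at hl'
    simp at hl'
  have hfin := tendsto_dualNormOn_finite h0 (finite_setOf_length_lt (η.length + 1))
  apply le_antisymm
  · have := hfin.add ((hμ (η ++ [false])).add (hμ (η ++ [true])))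
    rw [zero_add] at this
    refine le_of_tendsto_of_tendsto' (hμ η) this fun k => ?_
    refine (dualNormOn_mono (h k) hcone).trans ((dualNormOn_union_le (h k)).trans ?_)
    gcongr
    exact dualNormOn_union_le (h k)
  · exact le_of_tendsto_of_tendsto' ((hμ (η ++ [false])).add (hμ (η ++ [true]))) (hμ η) fun k =>
      (add_dualNormOn_le (h k) hdisj).trans (dualNormOn_mono (h k) hcone')

/-- With ill-founded sections, a coordinatewise null sequence of functionals loses at most `3 ε` of
its norm by a restriction to all nodes of high level with an initial segment bounded by `b`. -/
theorem exists_boundedNodes_eventually_lt (hT : ∀ σ : ℕ → Bool, IllFounded (treeSection T σ))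
    {C : ℝ} (hC : ∀ k, ‖h k‖ ≤ C)
    (h0 : ∀ η, Tendsto (fun k => h k (ofFinsupp T (Finsupp.single η 1))) U (𝓝 0))
    {a ε : ℝ} (hε : 0 < ε) (ha : ∀ k, a < ‖h k‖) :
    ∃ b : ℕ → ℕ, ∀ n p, n ≤ p → ∀ᶠ k in (U : Filter ℕ),
      a - 3 * ε < dualNormOn (h k) {η | p ≤ η.1.length ∧ η.1.take n ∈ boundedNodes T b} := by
  classical
  obtain ⟨μ, hμ0, hμadd, hμ⟩ := exists_limit_cone hC h0
  obtain ⟨b, hb⟩ := exists_boundedNodes hT hμ0 hμadd hε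
  refine ⟨b, fun n p hnp => ?_⟩
  have hbad : Tendsto (fun k => ∑ s : Fin n → Bool,
      (boundedNodes T b)ᶜ.indicator (fun η => dualNormOn (h k) (cone η)) (List.ofFn s)) U
      (𝓝 (∑ s : Fin n → Bool, (boundedNodes T b)ᶜ.indicator μ (List.ofFn s))) := by
    refine tendsto_finsetSum _ fun s _ => ?_
    by_cases hs : List.ofFn s ∈ (boundedNodes T b)ᶜ
    · simpa only [indicator_of_mem hs] using hμ _
    · simpa only [indicator_of_notMem hs] using tendsto_const_nhds
  have hfin := tendsto_dualNormOn_finite h0 (finite_setOf_length_lt p)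
  filter_upwards [hbad.eventually (gt_mem_nhds ((hb n).trans_lt (show ε < 2 * ε by linarith))),
    hfin.eventually (gt_mem_nhds hε)] with k hk1 hk2
  set S : Finset (Fin n → Bool) := Finset.univ.filter fun s => List.ofFn s ∉ boundedNodes T b
  have hsum : ∑ s : Fin n → Bool, (boundedNodes T b)ᶜ.indicator
      (fun η => dualNormOn (h k) (cone η)) (List.ofFn s) =
        ∑ s ∈ S, dualNormOn (h k) (cone (List.ofFn s)) := by
    rw [Finset.sum_filter]
    refine Finset.sum_congr rfl fun s _ => ?_
    simp [indicator_apply]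
  have hcover : (univ : Set Node) ⊆ {ζ | ζ.1.length < p} ∪ ((⋃ s ∈ S, cone (List.ofFn s)) ∪
      {η | p ≤ η.1.length ∧ η.1.take n ∈ boundedNodes T b}) := by
    intro ζ _
    by_cases h1 : ζ.1.length < p
    · exact Or.inl h1
    rw [not_lt] at h1
    by_cases h2 : ζ.1.take n ∈ boundedNodes T b
    · exact Or.inr (Or.inr ⟨h1, h2⟩)
    · refine Or.inr (Or.inl ?_)
      have hz : List.ofFn (fun i : Fin n => ζ.1[(i : ℕ)]'(by omega)) = ζ.1.take n := by
        refine List.ext_getElem (by simp; omega) fun i _ _ => by simp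
      refine mem_biUnion (x := fun i : Fin n => ζ.1[(i : ℕ)]'(by omega)) ?_ ?_
      · simp only [S, Finset.coe_filter, Finset.mem_univ, true_and, mem_ofPred_eq]
        rwa [hz]
      · change _ <+: ζ.1
        rw [hz]
        exact List.take_prefix _ _
  have h1 := dualNormOn_mono (h k) hcover
  have h2 := dualNormOn_union_le (h k) (S := {ζ | ζ.1.length < p})
    (S' := (⋃ s ∈ S, cone (List.ofFn s)) ∪
      {η | p ≤ η.1.length ∧ η.1.take n ∈ boundedNodes T b})
  have h3 := dualNormOn_union_le (h k) (S := ⋃ s ∈ S, cone (List.ofFn s))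
    (S' := {η | p ≤ η.1.length ∧ η.1.take n ∈ boundedNodes T b})
  have h4 := dualNormOn_biUnion_le (h k) S fun s => cone (List.ofFn s)
  rw [dualNormOn_univ] at h1
  rw [hsum] at hk1
  linarith [ha k]

end Extraction

section ExtractionSequence

variable {T : Descriptive.tree (Bool × ℕ+)} {U : Ultrafilter ℕ}
  {h : ℕ → StrongDual ℝ (PreTreeSpace T)}

theorem tendsto_apply_zero
    (h0 : ∀ η, Tendsto (fun k => h k (ofFinsupp T (Finsupp.single η 1))) U (𝓝 0))
    (x : Node →₀ ℝ) : Tendsto (fun k => h k (ofFinsupp T x)) U (𝓝 0) := by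
  have h1 := (tendsto_dualNormOn_finite h0 x.support.finite_toSet).mul_const (treeNorm T x)
  rw [zero_mul] at h1
  refine squeeze_zero_norm (fun k => ?_) h1
  exact abs_le_dualNormOn (h k) fun η hη => Finsupp.mem_support_iff.2 hη

/-- With ill-founded sections, every bounded coordinatewise null sequence of functionals has a
subsequence `h (κ i)` with blocks `y i` on which these functionals almost attain their norms. The
levels of the blocks exceed prescribed bounds `pk` depending on the earlier indices, and the windows
`q` of levels and the bounds `b` are as required for `treeNorm_sum_blocks_le`. -/
theorem exists_block_sequence (hT : ∀ σ : ℕ → Bool, IllFounded (treeSection T σ))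
    (hU : (U : Filter ℕ) ≤ atTop) {C : ℝ} (hC : ∀ k, ‖h k‖ ≤ C)
    (h0 : ∀ η, Tendsto (fun k => h k (ofFinsupp T (Finsupp.single η 1))) U (𝓝 0))
    {a ε : ℝ} (hε : 0 < ε) (ha : ∀ k, a < ‖h k‖) (pk : ℕ → ℕ) :
    ∃ (b κ q : ℕ → ℕ) (y : ℕ → Node →₀ ℝ), StrictMono κ ∧ Monotone q ∧
      (∀ k, treeNorm T (y k) ≤ 1) ∧ (∀ k, a - 3 * ε < h (κ k) (ofFinsupp T (y k))) ∧
      (∀ k η, y k η ≠ 0 → q k < η.1.length ∧ ∑ i ∈ Finset.range (q k + 1), b i ≤ η.1.length) ∧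
      (∀ k η, y k η ≠ 0 → η.1.length < q (k + 1)) ∧
      (∀ k η, y k η ≠ 0 → η.1.take (q k) ∈ boundedNodes T b) ∧
      ∀ j k, j < k → |h (κ k) (ofFinsupp T (y j))| ≤ ε / 2 / 2 ^ κ j ∧
        ∀ η, y k η ≠ 0 → pk (κ j) ≤ η.1.length := by
  classical
  obtain ⟨b, hb⟩ := exists_boundedNodes_eventually_lt hT hC h0 hε ha
  obtain ⟨B, hB⟩ : ∃ B : ℕ → ℕ, ∀ n, B n = ∑ i ∈ Finset.range (n + 1), b i := ⟨_, fun _ => rfl⟩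
  -- The triples consist of an index, a strict bound for the levels of a block, and the block.
  obtain ⟨f, hfP, hfr⟩ := exists_seq_of_forall_finset_exists
    (fun z : ℕ × ℕ × (Node →₀ ℝ) =>
      treeNorm T z.2.2 ≤ 1 ∧ a - 3 * ε < h z.1 (ofFinsupp T z.2.2) ∧
      ∀ η, z.2.2 η ≠ 0 → B 0 ≤ η.1.length ∧ η.1.length < z.2.1 ∧ η.1.take 0 ∈ boundedNodes T b)
    (fun z z' : ℕ × ℕ × (Node →₀ ℝ) =>
      z.1 < z'.1 ∧ z.2.1 ≤ z'.2.1 ∧ |h z'.1 (ofFinsupp T z.2.2)| ≤ ε / 2 / 2 ^ z.1 ∧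
      ∀ η, z'.2.2 η ≠ 0 → z.2.1 < η.1.length ∧ B z.2.1 ≤ η.1.length ∧ pk z.1 ≤ η.1.length ∧
        η.1.take z.2.1 ∈ boundedNodes T b) (by
    intro s _
    obtain ⟨n, hn⟩ : ∃ n, ∀ z ∈ s, z.2.1 ≤ n :=
      ⟨s.sup fun z => z.2.1, fun z hz => Finset.le_sup (f := fun z => z.2.1) hz⟩
    obtain ⟨p', hp'⟩ : ∃ p, ∀ z ∈ s, max (z.2.1 + 1) (max (B z.2.1) (pk z.1)) ≤ p :=
      ⟨s.sup fun z => max (z.2.1 + 1) (max (B z.2.1) (pk z.1)), fun z hz =>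
        Finset.le_sup (f := fun z => max (z.2.1 + 1) (max (B z.2.1) (pk z.1))) hz⟩
    obtain ⟨p, hp⟩ : ∃ p, n ≤ p ∧ B 0 ≤ p ∧ p' ≤ p := ⟨max n (max (B 0) p'), by simp⟩
    have hev : ∀ᶠ k in (U : Filter ℕ), ∀ z ∈ s, z.1 < k ∧
        |h k (ofFinsupp T z.2.2)| ≤ ε / 2 / 2 ^ z.1 := by
      rw [Filter.eventually_all_finset]
      intro z _
      refine Filter.Eventually.and (hU (eventually_gt_atTop z.1)) ?_
      have := (tendsto_apply_zero h0 z.2.2).abs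
      rw [abs_zero] at this
      filter_upwards [this.eventually (gt_mem_nhds (show 0 < ε / 2 / 2 ^ z.1 by positivity))]
        with k hk using hk.le
    obtain ⟨k, hk1, hk2⟩ := ((hb n p hp.1).and hev).exists
    obtain ⟨y, hy1, hy2, hy3⟩ := exists_lt_of_lt_dualNormOn (h k) hk1
    obtain ⟨q, hq⟩ := exists_level_bound y
    have htake : ∀ η, y η ≠ 0 → ∀ j ≤ n, η.1.take j ∈ boundedNodes T b := by
      intro η hη j hj
      have := take_mem_boundedNodes (hy1 η hη).2 j
      rwa [List.take_take, min_eq_left hj] at this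
    refine ⟨(k, max n q, y), ⟨hy2, hy3, fun η hη => ⟨?_, ?_, htake η hη 0 (Nat.zero_le _)⟩⟩, ?_⟩
    · exact hp.2.1.trans (hy1 η hη).1
    · exact (hq η hη).trans_le (le_max_right _ _)
    · intro z hz
      have hzn : z.2.1 ≤ n := hn z hz
      refine ⟨(hk2 z hz).1, hzn.trans (le_max_left _ _), (hk2 z hz).2, fun η hη => ?_⟩
      have h1 := ((hp' z hz).trans hp.2.2).trans (hy1 η hη).1
      simp only [max_le_iff] at h1
      exact ⟨h1.1, h1.2.1, h1.2.2, htake η hη _ hzn⟩)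
  have hsucc : ∀ k η, (f (k + 1)).2.2 η ≠ 0 → _ := fun k =>
    (hfr k (k + 1) (Nat.lt_succ_self k)).2.2.2
  -- The window of a block begins at the bound for the levels of the previous block.
  refine ⟨b, fun n => (f n).1, fun n => Nat.casesOn n 0 fun m => (f m).2.1, fun n => (f n).2.2,
    strictMono_nat_of_lt_succ fun n => (hfr n _ (Nat.lt_succ_self n)).1,
    monotone_nat_of_le_succ ?_, fun k => (hfP k).1, fun k => (hfP k).2.1, ?_,
    fun k η hη => ((hfP k).2.2 η hη).2.1, ?_, fun j k hjk => ⟨(hfr j k hjk).2.2.1,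
      fun η hη => ((hfr j k hjk).2.2.2 η hη).2.2.1⟩⟩
  · rintro (_ | n)
    · exact Nat.zero_le _
    · exact (hfr n _ (Nat.lt_succ_self n)).2.1
  · rintro (_ | k) η hη
    · exact ⟨List.length_pos_iff.2 η.2, hB 0 ▸ ((hfP 0).2.2 η hη).1⟩
    · exact ⟨(hsucc k η hη).1, hB _ ▸ (hsucc k η hη).2.1⟩
  · rintro (_ | k) η hη
    · exact ((hfP 0).2.2 η hη).2.2
    · exact (hsucc k η hη).2.2.2

/-- With ill-founded sections, every bounded coordinatewise null sequence of functionals has a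
subsequence `h (κ i)` with almost biorthogonal blocks `y i` all of whose signed sums have norm at
most `3`. -/
theorem exists_blocks (hT : ∀ σ : ℕ → Bool, IllFounded (treeSection T σ))
    (hU : (U : Filter ℕ) ≤ atTop) {C : ℝ} (hC : ∀ k, ‖h k‖ ≤ C)
    (h0 : ∀ η, Tendsto (fun k => h k (ofFinsupp T (Finsupp.single η 1))) U (𝓝 0))
    {a a' : ℝ} (haa' : a < a') (ha : ∀ k, a' < ‖h k‖) :
    ∃ (κ : ℕ → ℕ) (y : ℕ → Node →₀ ℝ), StrictMono κ ∧ ∀ s : ℕ → ℝ, (∀ k, |s k| = 1) → ∀ K,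
      treeNorm T (∑ k ∈ Finset.range K, s k • y k) ≤ 3 ∧
      ∀ i < K, a ≤ s i * h (κ i) (ofFinsupp T (∑ k ∈ Finset.range K, s k • y k)) := by
  -- The choice of the block costs `3 ε`, the earlier blocks cost `ε` and the later ones `3 ε`.
  set ε := (a' - a) / 7 with hεdef
  have hε : 0 < ε := by rw [hεdef]; linarith
  choose pk hpk using fun k => exists_dualNormOn_levelGE_le (h k) hε
  obtain ⟨b, κ, q, y, hκ, hqm, hy1, hyh, hlow, hup, hgood, hpair⟩ :=
    exists_block_sequence hT hU hC h0 hε ha pk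
  have hs0 : ∀ (s : ℕ → ℝ) k η, (s k • y k) η ≠ 0 → y k η ≠ 0 :=
    fun s k η hη h' => hη (by simp [h'])
  have hsum3 : ∀ s : ℕ → ℝ, (∀ k, |s k| ≤ 1) → ∀ K,
      treeNorm T (∑ k ∈ Finset.range K, s k • y k) ≤ 3 := fun s hs K =>
    treeNorm_sum_blocks_le hqm (fun k => by
      rw [treeNorm_smul]
      exact mul_le_one₀ (hs k) (treeNorm_nonneg _) (hy1 k))
      (fun k η hη => hlow k η (hs0 s k η hη)) (fun k η hη => hup k η (hs0 s k η hη))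
      (fun k η hη => hgood k η (hs0 s k η hη)) K
  refine ⟨κ, y, hκ, fun s hs K => ⟨hsum3 s (fun k => (hs k).le) K, fun i hi => ?_⟩⟩
  -- The blocks before the `i`-th one, the `i`-th one, and those after it.
  set A := ∑ k ∈ Finset.range i, s k • y k with hA
  set D := ∑ k ∈ Finset.range K, (if i < k then s k else 0) • y k with hD
  have hsplit : ∑ k ∈ Finset.range K, s k • y k = A + s i • y i + D := by
    have h1 : A = ∑ k ∈ Finset.range K, if k < i then s k • y k else 0 := by
      rw [← Finset.sum_filter, hA]
      congr 1
      ext k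
      simp only [Finset.mem_range, Finset.mem_filter]
      omega
    have h2 : s i • y i = ∑ k ∈ Finset.range K, if k = i then s k • y k else 0 := by
      rw [Finset.sum_ite_eq' (Finset.range K) i fun k => s k • y k, if_pos (Finset.mem_range.2 hi)]
    rw [h1, h2, hD, ← Finset.sum_add_distrib, ← Finset.sum_add_distrib]
    refine Finset.sum_congr rfl fun k _ => ?_
    rcases lt_trichotomy k i with hk | hk | hk
    · simp [hk, hk.ne, hk.le]
    · simp [hk]
    · simp [hk, hk.ne', hk.le]
  have hAle : |h (κ i) (ofFinsupp T A)| ≤ ε := by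
    rw [hA, map_sum, map_sum]
    refine (Finset.abs_sum_le_sum_abs _ _).trans ?_
    calc ∑ k ∈ Finset.range i, |h (κ i) (ofFinsupp T (s k • y k))|
        ≤ ∑ k ∈ Finset.range i, ε / 2 / 2 ^ k := by
          refine Finset.sum_le_sum fun k hk => ?_
          rw [map_smul, map_smul, smul_eq_mul, abs_mul, hs k, one_mul]
          refine (hpair k i (Finset.mem_range.1 hk)).1.trans ?_
          exact div_le_div_of_nonneg_left (by positivity) (by positivity)
            (pow_le_pow_right₀ one_le_two (hκ.le_apply : k ≤ κ k))
      _ ≤ ε := ((summable_geometric_two' ε).sum_le_tsum _ fun i _ => by positivity).trans_eq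
          (tsum_geometric_two' ε)
  have hDle : |h (κ i) (ofFinsupp T D)| ≤ 3 * ε := by
    have h1 : treeNorm T D ≤ 3 := hsum3 _ (fun k => by
      by_cases hk : i < k
      · simp [hk, hs k]
      · simp [hk]) K
    have h2 := abs_le_dualNormOn (h (κ i)) (S := levelGE (pk (κ i))) (x := D) fun η hη => by
      rw [hD, Finsupp.finsetSum_apply] at hη
      obtain ⟨k, -, hk⟩ := Finset.exists_ne_zero_of_sum_ne_zero hη
      by_cases hik : i < k
      · exact (hpair i k hik).2 η (hs0 (fun k => if i < k then s k else 0) k η hk)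
      · simp [hik] at hk
    calc _ ≤ _ := h2
      _ ≤ ε * 3 := mul_le_mul (hpk _) h1 (treeNorm_nonneg _) hε.le
      _ = _ := mul_comm _ _
  have hsi : s i * s i = 1 := by rw [← abs_mul_abs_self, hs i, one_mul]
  have hdiag : s i * (s i * h (κ i) (ofFinsupp T (y i))) = h (κ i) (ofFinsupp T (y i)) := by
    rw [← mul_assoc, hsi, one_mul]
  have h1 : |s i * h (κ i) (ofFinsupp T A)| ≤ ε := by rwa [abs_mul, hs i, one_mul]
  have h2 : |s i * h (κ i) (ofFinsupp T D)| ≤ 3 * ε := by rwa [abs_mul, hs i, one_mul]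
  have h3 := hyh i
  rw [hsplit, map_add, map_add, map_add, map_add, map_smul, map_smul, smul_eq_mul, mul_add, mul_add,
    hdiag]
  have h4 := (abs_le.1 h1).1
  have h5 := (abs_le.1 h2).1
  linarith

end ExtractionSequence

/-! ### The quantitative Schur property -/

/-- Bounded families of functionals have limits along ultrafilters. -/
theorem exists_limit_functional {α E : Type*} [NormedAddCommGroup E] [NormedSpace ℝ E]
    (U : Ultrafilter α) {F : α → StrongDual ℝ E} {C : ℝ} (hF : ∀ k, ‖F k‖ ≤ C) :
    ∃ Φ : StrongDual ℝ E, ‖Φ‖ ≤ C ∧ ∀ x, Tendsto (fun k => F k x) U (𝓝 (Φ x)) := by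
  obtain ⟨Φ, hΦ, hlim⟩ := (WeakDual.isCompact_closedBall (𝕜 := ℝ) (0 : StrongDual ℝ E)
    C).ultrafilter_le_nhds' (U.map fun k => StrongDual.toWeakDual (F k)) (by
      rw [Ultrafilter.mem_map]
      refine Filter.univ_mem' fun k => ?_
      simpa using hF k)
  refine ⟨WeakDual.toStrongDual Φ, by simpa using hΦ, fun x => ?_⟩
  exact ((WeakDual.eval_continuous x).tendsto Φ).comp
    (show Tendsto (fun k => StrongDual.toWeakDual (F k)) U (𝓝 Φ) from hlim)

section CauchyModulus

theorem ca_nonneg {X : Type*} [PseudoMetricSpace X] (x : ℕ → X) : 0 ≤ ca x :=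
  Real.iInf_nonneg fun _ => Metric.diam_nonneg

theorem ca_le_diam {X : Type*} [PseudoMetricSpace X] (x : ℕ → X) (m : ℕ) :
    ca x ≤ Metric.diam (x '' Ici m) :=
  ciInf_le ⟨0, by rintro _ ⟨m, rfl⟩; exact Metric.diam_nonneg⟩ m

/-- A lower bound for `ca` by pairs of terms of arbitrarily large index. -/
theorem le_ca {X : Type*} [PseudoMetricSpace X] {x : ℕ → X} (hx : Bornology.IsBounded (range x))
    {a : ℝ} (h : ∀ m, ∃ u ≥ m, ∃ v ≥ m, a ≤ dist (x u) (x v)) : a ≤ ca x :=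
  le_ciInf fun m => by
    obtain ⟨u, hu, v, hv, huv⟩ := h m
    exact huv.trans (Metric.dist_le_diam_of_mem (hx.subset (image_subset_range _ _))
      (mem_image_of_mem x hu) (mem_image_of_mem x hv))

variable {X : Type*} [NormedAddCommGroup X] [NormedSpace ℝ X]

theorem isBounded_range_apply {x : ℕ → X} (hx : Bornology.IsBounded (range x))
    (f : StrongDual ℝ X) : Bornology.IsBounded (range fun n => f (x n)) := by
  rw [range_comp' f x]
  exact f.lipschitz.isBounded_image hx

theorem bddAbove_weakCa {x : ℕ → X} (hx : Bornology.IsBounded (range x)) :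
    BddAbove (range fun f : Metric.closedBall (0 : StrongDual ℝ X) 1 =>
      ca fun n => (f : StrongDual ℝ X) (x n)) := by
  refine ⟨Metric.diam (x '' Ici 0), ?_⟩
  rintro _ ⟨⟨f, hf⟩, rfl⟩
  refine (ca_le_diam _ 0).trans (Metric.diam_le_of_forall_dist_le Metric.diam_nonneg ?_)
  rintro _ ⟨u, hu, rfl⟩ _ ⟨v, hv, rfl⟩
  have hf' : ‖f‖ ≤ 1 := by simpa using hf
  rw [dist_eq_norm, ← map_sub]
  refine (f.le_of_opNorm_le hf' _).trans ?_
  rw [one_mul, ← dist_eq_norm]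
  exact Metric.dist_le_diam_of_mem (hx.subset (image_subset_range _ _))
    (mem_image_of_mem x hu) (mem_image_of_mem x hv)

theorem ca_le_weakCa {x : ℕ → X} (hx : Bornology.IsBounded (range x)) {f : StrongDual ℝ X}
    (hf : ‖f‖ ≤ 1) : ca (fun n => f (x n)) ≤ weakCa x :=
  le_ciSup (bddAbove_weakCa hx) (⟨f, by simpa using hf⟩ : Metric.closedBall (0 : StrongDual ℝ X) 1)

theorem weakCa_nonneg (x : ℕ → X) : 0 ≤ weakCa x :=
  Real.iSup_nonneg fun _ => ca_nonneg _

end CauchyModulus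

section Completion

variable {T : Descriptive.tree (Bool × ℕ+)}

/-- The restriction of a functional on the Banach space `E_T` to its dense subspace. -/
def toPre (f : StrongDual ℝ (TreeBanachSpace T)) : StrongDual ℝ (PreTreeSpace T) :=
  f.comp (UniformSpace.Completion.toComplL : PreTreeSpace T →L[ℝ] TreeBanachSpace T)

theorem toPre_apply (f : StrongDual ℝ (TreeBanachSpace T)) (x : PreTreeSpace T) :
    toPre f x = f (x : TreeBanachSpace T) := rfl

theorem norm_toPre (f : StrongDual ℝ (TreeBanachSpace T)) : ‖toPre f‖ = ‖f‖ := by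
  refine le_antisymm ?_ ?_
  · refine ContinuousLinearMap.opNorm_le_bound _ (norm_nonneg f) fun x => ?_
    rw [toPre_apply]
    exact (f.le_opNorm _).trans_eq (by rw [UniformSpace.Completion.norm_coe])
  · refine ContinuousLinearMap.opNorm_le_bound _ (norm_nonneg _) fun x => ?_
    induction x using UniformSpace.Completion.induction_on with
    | hp => exact isClosed_le (by fun_prop) (by fun_prop)
    | ih x =>
      rw [UniformSpace.Completion.norm_coe]
      exact (toPre f).le_opNorm x

/-- With ill-founded sections, the dual of `E_T` has the `6`-Schur property: the loss is a factor
`3` for the norms of the signed sums of blocks, and a factor `2` since the functionals on the bidual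
have to be compared with the weak limit of differences, whose norm is only bounded by `δ`. -/
theorem hasQuantitativeSchurProperty (hT : ∀ σ : ℕ → Bool, IllFounded (treeSection T σ)) :
    HasQuantitativeSchurProperty 6 (StrongDual ℝ (TreeBanachSpace T)) := by
  intro f hf
  by_contra! hcon
  set δ := weakCa f with hδ
  have hδ0 : 0 ≤ δ := weakCa_nonneg f
  obtain ⟨c, hc1, hc2⟩ := exists_between hcon
  have hpair : ∀ m, ∃ w : ℕ × ℕ, m ≤ w.1 ∧ m ≤ w.2 ∧ c < ‖f w.1 - f w.2‖ := by
    intro m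
    by_contra! h
    refine absurd ((ca_le_diam f m).trans (Metric.diam_le_of_forall_dist_le
      (by linarith : 0 ≤ c) ?_)) (not_le.2 hc2)
    rintro _ ⟨u, hu, rfl⟩ _ ⟨v, hv, rfl⟩
    rw [dist_eq_norm]
    exact h (u, v) hu hv
  choose w hw1 hw2 hw3 using hpair
  set g : ℕ → StrongDual ℝ (TreeBanachSpace T) := fun m => f (w m).1 - f (w m).2 with hg
  obtain ⟨R, hR⟩ := hf.exists_norm_le
  have hgR : ∀ m, ‖g m‖ ≤ R + R := fun m =>
    (norm_sub_le _ _).trans (add_le_add (hR _ ⟨_, rfl⟩) (hR _ ⟨_, rfl⟩))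
  set U := hyperfilter ℕ
  have hU : (U : Filter ℕ) ≤ atTop := Nat.hyperfilter_le_atTop
  obtain ⟨H, hHR, hH⟩ := exists_limit_functional U hgR
  -- The limit of the values of a normalized functional at the differences is at most `δ`; applied
  -- to evaluations at points, this bounds the norm of `H`.
  have hev : ∀ Ψ : StrongDual ℝ (StrongDual ℝ (TreeBanachSpace T)), ‖Ψ‖ ≤ 1 → ∀ l,
      Tendsto (fun m => Ψ (g m)) U (𝓝 l) → |l| ≤ δ := by
    intro Ψ hΨ l hl
    refine le_trans ?_ (ca_le_weakCa hf hΨ)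
    refine le_ciInf fun m => le_of_tendsto hl.abs ?_
    filter_upwards [hU (eventually_ge_atTop m)] with n hn
    rw [hg]
    simp only [map_sub]
    rw [← Real.dist_eq]
    exact Metric.dist_le_diam_of_mem ((isBounded_range_apply hf Ψ).subset (image_subset_range _ _))
      (mem_image_of_mem (fun n => Ψ (f n)) (hn.trans (hw1 n)))
      (mem_image_of_mem (fun n => Ψ (f n)) (hn.trans (hw2 n)))
  have hHδ : ‖H‖ ≤ δ := by
    refine ContinuousLinearMap.opNorm_le_of_unit_norm hδ0 fun x hx => ?_
    refine hev (NormedSpace.inclusionInDoubleDual ℝ _ x) ?_ _ (hH x)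
    exact (NormedSpace.double_dual_bound ℝ _ x).trans hx.le
  set h : ℕ → StrongDual ℝ (PreTreeSpace T) := fun m => toPre (g m - H) with hh
  have hhC : ∀ m, ‖h m‖ ≤ R + R + (R + R) := fun m => by
    rw [hh]
    simp only [norm_toPre]
    exact (norm_sub_le _ _).trans (add_le_add (hgR m) hHR)
  have hh0 : ∀ η, Tendsto (fun k => h k (ofFinsupp T (Finsupp.single η 1))) U (𝓝 0) := fun η => by
    have := (hH (ofFinsupp T (Finsupp.single η 1) : PreTreeSpace T)).sub_const
      (H (ofFinsupp T (Finsupp.single η 1) : PreTreeSpace T))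
    rwa [sub_self] at this
  have hhlow : ∀ m, c - δ < ‖h m‖ := fun m => by
    rw [hh]
    simp only [norm_toPre]
    have := norm_sub_norm_le (g m) H
    linarith [hw3 m]
  -- Since `6 δ < c`, the number `(3 δ + (c - δ)) / 2` lies strictly between `3 δ` and `c - δ`.
  obtain ⟨κ, y, hκ, hy⟩ := exists_blocks hT hU hhC hh0
    (show (3 * δ + (c - δ)) / 2 < c - δ by linarith) hhlow
  set a := (3 * δ + (c - δ)) / 2 with ha
  -- With alternating signs, one of the parities gives `s i * Φ H` the favourable sign, whatever the
  -- value at `H` of the resulting element `Φ` of the bidual.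
  set s : ℕ → ℝ := fun k => (-1) ^ k with hs
  have hs1 : ∀ k, |s k| = 1 := fun k => by simp [hs]
  set z : ℕ → TreeBanachSpace T := fun K =>
    ((ofFinsupp T (∑ k ∈ Finset.range K, s k • y k) : PreTreeSpace T) : TreeBanachSpace T) with hz
  obtain ⟨Φ, hΦ3, hΦ⟩ := exists_limit_functional U
    (F := fun K => NormedSpace.inclusionInDoubleDual ℝ (TreeBanachSpace T) (z K)) (C := 3)
    fun K => (NormedSpace.double_dual_bound ℝ _ _).trans (by
      rw [hz]
      simp only [UniformSpace.Completion.norm_coe]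
      exact (hy s hs1 K).1)
  have hΦge : ∀ i, a ≤ s i * Φ (g (κ i) - H) := fun i => by
    refine ge_of_tendsto ((hΦ (g (κ i) - H)).const_mul (s i)) ?_
    filter_upwards [hU (eventually_gt_atTop i)] with K hK
    exact (hy s hs1 K).2 i hK
  have hcaΦ : a ≤ ca fun n => Φ (f n) := by
    refine le_ca (isBounded_range_apply hf Φ) fun m => ?_
    obtain ⟨i, him, hi⟩ : ∃ i ≥ m, 0 ≤ s i * Φ H := by
      rcases le_total 0 (Φ H) with h' | h'
      · exact ⟨2 * m, by omega, by simpa [hs] using h'⟩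
      · exact ⟨2 * m + 1, by omega, by simpa [hs, pow_succ] using h'⟩
    have him' : m ≤ κ i := him.trans (hκ.le_apply)
    refine ⟨_, him'.trans (hw1 (κ i)), _, him'.trans (hw2 (κ i)), ?_⟩
    have h1 := hΦge i
    rw [map_sub, mul_sub] at h1
    have h2 : a ≤ s i * Φ (g (κ i)) := by linarith
    calc a ≤ |s i * Φ (g (κ i))| := h2.trans (le_abs_self _)
      _ = |Φ (g (κ i))| := by rw [abs_mul, hs1 i, one_mul]
      _ = _ := by rw [hg]; simp only [map_sub]; rw [Real.dist_eq]
  have hfin : a / 3 ≤ δ := by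
    have h1 : ‖(3⁻¹ : ℝ) • Φ‖ ≤ 1 := by
      rw [norm_smul, Real.norm_eq_abs, abs_of_pos (by norm_num)]
      linarith
    refine le_trans ?_ (ca_le_weakCa hf h1)
    rw [show (fun n => ((3⁻¹ : ℝ) • Φ) (f n)) = fun n => (3⁻¹ : ℝ) • Φ (f n) from rfl]
    refine le_ciInf fun m => ?_
    rw [show (fun n => (3⁻¹ : ℝ) • Φ (f n)) '' Ici m = (fun t : ℝ => (3⁻¹ : ℝ) • t) ''
      ((fun n => Φ (f n)) '' Ici m) by rw [image_image], ← image_smul.symm, diam_smul₀]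
    rw [Real.norm_eq_abs, abs_of_pos (by norm_num)]
    have := hcaΦ.trans (ca_le_diam _ m)
    linarith
  linarith

end Completion

/-! ### Weak convergence, the Schur property and the Dunford-Pettis property -/

section Weak

variable {X : Type*} [NormedAddCommGroup X] [NormedSpace ℝ X]

theorem weaklyTendsto_iff {x : ℕ → X} {a : X} :
    WeaklyTendsto x a ↔ ∀ f : StrongDual ℝ X, Tendsto (fun n => f (x n)) atTop (𝓝 (f a)) := by
  refine WeakBilin.tendsto_iff_forall_eval_tendsto (topDualPairing ℝ X).flip fun y z hyz => ?_
  by_contra hne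
  obtain ⟨f, hf⟩ := SeparatingDual.exists_ne_zero (R := ℝ) (sub_ne_zero.2 hne)
  refine hf ?_
  rw [map_sub, sub_eq_zero]
  exact LinearMap.congr_fun hyz f

theorem isBounded_range_of_weaklyTendsto {x : ℕ → X} {a : X} (h : WeaklyTendsto x a) :
    Bornology.IsBounded (range x) := by
  obtain ⟨C, hC⟩ := banach_steinhaus (g := fun n => NormedSpace.inclusionInDoubleDual ℝ X (x n))
    fun f => by
      obtain ⟨C, hC⟩ := (Metric.isBounded_range_of_tendsto _
        (weaklyTendsto_iff.1 h f)).exists_norm_le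
      exact ⟨C, fun n => hC _ ⟨n, rfl⟩⟩
  refine isBounded_iff_forall_norm_le.2 ⟨C, ?_⟩
  rintro _ ⟨n, rfl⟩
  exact (NormedSpace.inclusionInDoubleDualLi ℝ (E := X)).norm_map (x n) ▸ hC n

theorem ca_eq_zero_of_tendsto {x : ℕ → ℝ} {a : ℝ} (h : Tendsto x atTop (𝓝 a)) : ca x = 0 := by
  refine le_antisymm (le_of_forall_pos_le_add fun ε hε => ?_) (ca_nonneg x)
  obtain ⟨m, hm⟩ := Metric.tendsto_atTop.1 h (ε / 2) (half_pos hε)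
  rw [zero_add]
  refine (ca_le_diam x m).trans (Metric.diam_le_of_forall_dist_le hε.le ?_)
  rintro _ ⟨u, hu, rfl⟩ _ ⟨v, hv, rfl⟩
  have := dist_triangle_right (x u) (x v) a
  linarith [hm u hu, hm v hv]

theorem cauchySeq_of_ca_le_zero {X : Type*} [PseudoMetricSpace X] {x : ℕ → X}
    (hx : Bornology.IsBounded (range x)) (h : ca x ≤ 0) : CauchySeq x := by
  refine Metric.cauchySeq_iff.2 fun ε hε => ?_
  obtain ⟨m, hm⟩ := exists_lt_of_ciInf_lt (h.trans_lt hε)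
  exact ⟨m, fun u hu v hv => (Metric.dist_le_diam_of_mem (hx.subset (image_subset_range _ _))
    (mem_image_of_mem x hu) (mem_image_of_mem x hv)).trans_lt hm⟩

theorem HasQuantitativeSchurProperty.hasSchurProperty [CompleteSpace X] {C : ℝ}
    (h : HasQuantitativeSchurProperty C X) : HasSchurProperty X := by
  intro x a hx
  have hb := isBounded_range_of_weaklyTendsto hx
  have h0 : weakCa x = 0 := by
    rw [weakCa]
    simp only [ca_eq_zero_of_tendsto (weaklyTendsto_iff.1 hx _), ciSup_const]
  have := h x hb
  rw [h0, mul_zero] at this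
  exact cauchySeq_tendsto_of_complete (cauchySeq_of_ca_le_zero hb this)

theorem HasSchurProperty.hasDunfordPettisProperty {X : Type u} [NormedAddCommGroup X]
    [NormedSpace ℝ X] (h : HasSchurProperty X) : HasDunfordPettisProperty.{u, v} X := by
  intro Y _ _ _ S _ x a hx
  obtain ⟨b, hb⟩ := h x a hx
  exact ⟨S b, (S.continuous.tendsto b).comp hb⟩

/-- In a reflexive space, closed balls are weakly compact. -/
theorem IsReflexiveSpace.isCompact_closedBall (h : IsReflexiveSpace X) (r : ℝ) :
    IsCompact (toWeakSpace ℝ X '' Metric.closedBall 0 r) := by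
  choose J hJ using h
  have hcont : Continuous fun Φ : WeakDual ℝ (StrongDual ℝ X) =>
      toWeakSpace ℝ X (J (WeakDual.toStrongDual Φ)) := by
    refine WeakBilin.continuous_of_continuous_eval _ fun f => ?_
    have : (fun Φ : WeakDual ℝ (StrongDual ℝ X) => (topDualPairing ℝ X).flip
        (toWeakSpace ℝ X (J (WeakDual.toStrongDual Φ))) f) = fun Φ => Φ f := by
      funext Φ
      exact DFunLike.congr_fun (hJ (WeakDual.toStrongDual Φ)) f
    rw [this]
    exact WeakDual.eval_continuous f
  have hnorm : ∀ x : X, ‖NormedSpace.inclusionInDoubleDual ℝ X x‖ = ‖x‖ :=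
    (NormedSpace.inclusionInDoubleDualLi ℝ (E := X)).norm_map
  have hball : ∀ Φ : StrongDual ℝ (StrongDual ℝ X), Φ ∈ Metric.closedBall 0 r ↔ ‖Φ‖ ≤ r :=
    fun Φ => mem_closedBall_zero_iff (E := StrongDual ℝ (StrongDual ℝ X))
  have himage : toWeakSpace ℝ X '' Metric.closedBall 0 r =
      (fun Φ : WeakDual ℝ (StrongDual ℝ X) => toWeakSpace ℝ X (J (WeakDual.toStrongDual Φ))) ''
        (WeakDual.toStrongDual ⁻¹' Metric.closedBall (0 : StrongDual ℝ (StrongDual ℝ X)) r) := by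
    ext y
    constructor
    · rintro ⟨x, hx, rfl⟩
      refine ⟨StrongDual.toWeakDual (NormedSpace.inclusionInDoubleDual ℝ X x), ?_, ?_⟩
      · rw [mem_closedBall_zero_iff] at hx
        exact (hball _).2 ((hnorm x).trans_le hx)
      · refine congrArg _ ((NormedSpace.inclusionInDoubleDualLi ℝ (E := X)).injective ?_)
        exact hJ _
    · rintro ⟨Φ, hΦ, rfl⟩
      refine ⟨_, ?_, rfl⟩
      have h1 := hnorm (J (WeakDual.toStrongDual Φ))
      rw [hJ] at h1
      exact mem_closedBall_zero_iff.2 (h1.symm.trans_le ((hball _).1 hΦ))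
  rw [himage]
  exact (WeakDual.isCompact_closedBall (𝕜 := ℝ) (0 : StrongDual ℝ (StrongDual ℝ X)) r).image hcont

/-- An operator that factors through a reflexive space is weakly compact. -/
theorem IsReflexiveSpace.isWeaklyCompactOperator_comp {Y Z : Type*} [NormedAddCommGroup Y]
    [NormedSpace ℝ Y] [NormedAddCommGroup Z] [NormedSpace ℝ Z] (h : IsReflexiveSpace Z)
    (j : Z →L[ℝ] Y) (Q : X →L[ℝ] Z) : IsWeaklyCompactOperator (j.comp Q) := by
  have hK := (h.isCompact_closedBall ‖Q‖).image (WeakSpace.map j).continuous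
  refine hK.closure_of_subset ?_
  rintro _ ⟨_, ⟨x, hx, rfl⟩, rfl⟩
  refine ⟨toWeakSpace ℝ Z (Q x), ⟨Q x, ?_, rfl⟩, rfl⟩
  rw [mem_closedBall_zero_iff] at hx ⊢
  exact (Q.le_opNorm x).trans (mul_le_of_le_one_right (norm_nonneg Q) hx)

/-- A complemented reflexive subspace with a weakly null sequence that is not norm convergent
rules out the Schur and the Dunford-Pettis property. -/
theorem not_hasSchurProperty_and_not_hasDunfordPettisProperty {X : Type} [NormedAddCommGroup X]
    [NormedSpace ℝ X] {Z : Submodule ℝ X} (hZ : Z.ClosedComplemented)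
    (hr : IsReflexiveSpace Z) (hc : CompleteSpace Z) {e : ℕ → Z} (he : WeaklyTendsto e 0)
    (he' : ∀ n, 1 ≤ ‖e n - e (n + 1)‖) :
    ¬ HasSchurProperty X ∧ ¬ HasDunfordPettisProperty.{0, v} X := by
  have hw : WeaklyTendsto (fun n => (e n : X)) 0 := by
    rw [weaklyTendsto_iff] at he ⊢
    intro f
    simpa using he (f.comp Z.subtypeL)
  have hdp : ¬ HasDunfordPettisProperty.{0, v} X := by
    intro h
    obtain ⟨Q, hQ⟩ := hZ
    -- The projection onto `Z` is weakly compact; `Z` is lifted to the universe of the targets.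
    let j : Z →L[ℝ] ULift.{v} Z :=
      (ContinuousLinearEquiv.ulift (R₁ := ℝ) (M₁ := Z)).symm.toContinuousLinearMap
    obtain ⟨b, hb⟩ := h (ULift.{v} Z) (j.comp Q) (hr.isWeaklyCompactOperator_comp j Q) _ _ hw
    obtain ⟨N, hN⟩ := Metric.cauchySeq_iff.1 hb.cauchySeq 1 one_pos
    have h1 := hN N le_rfl (N + 1) (Nat.le_succ N)
    rw [dist_eq_norm, ← map_sub, ← AddSubgroupClass.coe_sub, ContinuousLinearMap.comp_apply,
      hQ] at h1
    exact absurd (he' N) (not_le.2 h1)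
  exact ⟨fun h => hdp h.hasDunfordPettisProperty, hdp⟩

end Weak

/-! ### Generators of the unit ball of a Tsirelson type norm -/

section Generators

variable {T : Descriptive.tree ℕ+}

theorem sum_map_initSeg (ν : ℕ → ℕ+) (j : ℕ) :
    ((initSeg ν j).map fun n : ℕ+ => (n : ℕ)).sum = ∑ i ∈ Finset.range j, (ν i : ℕ) := by
  rw [initSeg, List.map_ofFn, List.sum_ofFn, Finset.sum_range]
  rfl

/-- Finitely many elements of a member of `M_T` are partial sums of a single finite sequence. -/
theorem exists_list_of_mem_setSystem {A : Set ℕ+} (hA : A ∈ setSystem T) (F : Finset ℕ+)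
    (hF : ∀ m ∈ F, m ∈ A) :
    ∃ ν : List ℕ+, (ν ∈ T ∨ ν.length ≤ 3) ∧ ∀ m ∈ F, m ∈ finPartialSums ν := by
  rcases hA with ⟨ν, hν, rfl⟩ | ⟨ν, hν, rfl⟩
  · exact ⟨ν, hν, hF⟩
  · choose! j hj1 hj2 using hF
    refine ⟨initSeg ν (F.sup j), Or.inl (hν _), fun m hm => ⟨j m, hj1 m hm, ?_, ?_⟩⟩
    · rw [length_initSeg]
      exact Finset.le_sup hm
    · rw [initSeg_take ν (Finset.le_sup hm), sum_map_initSeg, hj2 m hm]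

/-- The finitely supported sequences generated from the signed basic vectors by halved sums whose
supports are separated by partial sums of an element of `T` or of a sequence of length at most
`3`. Their convex hull is `Θ` for the system `M_T`. -/
inductive IsGenerator (T : Descriptive.tree ℕ+) : (ℕ+ →₀ ℝ) → Prop
  | single (i : ℕ+) (s : ℝ) (hs : s = 1 ∨ s = -1) : IsGenerator T (Finsupp.single i s)
  | half_sum {n : ℕ} (ν : List ℕ+) (hν : ν ∈ T ∨ ν.length ≤ 3) (x : Fin n → ℕ+ →₀ ℝ)
      (m : Fin n → ℕ+) (hx : ∀ k, IsGenerator T (x k)) (hm : ∀ k, m k ∈ finPartialSums ν)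
      (h1 : ∀ k i, x k i ≠ 0 → m k ≤ i) (h2 : ∀ j k, j < k → ∀ i, x j i ≠ 0 → i < m k) :
      IsGenerator T ((1 / 2 : ℝ) • ∑ k, x k)

theorem isGenerator_zero : IsGenerator T 0 := by
  have := IsGenerator.half_sum (T := T) (n := 0) [] (Or.inr (by simp)) Fin.elim0 Fin.elim0
    (fun k => k.elim0) (fun k => k.elim0) (fun k => k.elim0) (fun k => k.elim0)
  simpa using this

theorem IsGenerator.neg {x : ℕ+ →₀ ℝ} (hx : IsGenerator T x) : IsGenerator T (-x) := by
  induction hx with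
  | single i s hs =>
    rw [← Finsupp.single_neg]
    refine .single i (-s) ?_
    rcases hs with rfl | rfl <;> simp
  | half_sum ν hν x m hx hm h1 h2 ih =>
    have := IsGenerator.half_sum ν hν (fun k => -x k) m ih hm
      (fun k i hi => h1 k i (by simpa using hi))
      (fun j k hjk i hi => h2 j k hjk i (by simpa using hi))
    simpa [Finset.sum_neg_distrib] using this

theorem IsGenerator.restrict {x : ℕ+ →₀ ℝ} (hx : IsGenerator T x) (S : Set ℕ+) :
    IsGenerator T (restrict S x) := by
  induction hx with
  | single i s hs =>
    by_cases hi : i ∈ S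
    · rw [restrict_single_of_mem hi]
      exact .single i s hs
    · rw [restrict_single_of_notMem hi]
      exact isGenerator_zero
  | half_sum ν hν x m hx hm h1 h2 ih =>
    rw [map_smul, map_sum]
    exact .half_sum ν hν _ m ih hm (fun k i hi => h1 k i (apply_ne_zero_of_restrict hi))
      (fun j k hjk i hi => h2 j k hjk i (apply_ne_zero_of_restrict hi))

theorem IsGenerator.mem_theta {x : ℕ+ →₀ ℝ} (hx : IsGenerator T x) : x ∈ theta (setSystem T) := by
  induction hx with
  | single i s hs =>
    have h1 := (isTsirelsonClosed_theta (setSystem T)).2.1 i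
    have h2 := smul_mem_theta (a := s) (by rcases hs with rfl | rfl <;> simp) h1
    simpa using h2
  | half_sum ν hν x m hx hm h1 h2 ih =>
    exact half_sum_mem_theta (Or.inl ⟨ν, hν, rfl⟩) Finset.univ x m (fun k _ => ih k)
      (fun k _ _ => hm k) (fun k _ => h1 k) (fun j _ k _ hjk _ => h2 j k hjk)

theorem theta_subset_convexHull : theta (setSystem T) ⊆ convexHull ℝ {x | IsGenerator T x} := by
  set W := {x | IsGenerator T x} with hW
  have hneg : ∀ x ∈ convexHull ℝ W, -x ∈ convexHull ℝ W := by
    intro x hx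
    have : -W = W := by
      ext y
      exact ⟨fun h => by
        have := IsGenerator.neg (show IsGenerator T (-y) from h)
        rwa [neg_neg] at this, fun h => IsGenerator.neg h⟩
    rw [← this, convexHull_neg]
    simpa using hx
  refine sInter_subset_of_mem ⟨⟨?_, convex_convexHull ℝ W⟩, ?_, ?_⟩
  · rw [balanced_iff_smul_mem]
    intro a ha x hx
    rw [Real.norm_eq_abs, abs_le] at ha
    have := convex_convexHull ℝ W hx (hneg x hx) (show 0 ≤ (1 + a) / 2 by linarith [ha.1])
      (show 0 ≤ (1 - a) / 2 by linarith [ha.2]) (by ring)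
    convert this using 1
    rw [smul_neg, ← sub_eq_add_neg, ← sub_smul]
    congr 1
    ring
  · exact fun i => subset_convexHull ℝ W (.single i 1 (Or.inl rfl))
  · rintro n E x ⟨-, A, hA, m, hmA, hm1, hm2⟩ hx
    obtain ⟨ν, hν, hmν⟩ := exists_list_of_mem_setSystem hA (Finset.univ.image m) (by
      intro _ h
      obtain ⟨k, -, rfl⟩ := Finset.mem_image.1 h
      exact hmA k)
    -- The halved sum is linear in the vectors, which range over a product of convex hulls.
    let L : (Fin n → ℕ+ →₀ ℝ) →ₗ[ℝ] (ℕ+ →₀ ℝ) :=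
      (1 / 2 : ℝ) • ∑ k, TreeSpace.restrict (↑(E k) : Set ℕ+) ∘ₗ LinearMap.proj k
    have hL : ∀ y, L y = (1 / 2 : ℝ) • ∑ k, TreeSpace.restrict (↑(E k) : Set ℕ+) (y k) := by
      intro y
      simp [L]
    have hLx : L x = (1 / 2 : ℝ) • ∑ k, (x k).filter (· ∈ E k) := by
      rw [hL]
      congr 1
      refine Finset.sum_congr rfl fun k _ => ?_
      ext i
      by_cases hi : i ∈ E k <;> simp [restrict_apply_of_mem, restrict_apply_of_notMem, hi]
    rw [← hLx]
    have hxpi : x ∈ convexHull ℝ (Set.pi univ fun _ : Fin n => W) := by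
      rw [convexHull_pi]
      exact fun k _ => hx k
    have himg := mem_image_of_mem L hxpi
    rw [L.isLinear.image_convexHull] at himg
    refine convexHull_mono ?_ himg
    rintro _ ⟨y, hy, rfl⟩
    rw [hL]
    refine .half_sum ν hν _ m (fun k => IsGenerator.restrict (hy k (mem_univ k)) _)
      (fun k => hmν _ (Finset.mem_image_of_mem m (Finset.mem_univ k)))
      (fun k i hi => hm1 k i (mem_of_restrict_apply_ne_zero hi))
      (fun j k hjk i hi => hm2 j k hjk i (mem_of_restrict_apply_ne_zero hi))

/-- The positive integers in the interval `(N, L]`. -/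
def window (N L : ℕ) : Set ℕ+ := {i | N < (i : ℕ) ∧ (i : ℕ) ≤ L}

/-- On a window that contains no partial sum of the sequence used last in its construction, a
generator is half of a generator. -/
theorem IsGenerator.exists_window {w : ℕ+ →₀ ℝ} (hw : IsGenerator T w) :
    ∃ ν : List ℕ+, (ν ∈ T ∨ ν.length ≤ 3) ∧ ∀ N L : ℕ,
      (∀ m ∈ finPartialSums ν, m ∉ window N L) →
        IsGenerator T ((2 : ℝ) • TreeSpace.restrict (window N L) w) := by
  cases hw with
  | single i s hs =>
    refine ⟨[i], Or.inr (by simp), fun N L h => ?_⟩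
    rw [restrict_single_of_notMem (h i ⟨1, le_rfl, by simp, by simp⟩), smul_zero]
    exact isGenerator_zero
  | half_sum ν hν x m hx hm h1 h2 =>
    refine ⟨ν, hν, fun N L h => ?_⟩
    rw [map_smul, smul_smul, map_sum]
    norm_num only [one_smul]
    by_cases h0 : ∃ k, TreeSpace.restrict (window N L) (x k) ≠ 0
    · obtain ⟨k, hk⟩ := h0
      -- Two vectors meeting the window would be separated by an element of the window.
      have huniq : ∀ j k, j < k → TreeSpace.restrict (window N L) (x j) ≠ 0 →
          TreeSpace.restrict (window N L) (x k) = 0 := by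
        intro j k hjk hj
        obtain ⟨i, hi⟩ := Finsupp.ne_iff.1 hj
        ext l
        by_contra hl
        have h3 : i ∈ window N L := mem_of_restrict_apply_ne_zero hi
        have h4 : l ∈ window N L := mem_of_restrict_apply_ne_zero hl
        have h5 : (i : ℕ) < m k := h2 j k hjk i (apply_ne_zero_of_restrict hi)
        have h6 : (m k : ℕ) ≤ l := h1 k l (apply_ne_zero_of_restrict hl)
        exact h (m k) (hm k) ⟨by have := h3.1; omega, by have := h4.2; omega⟩
      rw [Finset.sum_eq_single k]
      · exact (hx k).restrict _
      · intro j _ hjk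
        rcases lt_or_gt_of_ne hjk with hlt | hlt
        · by_contra hj
          exact hk (huniq j k hlt hj)
        · exact huniq k j hlt hk
      · exact fun h' => absurd (Finset.mem_univ k) h'
    · push Not at h0
      rw [Finset.sum_eq_zero fun k _ => h0 k]
      exact isGenerator_zero

end Generators

/-! ### Compactness of the set system of a well-founded tree -/

section WellFounded

variable {T : Descriptive.tree ℕ+}

/-- If `T` has no infinite branch, an ultrafilter on `T` converges to a finite sequence: there is a
bound `N` such that the partial sums beyond `N` escape to infinity. -/
theorem exists_partialSums_notMem_window (hT : ¬ IllFounded T) (U : Ultrafilter (List ℕ+))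
    (hU : ∀ᶠ ν in (U : Filter (List ℕ+)), ν ∈ T ∨ ν.length ≤ 3) :
    ∃ N : ℕ, ∀ L : ℕ, ∀ᶠ ν in (U : Filter (List ℕ+)), ∀ m ∈ finPartialSums ν, m ∉ window N L := by
  -- A longest finite sequence `p` that is an initial segment of almost all `ν`.
  obtain ⟨p, hp, hp'⟩ : ∃ p : List ℕ+, (∀ᶠ ν in (U : Filter (List ℕ+)), p <+: ν) ∧
      ∀ n, ¬ ∀ᶠ ν in (U : Filter (List ℕ+)), p ++ [n] <+: ν := by
    by_contra! hcon
    choose! g hg using hcon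
    let c : ℕ → List ℕ+ := fun ℓ => Nat.rec [] (fun _ p => p ++ [g p]) ℓ
    have hcs : ∀ ℓ, c (ℓ + 1) = c ℓ ++ [g (c ℓ)] := fun ℓ => rfl
    have hc : ∀ ℓ, ∀ᶠ ν in (U : Filter (List ℕ+)), c ℓ <+: ν := by
      intro ℓ
      induction ℓ with
      | zero => exact Filter.Eventually.of_forall fun ν => List.nil_prefix
      | succ ℓ ih => exact hg _ ih
    have hseg : ∀ ℓ, initSeg (fun i => g (c i)) ℓ = c ℓ := by
      intro ℓ
      induction ℓ with
      | zero => rfl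
      | succ ℓ ih => rw [initSeg_succ, ih, hcs]
    refine hT ⟨fun i => g (c i), fun ℓ => ?_⟩
    obtain ⟨ν, h1, h2⟩ := ((hc (ℓ + 4)).and hU).exists
    have hlen : ℓ + 4 ≤ ν.length := by
      have := h1.length_le
      have h' := congrArg List.length (hseg (ℓ + 4))
      rw [length_initSeg] at h'
      omega
    have hνT : ν ∈ T := h2.resolve_right (by omega)
    refine Descriptive.Tree.mem_of_prefix ?_ hνT
    refine List.IsPrefix.trans ?_ h1
    rw [← hseg (ℓ + 4), ← initSeg_take (fun i => g (c i)) (show ℓ ≤ ℓ + 4 by omega)]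
    exact List.take_prefix _ _
  refine ⟨(p.map fun n : ℕ+ => (n : ℕ)).sum, fun L => ?_⟩
  -- Almost no `ν` extends `p` by an entry at most `L`.
  have hall : ∀ᶠ ν in (U : Filter (List ℕ+)), ∀ n ∈ (Finset.range L).image Nat.succPNat,
      ¬ p ++ [n] <+: ν := by
    rw [Filter.eventually_all_finset]
    exact fun n _ => Ultrafilter.eventually_not.2 (hp' n)
  filter_upwards [hp, hall] with ν h1 h2
  rintro m ⟨j, hj1, hj2, hj3⟩ ⟨hN, hL⟩
  obtain ⟨t, rfl⟩ := h1
  have hmono : ∀ {l l' : List ℕ+}, l <+: l' →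
      (l.map fun n : ℕ+ => (n : ℕ)).sum ≤ (l'.map fun n : ℕ+ => (n : ℕ)).sum := by
    rintro l _ ⟨r, rfl⟩
    simp
  by_cases hjp : j ≤ p.length
  · rw [List.take_append_of_le_length hjp] at hj3
    have := hmono (List.take_prefix j p)
    omega
  rcases t with _ | ⟨n, t⟩
  · simp at hj2
    exact hjp hj2
  have hpre : p ++ [n] <+: (p ++ n :: t).take j := by
    rw [List.prefix_take_iff]
    exact ⟨⟨t, by simp⟩, by simp; omega⟩
  have hsum := hmono hpre
  rw [List.map_append, List.sum_append, List.map_singleton, List.sum_singleton] at hsum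
  have hnpos := n.pos
  refine h2 n (Finset.mem_image.2 ⟨n.natPred, Finset.mem_range.2 ?_, PNat.succPNat_natPred n⟩)
    ⟨t, by simp⟩
  have : n.natPred + 1 = (n : ℕ) := PNat.natPred_add_one n
  omega

end WellFounded

/-! ### Bounded completeness of the unit vectors for a well-founded tree -/

section BoundedlyComplete

variable {T : Descriptive.tree ℕ+}

/-- The pairing of a finitely supported sequence with an arbitrary one. -/
def pairing (c : ℕ+ →₀ ℝ) (w : ℕ+ → ℝ) : ℝ := ∑ i ∈ c.support, c i * w i

theorem continuous_pairing (c : ℕ+ →₀ ℝ) : Continuous (pairing c) := by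
  unfold pairing
  fun_prop

theorem pairing_sum (c : ℕ+ →₀ ℝ) {ι : Type*} (I : Finset ι) (a : ι → ℝ) (w : ι → ℕ+ → ℝ) :
    pairing c (∑ k ∈ I, a k • w k) = ∑ k ∈ I, a k * pairing c (w k) := by
  simp only [pairing, Finset.mul_sum, Finset.sum_apply, Pi.smul_apply, smul_eq_mul]
  rw [Finset.sum_comm]
  exact Finset.sum_congr rfl fun k _ => Finset.sum_congr rfl fun i _ => by ring

/-- The pointwise closure of the set of generators. -/
def generatorClosure (T : Descriptive.tree ℕ+) : Set (ℕ+ → ℝ) :=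
  closure ((fun x : ℕ+ →₀ ℝ => (x : ℕ+ → ℝ)) '' {x | IsGenerator T x})

theorem IsGenerator.coe_mem {x : ℕ+ →₀ ℝ} (hx : IsGenerator T x) :
    (x : ℕ+ → ℝ) ∈ generatorClosure T :=
  subset_closure (mem_image_of_mem _ hx)

theorem isCompact_generatorClosure : IsCompact (generatorClosure T) := by
  have hK : IsCompact (Set.pi univ fun _ : ℕ+ => Icc (-1 : ℝ) 1) :=
    isCompact_univ_pi fun _ => isCompact_Icc
  refine hK.of_isClosed_subset isClosed_closure (closure_minimal ?_ hK.isClosed)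
  rintro _ ⟨x, hx, rfl⟩ i -
  exact abs_le.1 ((abs_apply_le_tsirelsonNorm (setSystem T) x i).trans
    (tsirelsonNorm_le_one hx.mem_theta))

/-- If `T` has no infinite branch, then a tail of any pointwise limit of generators is half of
such a limit. -/
theorem exists_two_mul_tail_mem (hT : ¬ IllFounded T) {w : ℕ+ → ℝ} (hw : w ∈ generatorClosure T) :
    ∃ N : ℕ, (fun i : ℕ+ => if N < (i : ℕ) then 2 * w i else 0) ∈ generatorClosure T := by
  obtain ⟨U, hU1, hU2⟩ : ∃ U : Ultrafilter (ℕ+ →₀ ℝ), (U : Filter (ℕ+ →₀ ℝ)) ≤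
      𝓟 {x | IsGenerator T x} ∧ Tendsto (fun x : ℕ+ →₀ ℝ => (x : ℕ+ → ℝ)) U (𝓝 w) := by
    rw [generatorClosure, mem_closure_iff_clusterPt, ← map_principal] at hw
    exact mapClusterPt_iff_ultrafilter.1 hw
  have hgen : ∀ᶠ x in (U : Filter (ℕ+ →₀ ℝ)), IsGenerator T x := le_principal_iff.1 hU1
  have hch := fun (x : ℕ+ →₀ ℝ) (hx : IsGenerator T x) => hx.exists_window
  choose! ν hν1 hν2 using hch
  obtain ⟨N, hN⟩ := exists_partialSums_notMem_window hT (U.map ν) (by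
    rw [Ultrafilter.coe_map, eventually_map]
    exact hgen.mono hν1)
  refine ⟨N, ?_⟩
  -- On finite windows this is `IsGenerator.exists_window`; let then `L` tend to infinity.
  have hwin : ∀ L : ℕ, (window N L).indicator (fun i => 2 * w i) ∈
      generatorClosure T := by
    intro L
    refine isClosed_closure.mem_of_tendsto (b := (U : Filter (ℕ+ →₀ ℝ)))
      (f := fun x => (((2 : ℝ) • TreeSpace.restrict (window N L) x : ℕ+ →₀ ℝ) : ℕ+ → ℝ)) ?_ ?_
    · rw [tendsto_pi_nhds] at hU2 ⊢
      intro i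
      by_cases hi : i ∈ window N L
      · simp only [Finsupp.smul_apply, restrict_apply_of_mem hi, smul_eq_mul,
          indicator_of_mem hi]
        exact (hU2 i).const_mul 2
      · simp only [Finsupp.smul_apply, restrict_apply_of_notMem hi, smul_zero,
          indicator_of_notMem hi]
        exact tendsto_const_nhds
    · have := hN L
      rw [Ultrafilter.coe_map, eventually_map] at this
      filter_upwards [hgen, this] with x hx hx'
      exact (hν2 x hx N L hx').coe_mem
  refine isClosed_closure.mem_of_tendsto (b := (atTop : Filter ℕ)) ?_
    (Filter.Eventually.of_forall hwin)
  rw [tendsto_pi_nhds]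
  intro i
  refine tendsto_const_nhds.congr' ?_
  filter_upwards [eventually_ge_atTop (i : ℕ)] with L hL
  simp [window, Set.indicator_apply, hL]

theorem exists_two_pow_mul_tail_mem (hT : ¬ IllFounded T) {w : ℕ+ → ℝ}
    (hw : w ∈ generatorClosure T) (j : ℕ) :
    ∃ N : ℕ, (fun i : ℕ+ => if N < (i : ℕ) then 2 ^ j * w i else 0) ∈ generatorClosure T := by
  induction j with
  | zero => exact ⟨0, by simpa using hw⟩
  | succ j ih =>
    obtain ⟨N, hN⟩ := ih
    obtain ⟨N', hN'⟩ := exists_two_mul_tail_mem hT hN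
    refine ⟨max N N', ?_⟩
    convert hN' using 2 with i
    by_cases h1 : N < (i : ℕ) <;> by_cases h2 : N' < (i : ℕ) <;> simp [h1, h2, pow_succ]
    ring

/-- Functionals of norm at most one with supports tending to infinity tend to zero pointwise on the
pointwise limits of generators. -/
theorem tendsto_pairing_generatorClosure (hT : ¬ IllFounded T) {c : ℕ → ℕ+ →₀ ℝ}
    (hc : ∀ n i, c n i ≠ 0 → n < (i : ℕ))
    (hb : ∀ n, ∀ w ∈ generatorClosure T, |pairing (c n) w| ≤ 1) {w : ℕ+ → ℝ}
    (hw : w ∈ generatorClosure T) : Tendsto (fun n => pairing (c n) w) atTop (𝓝 0) := by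
  rw [Metric.tendsto_atTop]
  intro ε hε
  obtain ⟨j, hj⟩ := exists_pow_lt_of_lt_one hε (show (1 / 2 : ℝ) < 1 by norm_num)
  obtain ⟨N, hN⟩ := exists_two_pow_mul_tail_mem hT hw j
  refine ⟨N, fun n hn => ?_⟩
  rw [Real.dist_eq, sub_zero]
  have h1 := hb n _ hN
  have h2 : pairing (c n) (fun i : ℕ+ => if N < (i : ℕ) then 2 ^ j * w i else 0) =
      2 ^ j * pairing (c n) w := by
    rw [pairing, pairing, Finset.mul_sum]
    refine Finset.sum_congr rfl fun i hi => ?_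
    rw [if_pos (lt_of_le_of_lt hn (hc n i (Finsupp.mem_support_iff.1 hi)))]
    ring
  rw [h2, abs_mul, abs_of_pos (by positivity : (0 : ℝ) < 2 ^ j)] at h1
  refine lt_of_le_of_lt ?_ hj
  rw [one_div, inv_pow, ← one_div, le_div_iff₀ (by positivity), mul_comm]
  exact h1

/-- A pointwise limit of elements of `Θ` is the barycenter of a probability measure on the
pointwise closure of the set of generators. -/
theorem exists_probabilityMeasure {y : ℕ → ℕ+ →₀ ℝ} (hy : ∀ n, y n ∈ theta (setSystem T))
    {a : ℕ+ → ℝ} (ha : Tendsto (fun n => (y n : ℕ+ → ℝ)) atTop (𝓝 a)) :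
    ∃ μ : MeasureTheory.ProbabilityMeasure (generatorClosure T), ∀ c : ℕ+ →₀ ℝ,
      ∫ w, pairing c (w : ℕ+ → ℝ) ∂(μ : MeasureTheory.Measure (generatorClosure T)) =
        pairing c a := by
  have : CompactSpace (generatorClosure T) :=
    isCompact_iff_compactSpace.1 isCompact_generatorClosure
  have key : ∀ n, ∃ μ : MeasureTheory.ProbabilityMeasure (generatorClosure T), ∀ c : ℕ+ →₀ ℝ,
      ∫ w, pairing c (w : ℕ+ → ℝ) ∂(μ : MeasureTheory.Measure (generatorClosure T)) =
        pairing c (y n) := by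
    intro n
    obtain ⟨ι, hι, s, z, hs, hs1, hz, hsum⟩ :=
      mem_convexHull_iff_exists_fintype.1 (theta_subset_convexHull (hy n))
    let z' : ι → generatorClosure T := fun k => ⟨z k, IsGenerator.coe_mem (hz k)⟩
    let m : MeasureTheory.Measure (generatorClosure T) :=
      ∑ k, ENNReal.ofReal (s k) • MeasureTheory.Measure.dirac (z' k)
    have hm : MeasureTheory.IsProbabilityMeasure m := by
      constructor
      simp only [m, MeasureTheory.Measure.coe_finsetSum, Finset.sum_apply,
        MeasureTheory.Measure.smul_apply, MeasureTheory.measure_univ, smul_eq_mul, mul_one]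
      rw [← ENNReal.ofReal_sum_of_nonneg fun k _ => hs k, hs1, ENNReal.ofReal_one]
    refine ⟨⟨m, hm⟩, fun c => ?_⟩
    have hcoe : (y n : ℕ+ → ℝ) = ∑ k, s k • (z k : ℕ+ → ℝ) := by
      rw [← hsum]
      ext i
      simp [Finsupp.finsetSum_apply]
    rw [hcoe, pairing_sum]
    change ∫ w, pairing c (w : ℕ+ → ℝ) ∂m = _
    have hcont : Continuous fun w : generatorClosure T => pairing c (w : ℕ+ → ℝ) :=
      (continuous_pairing c).comp continuous_subtype_val
    rw [MeasureTheory.integral_finsetSum_measure]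
    · refine Finset.sum_congr rfl fun k _ => ?_
      rw [MeasureTheory.integral_smul_measure, MeasureTheory.integral_dirac,
        ENNReal.toReal_ofReal (hs k), smul_eq_mul]
    · intro k _
      exact ((BoundedContinuousFunction.mkOfCompact ⟨_, hcont⟩).integrable
        (MeasureTheory.Measure.dirac (z' k))).smul_measure ENNReal.ofReal_ne_top
  choose ρ hρ using key
  obtain ⟨m, -, hm⟩ := isCompact_univ.ultrafilter_le_nhds' ((hyperfilter ℕ).map ρ) univ_mem
  refine ⟨m, fun c => ?_⟩
  have hcont : Continuous fun w : generatorClosure T => pairing c (w : ℕ+ → ℝ) :=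
    (continuous_pairing c).comp continuous_subtype_val
  have hlim := MeasureTheory.ProbabilityMeasure.tendsto_iff_forall_integral_tendsto.1
    (show Tendsto ρ (hyperfilter ℕ) (𝓝 m) from hm)
    (BoundedContinuousFunction.mkOfCompact ⟨_, hcont⟩)
  simp only [BoundedContinuousFunction.mkOfCompact_apply, ContinuousMap.coe_mk, hρ] at hlim
  exact tendsto_nhds_unique hlim
    ((((continuous_pairing c).tendsto a).comp ha).mono_left Nat.hyperfilter_le_atTop)

/-- Bounded completeness of the unit vectors for the norm given by a tree without infinite branches,
in dual form: normalized functionals with supports tending to infinity tend to zero at every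
pointwise limit of elements of `Θ`, by dominated convergence for a representing measure. -/
theorem tendsto_pairing_of_mem_theta (hT : ¬ IllFounded T) {y : ℕ → ℕ+ →₀ ℝ}
    (hy : ∀ n, y n ∈ theta (setSystem T)) {a : ℕ+ → ℝ}
    (ha : Tendsto (fun n => (y n : ℕ+ → ℝ)) atTop (𝓝 a)) {c : ℕ → ℕ+ →₀ ℝ}
    (hc : ∀ n i, c n i ≠ 0 → n < (i : ℕ))
    (hb : ∀ n, ∀ x ∈ theta (setSystem T), |pairing (c n) x| ≤ 1) :
    Tendsto (fun n => pairing (c n) a) atTop (𝓝 0) := by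
  have hb' : ∀ n, ∀ w ∈ generatorClosure T, |pairing (c n) w| ≤ 1 := by
    intro n
    refine closure_minimal ?_ (isClosed_le (continuous_pairing (c n)).abs continuous_const)
    rintro _ ⟨x, hx, rfl⟩
    exact hb n x (IsGenerator.mem_theta hx)
  obtain ⟨μ, hμ⟩ := exists_probabilityMeasure hy ha
  have := MeasureTheory.tendsto_integral_of_dominated_convergence
    (μ := (μ : MeasureTheory.Measure (generatorClosure T)))
    (F := fun n w => pairing (c n) (w : ℕ+ → ℝ)) (f := fun _ => 0) (fun _ => (1 : ℝ))
    (fun n => ((continuous_pairing (c n)).comp continuous_subtype_val).aestronglyMeasurable)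
    (MeasureTheory.integrable_const 1)
    (fun n => Filter.Eventually.of_forall fun w => hb' n w w.2)
    (Filter.Eventually.of_forall fun w => tendsto_pairing_generatorClosure hT hc hb' w.2)
  simpa [hμ] using this

end BoundedlyComplete

/-! ### Sequences on a single branch -/

section Branch

variable {T : Descriptive.tree (Bool × ℕ+)} (σ : ℕ → Bool)

/-- Restriction to the common part of two branches maps the set `Θ` of one into that of the other:
a separating number bounded by a level `ℓ` is a partial sum of at most `ℓ` terms, and `T(σ)` and
`T(σ')` contain the same sequences up to the splitting level. -/
theorem restrict_mem_theta_treeSection (σ' : ℕ → Bool) {x : ℕ+ →₀ ℝ}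
    (hx : x ∈ theta (setSystem (treeSection T σ))) :
    restrict {i | branchNode σ' i = branchNode σ i} x ∈ theta (setSystem (treeSection T σ')) := by
  refine restrict_mem_theta_of_forall (fun A hA F hF => ?_) hx
  obtain ⟨ν, hν, hFν⟩ := exists_list_of_mem_setSystem hA F fun m hm => (hF m hm).1
  rcases hν with hν | hν
  swap
  · exact ⟨_, Or.inl ⟨ν, Or.inr hν, rfl⟩, hFν⟩
  choose! k hk1 hk2 hk3 using hFν
  have hkν : F.sup k ≤ ν.length := Finset.sup_le hk2
  have hseg : initSeg σ' (F.sup k) = initSeg σ (F.sup k) := by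
    rcases F.eq_empty_or_nonempty with rfl | hne
    · rfl
    obtain ⟨m, hm, hkm⟩ := Finset.exists_mem_eq_sup F hne k
    obtain ⟨i, hi, hmi⟩ := (hF m hm).2
    have hle : F.sup k ≤ i := by
      have h1 := le_sum_take ν (hk2 m hm)
      rw [← hk3 m hm] at h1
      rw [hkm]
      exact h1.trans hmi
    rw [← take_branchNode σ' i hle, ← take_branchNode σ i hle, show branchNode σ' i = _ from hi]
  refine ⟨_, Or.inl ⟨ν.take (F.sup k), Or.inl ?_, rfl⟩, fun m hm => ⟨k m, hk1 m hm, ?_, ?_⟩⟩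
  · refine mem_treeSection_of_zip_mem (ℓ := F.sup k) (by simp [length_initSeg, hkν]) ?_
    have h1 : (initSeg σ ν.length).zip ν ∈ T := hν
    rw [hseg, ← initSeg_take σ hkν]
    have h2 : ((initSeg σ ν.length).take (F.sup k)).zip (ν.take (F.sup k)) =
        ((initSeg σ ν.length).zip ν).take (F.sup k) := List.take_zipWith.symm
    rw [h2]
    exact Descriptive.Tree.mem_of_prefix (List.take_prefix _ _) h1
  · rw [List.length_take, min_eq_left hkν]
    exact Finset.le_sup hm
  · rw [List.take_take, min_eq_left (Finset.le_sup hm), hk3 m hm]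

/-- The finitely supported function on the nodes that has prescribed values along the branch `σ` and
vanishes elsewhere. -/
def onBranch : (ℕ+ →₀ ℝ) →ₗ[ℝ] (Node →₀ ℝ) := Finsupp.lmapDomain ℝ ℝ (branchNode σ)

theorem onBranch_single (i : ℕ+) (a : ℝ) :
    onBranch σ (Finsupp.single i a) = Finsupp.single (branchNode σ i) a :=
  Finsupp.mapDomain_single

theorem onBranch_branchNode (x : ℕ+ →₀ ℝ) (i : ℕ+) : onBranch σ x (branchNode σ i) = x i :=
  Finsupp.mapDomain_apply (branchNode_injective σ) x i

theorem onBranch_of_notMem (x : ℕ+ →₀ ℝ) {η : Node} (hη : η ∉ range (branchNode σ)) :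
    onBranch σ x η = 0 :=
  Finsupp.mapDomain_of_notMem_range x η hη

theorem alongBranch_onBranch_self (x : ℕ+ →₀ ℝ) : alongBranch σ (onBranch σ x) = x := by
  ext i
  rw [alongBranch_apply, onBranch_branchNode]

theorem alongBranch_onBranch (σ' : ℕ → Bool) (x : ℕ+ →₀ ℝ) :
    alongBranch σ' (onBranch σ x) = restrict {i | branchNode σ' i = branchNode σ i} x := by
  ext i
  rw [alongBranch_apply]
  by_cases hi : branchNode σ' i = branchNode σ i
  · rw [restrict_apply_of_mem (show i ∈ {i | branchNode σ' i = branchNode σ i} from hi), hi,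
      onBranch_branchNode]
  · rw [restrict_apply_of_notMem (show i ∉ {i | branchNode σ' i = branchNode σ i} from hi)]
    refine onBranch_of_notMem σ x ?_
    rintro ⟨j, hj⟩
    have := congrArg (fun η : Node => η.1.length) hj
    simp only [length_branchNode, PNat.coe_inj] at this
    exact hi (this ▸ hj.symm)

/-- The branch `σ` itself gives the largest of the norms whose supremum is the norm of `E_T`. -/
theorem treeNorm_onBranch_le_one {x : ℕ+ →₀ ℝ} (hx : x ∈ theta (setSystem (treeSection T σ))) :
    treeNorm T (onBranch σ x) ≤ 1 :=
  treeNorm_le fun σ' => by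
    rw [alongBranch_onBranch]
    exact tsirelsonNorm_le_one (restrict_mem_theta_treeSection σ σ' hx)

theorem onBranch_restrict_alongBranch (B : Set ℕ+) (x : Node →₀ ℝ) :
    onBranch σ (restrict B (alongBranch σ x)) = restrict (branchNode σ '' B) x := by
  ext η
  by_cases hη : η ∈ range (branchNode σ)
  · obtain ⟨i, rfl⟩ := hη
    rw [onBranch_branchNode]
    by_cases hi : i ∈ B
    · rw [restrict_apply_of_mem hi, restrict_apply_of_mem (mem_image_of_mem _ hi),
        alongBranch_apply]
    · rw [restrict_apply_of_notMem hi, restrict_apply_of_notMem]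
      rwa [(branchNode_injective σ).mem_set_image]
  · rw [onBranch_of_notMem σ _ hη, restrict_apply_of_notMem]
    exact fun h => hη (image_subset_range _ _ h)

/-- The part of a sequence `a` on the window `(N, n]`. -/
def segment (N n : ℕ) (a : ℕ+ → ℝ) : ℕ+ →₀ ℝ :=
  ∑ i ∈ Finset.Ico N n, Finsupp.single i.succPNat (a i.succPNat)

theorem segment_apply_of_mem {N n : ℕ} (a : ℕ+ → ℝ) {i : ℕ+} (hi : i ∈ window N n) :
    segment N n a i = a i := by
  have hi' : i.natPred + 1 = (i : ℕ) := PNat.natPred_add_one i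
  rw [segment, Finsupp.finsetSum_apply, Finset.sum_eq_single i.natPred]
  · simp
  · intro j _ hj
    rw [Finsupp.single_apply, if_neg]
    rintro rfl
    exact hj (Nat.natPred_succPNat j).symm
  · intro h
    have h1 := hi.1
    have h2 := hi.2
    exact absurd (Finset.mem_Ico.2 ⟨by omega, by omega⟩) h

theorem segment_apply_of_notMem {N n : ℕ} (a : ℕ+ → ℝ) {i : ℕ+} (hi : i ∉ window N n) :
    segment N n a i = 0 := by
  rw [segment, Finsupp.finsetSum_apply]
  refine Finset.sum_eq_zero fun j hj => ?_
  rw [Finsupp.single_apply, if_neg]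
  rintro rfl
  have := Finset.mem_Ico.1 hj
  exact hi ⟨by rw [Nat.succPNat_coe]; omega, by rw [Nat.succPNat_coe]; omega⟩

theorem segment_eq_restrict (N n : ℕ) (x : ℕ+ →₀ ℝ) : segment N n x = restrict (window N n) x := by
  ext i
  by_cases hi : i ∈ window N n
  · rw [segment_apply_of_mem _ hi, restrict_apply_of_mem hi]
  · rw [segment_apply_of_notMem _ hi, restrict_apply_of_notMem hi]

theorem pairing_segment (N n : ℕ) (b w : ℕ+ → ℝ) :
    pairing (segment N n b) w = ∑ i ∈ Finset.Ico N n, b i.succPNat * w i.succPNat := by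
  have : ∀ c, pairing c w = Finsupp.linearCombination ℝ w c := fun c => rfl
  rw [this, segment, map_sum]
  simp [Finsupp.linearCombination_single]

end Branch

/-! ### The functionals supported by a branch -/

section BranchDual

variable {T : Descriptive.tree (Bool × ℕ+)} (σ : ℕ → Bool)

/-- The unit vector of `E_T` at the `i`-th node of the branch `σ`. -/
def branchVec (T : Descriptive.tree (Bool × ℕ+)) (σ : ℕ → Bool) (i : ℕ+) : TreeBanachSpace T :=
  (ofFinsupp T (Finsupp.single (branchNode σ i) 1) : PreTreeSpace T)

theorem norm_branchVec_le (i : ℕ+) : ‖branchVec T σ i‖ ≤ 1 := by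
  rw [branchVec, UniformSpace.Completion.norm_coe, norm_ofFinsupp]
  simpa using treeNorm_single_le (T := T) (branchNode σ i) 1

theorem coe_onBranch_segment (N n : ℕ) (a : ℕ+ → ℝ) :
    ((ofFinsupp T (onBranch σ (segment N n a)) : PreTreeSpace T) : TreeBanachSpace T) =
      ∑ i ∈ Finset.Ico N n, a i.succPNat • branchVec T σ i.succPNat := by
  have h : ∀ i : ℕ+, Finsupp.single i (a i) = a i • Finsupp.single i (1 : ℝ) := fun i => by simp
  simp only [segment, h, map_sum, map_smul, onBranch_single]
  change UniformSpace.Completion.toComplL (𝕜 := ℝ) (E := PreTreeSpace T) _ = _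
  rw [map_sum]
  simp only [map_smul]
  rfl

/-- The coefficient functional at the `i`-th node of the branch `σ`. -/
def branchCoeff (T : Descriptive.tree (Bool × ℕ+)) (σ : ℕ → Bool) (i : ℕ+) :
    StrongDual ℝ (TreeBanachSpace T) :=
  (LinearMap.mkContinuous (Finsupp.lapply (branchNode σ i) ∘ₗ (ofFinsupp T).symm.toLinearMap)
    1 fun x => by
      rw [one_mul]
      exact abs_apply_le_treeNorm ((ofFinsupp T).symm x) _ :
    PreTreeSpace T →L[ℝ] ℝ).fromCompletion

theorem branchCoeff_coe (i : ℕ+) (x : Node →₀ ℝ) :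
    branchCoeff T σ i (ofFinsupp T x : PreTreeSpace T) = x (branchNode σ i) :=
  ContinuousLinearMap.fromCompletion_apply_coe _ _

theorem branchCoeff_branchVec (i j : ℕ+) :
    branchCoeff T σ i (branchVec T σ j) = if i = j then 1 else 0 := by
  rw [branchVec, branchCoeff_coe]
  simp only [Finsupp.single_apply, (branchNode_injective σ).eq_iff, eq_comm]

/-- The restriction to the branch `σ`, as a bounded operator on `E_T`. -/
def branchProj (T : Descriptive.tree (Bool × ℕ+)) (σ : ℕ → Bool) :
    TreeBanachSpace T →L[ℝ] TreeBanachSpace T :=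
  (restrictL T (range (branchNode σ))).completion

theorem branchProj_coe (x : Node →₀ ℝ) :
    branchProj T σ (ofFinsupp T x : PreTreeSpace T) =
      (ofFinsupp T (restrict (range (branchNode σ)) x) : PreTreeSpace T) :=
  ContinuousLinearMap.completion_apply_coe _ _

theorem branchProj_branchProj (x : TreeBanachSpace T) :
    branchProj T σ (branchProj T σ x) = branchProj T σ x := by
  induction x using UniformSpace.Completion.induction_on with
  | hp => exact isClosed_eq (by fun_prop) (by fun_prop)
  | ih x =>
    obtain ⟨x, rfl⟩ := (ofFinsupp T).surjective x
    rw [branchProj_coe, branchProj_coe, restrict_restrict, inter_self]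

/-- The adjoint of the restriction to the branch `σ`. -/
def branchProjDual (T : Descriptive.tree (Bool × ℕ+)) (σ : ℕ → Bool) :
    StrongDual ℝ (TreeBanachSpace T) →L[ℝ] StrongDual ℝ (TreeBanachSpace T) :=
  (ContinuousLinearMap.compL ℝ (TreeBanachSpace T) (TreeBanachSpace T) ℝ).flip (branchProj T σ)

theorem branchProjDual_apply (f : StrongDual ℝ (TreeBanachSpace T)) (x : TreeBanachSpace T) :
    branchProjDual T σ f x = f (branchProj T σ x) := rfl

/-- The functionals on `E_T` that depend only on the values on the branch `σ`. -/
def branchDual (T : Descriptive.tree (Bool × ℕ+)) (σ : ℕ → Bool) :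
    Submodule ℝ (StrongDual ℝ (TreeBanachSpace T)) :=
  (ContinuousLinearMap.id ℝ _ - branchProjDual T σ).ker

theorem mem_branchDual {f : StrongDual ℝ (TreeBanachSpace T)} :
    f ∈ branchDual T σ ↔ ∀ x, f (branchProj T σ x) = f x := by
  rw [branchDual, LinearMap.mem_ker]
  constructor
  · intro h x
    have := congrArg (fun g : StrongDual ℝ (TreeBanachSpace T) => g x) h
    exact (sub_eq_zero.1 this).symm
  · intro h
    ext x
    exact sub_eq_zero.2 (h x).symm

theorem completeSpace_branchDual : CompleteSpace (branchDual T σ) :=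
  (ContinuousLinearMap.isClosed_ker
    (ContinuousLinearMap.id ℝ _ - branchProjDual T σ)).completeSpace_coe

/-- The projection of the dual of `E_T` onto `branchDual T σ`. -/
def toBranchDual (T : Descriptive.tree (Bool × ℕ+)) (σ : ℕ → Bool) :
    StrongDual ℝ (TreeBanachSpace T) →L[ℝ] branchDual T σ :=
  (branchProjDual T σ).codRestrict _ fun f => (mem_branchDual σ).2 fun x => by
    rw [branchProjDual_apply, branchProjDual_apply, branchProj_branchProj]

theorem toBranchDual_apply (f : StrongDual ℝ (TreeBanachSpace T)) (x : TreeBanachSpace T) :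
    (toBranchDual T σ f : StrongDual ℝ (TreeBanachSpace T)) x = f (branchProj T σ x) := rfl

theorem closedComplemented_branchDual : (branchDual T σ).ClosedComplemented :=
  ⟨toBranchDual T σ, fun f => Subtype.ext (ContinuousLinearMap.ext fun x =>
    (mem_branchDual σ).1 f.2 x)⟩

theorem branchCoeff_mem (i : ℕ+) : branchCoeff T σ i ∈ branchDual T σ := by
  rw [mem_branchDual]
  intro x
  induction x using UniformSpace.Completion.induction_on with
  | hp => exact isClosed_eq (by fun_prop) (by fun_prop)
  | ih x =>
    obtain ⟨x, rfl⟩ := (ofFinsupp T).surjective x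
    rw [branchProj_coe, branchCoeff_coe, branchCoeff_coe, restrict_apply_of_mem (mem_range_self i)]

/-- The `n`-th partial sum of the expansion of a functional in the coefficient functionals of the
branch `σ`, as an element of `branchDual T σ`. -/
def branchPartialSum (n : ℕ) (f : StrongDual ℝ (TreeBanachSpace T)) : branchDual T σ :=
  ∑ i ∈ Finset.Ico 0 n,
    f (branchVec T σ i.succPNat) •
      (⟨branchCoeff T σ i.succPNat, branchCoeff_mem σ _⟩ : branchDual T σ)

theorem branchPartialSum_coe (n : ℕ) (f : StrongDual ℝ (TreeBanachSpace T)) (x : Node →₀ ℝ) :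
    (branchPartialSum σ n f : StrongDual ℝ (TreeBanachSpace T)) (ofFinsupp T x : PreTreeSpace T) =
      toPre f (ofFinsupp T (restrict (branchNode σ '' window 0 n) x)) := by
  rw [toPre_apply, ← onBranch_restrict_alongBranch, ← segment_eq_restrict, coe_onBranch_segment,
    map_sum, branchPartialSum, Submodule.coe_sum, sum_apply]
  refine Finset.sum_congr rfl fun i _ => ?_
  rw [Submodule.coe_smul, smul_apply, branchCoeff_coe, map_smul,
    alongBranch_apply, smul_eq_mul, smul_eq_mul, mul_comm]

theorem norm_branchPartialSum_le (n : ℕ) (f : StrongDual ℝ (TreeBanachSpace T)) :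
    ‖branchPartialSum σ n f‖ ≤ ‖f‖ := by
  have h : toPre (branchPartialSum σ n f : StrongDual ℝ (TreeBanachSpace T)) =
      (toPre f).comp (restrictL T (branchNode σ '' window 0 n)) :=
    ext_ofFinsupp fun x => branchPartialSum_coe σ n f x
  rw [Submodule.coe_norm, ← norm_toPre, h, ← norm_toPre f]
  exact dualNormOn_le_norm _

/-- The expansion in the coefficient functionals converges since the basis is shrinking. -/
theorem tendsto_branchPartialSum (f : branchDual T σ) :
    Tendsto (fun n => branchPartialSum σ n (f : StrongDual ℝ (TreeBanachSpace T))) atTop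
      (𝓝 f) := by
  set h := toPre (f : StrongDual ℝ (TreeBanachSpace T)) with hh
  have key : ∀ n, ‖f - branchPartialSum σ n (f : StrongDual ℝ (TreeBanachSpace T))‖ ≤
      dualNormOn h (levelGE (n + 1)) := by
    intro n
    have hcomp : toPre ((f - branchPartialSum σ n (f : StrongDual ℝ (TreeBanachSpace T)) :
        branchDual T σ) : StrongDual ℝ (TreeBanachSpace T)) =
        h.comp (restrictL T (range (branchNode σ) \ branchNode σ '' window 0 n)) := by
      refine ext_ofFinsupp fun x => ?_
      have hsplit := restrict_add_restrict
        (disjoint_sdiff_self_right (x := branchNode σ '' window 0 n) (y := range (branchNode σ))) x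
      rw [union_sdiff_cancel (image_subset_range _ _)] at hsplit
      have h1 := (mem_branchDual σ).1 f.2 (ofFinsupp T x : PreTreeSpace T)
      rw [branchProj_coe, ← toPre_apply, ← hsplit, map_add, map_add] at h1
      rw [toPre_apply, Submodule.coe_sub, sub_apply, branchPartialSum_coe, ← h1,
        ContinuousLinearMap.comp_apply, restrictL_ofFinsupp]
      exact add_sub_cancel_left _ _
    rw [Submodule.coe_norm, ← norm_toPre, hcomp]
    refine dualNormOn_mono h ?_
    rintro _ ⟨⟨i, rfl⟩, hi⟩
    by_contra hlt
    refine hi ⟨i, ⟨i.pos, ?_⟩, rfl⟩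
    simp only [levelGE, mem_ofPred_eq, length_branchNode] at hlt
    omega
  rw [Metric.tendsto_atTop]
  intro ε hε
  obtain ⟨p, hp⟩ := exists_dualNormOn_levelGE_le h (half_pos hε)
  refine ⟨p, fun n hn => ?_⟩
  rw [dist_comm, Subtype.dist_eq, dist_eq_norm, ← Submodule.coe_sub, ← Submodule.coe_norm]
  have : levelGE (n + 1) ⊆ levelGE p := fun η hη => by
    simp only [levelGE, mem_ofPred_eq] at hη ⊢
    omega
  linarith [key n, dualNormOn_mono h this]

end BranchDual

/-! ### Reflexivity for a branch with a well-founded section -/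

section BranchReflexive

variable {T : Descriptive.tree (Bool × ℕ+)} (σ : ℕ → Bool)

/-- On a branch with a well-founded section, bounded partial sums converge. -/
theorem cauchySeq_sum_branchVec (hσ : ¬ IllFounded (treeSection T σ)) {a : ℕ+ → ℝ} {C : ℝ}
    (hC : ∀ n, ‖∑ i ∈ Finset.Ico 0 n, a i.succPNat • branchVec T σ i.succPNat‖ ≤ C) :
    CauchySeq fun n => ∑ i ∈ Finset.Ico 0 n, a i.succPNat • branchVec T σ i.succPNat := by
  have hC0 : 0 < C + 1 := by linarith [(norm_nonneg _).trans (hC 0)]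
  rw [Metric.cauchySeq_iff']
  by_contra! hcon
  obtain ⟨ε, hε, hcon⟩ := hcon
  choose n hn hdist using hcon
  -- Functionals norming the differences contradict `tendsto_pairing_of_mem_theta`.
  have hdiff : ∀ N, ∑ i ∈ Finset.Ico 0 (n N), a i.succPNat • branchVec T σ i.succPNat -
      ∑ i ∈ Finset.Ico 0 N, a i.succPNat • branchVec T σ i.succPNat =
        ∑ i ∈ Finset.Ico N (n N), a i.succPNat • branchVec T σ i.succPNat := fun N =>
    sub_eq_iff_eq_add'.2 (Finset.sum_Ico_consecutive _ (Nat.zero_le N) (hn N)).symm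
  have hch : ∀ N, ∃ f : StrongDual ℝ (TreeBanachSpace T), ‖f‖ ≤ 1 ∧
      ε ≤ f (∑ i ∈ Finset.Ico N (n N), a i.succPNat • branchVec T σ i.succPNat) := fun N => by
    obtain ⟨f, hf1, hf2⟩ := exists_dual_vector'' ℝ
      (∑ i ∈ Finset.Ico N (n N), a i.succPNat • branchVec T σ i.succPNat)
    refine ⟨f, hf1, ?_⟩
    have := hdist N
    rw [dist_eq_norm, hdiff] at this
    exact this.trans_eq hf2.symm
  choose f hf1 hf2 using hch
  have hy : ∀ m, (C + 1)⁻¹ • segment 0 m a ∈ theta (setSystem (treeSection T σ)) := fun m => by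
    refine inv_smul_mem_theta (lt_of_le_of_lt ?_ (show C < C + 1 by linarith))
    have h1 := tsirelsonNorm_alongBranch_le T σ (onBranch σ (segment 0 m a))
    rw [alongBranch_onBranch_self, ← norm_ofFinsupp, ← UniformSpace.Completion.norm_coe,
      coe_onBranch_segment] at h1
    exact h1.trans (hC m)
  have hlim : Tendsto (fun m => (((C + 1)⁻¹ • segment 0 m a : ℕ+ →₀ ℝ) : ℕ+ → ℝ)) atTop
      (𝓝 fun i => (C + 1)⁻¹ * a i) := by
    rw [tendsto_pi_nhds]
    intro i
    refine tendsto_const_nhds.congr' ?_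
    filter_upwards [eventually_ge_atTop (i : ℕ)] with m hm
    rw [Finsupp.smul_apply, segment_apply_of_mem a ⟨i.pos, hm⟩, smul_eq_mul]
  have h0 := tendsto_pairing_of_mem_theta hσ hy hlim
    (c := fun N => segment N (n N) fun i => f N (branchVec T σ i)) (fun N i hi => by
      by_contra h
      exact hi (segment_apply_of_notMem _ fun h' => h h'.1)) (fun N x hx => by
      have h1 : pairing (segment N (n N) fun i => f N (branchVec T σ i)) x =
          f N (ofFinsupp T (onBranch σ (segment N (n N) x)) : PreTreeSpace T) := by
        rw [pairing_segment, coe_onBranch_segment, map_sum]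
        refine Finset.sum_congr rfl fun i _ => ?_
        rw [map_smul, smul_eq_mul, mul_comm]
      rw [h1]
      refine ((f N).le_opNorm _).trans (mul_le_one₀ (hf1 N) (norm_nonneg _) ?_)
      rw [UniformSpace.Completion.norm_coe, norm_ofFinsupp, segment_eq_restrict]
      exact treeNorm_onBranch_le_one σ (restrict_mem_theta _ hx))
  have h2 : ∀ N, (C + 1)⁻¹ * ε ≤ pairing (segment N (n N) fun i => f N (branchVec T σ i))
      fun i => (C + 1)⁻¹ * a i := fun N => by
    have h3 : pairing (segment N (n N) fun i => f N (branchVec T σ i))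
        (fun i => (C + 1)⁻¹ * a i) = (C + 1)⁻¹ *
          f N (∑ i ∈ Finset.Ico N (n N), a i.succPNat • branchVec T σ i.succPNat) := by
      rw [pairing_segment, map_sum, Finset.mul_sum]
      refine Finset.sum_congr rfl fun i _ => ?_
      rw [map_smul, smul_eq_mul]
      ring
    rw [h3]
    exact mul_le_mul_of_nonneg_left (hf2 N) (inv_nonneg.2 hC0.le)
  have h4 : (C + 1)⁻¹ * ε ≤ 0 := ge_of_tendsto' h0 h2
  have h5 : 0 < (C + 1)⁻¹ * ε := by positivity
  linarith

/-- The coefficient functionals of the branch `σ` as elements of `branchDual T σ`. -/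
def branchDualVec (T : Descriptive.tree (Bool × ℕ+)) (σ : ℕ → Bool) (i : ℕ+) : branchDual T σ :=
  ⟨branchCoeff T σ i, branchCoeff_mem σ i⟩

/-- The dual of a normed space, with the module structure and the topology given by the norm. For a
submodule, `StrongDual` elaborates to the instances inherited from the ambient space, which instance
search does not identify with these. -/
abbrev NormedDual (X : Type*) [NormedAddCommGroup X] [NormedSpace ℝ X] : Type _ := StrongDual ℝ X

/-- On a branch with a well-founded section, every functional on `branchDual T σ` is the evaluation
at an element of `E_T`, whose expansion in the unit vectors of the branch converges. -/
theorem exists_forall_eq_apply (hσ : ¬ IllFounded (treeSection T σ))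
    (Φ : NormedDual (branchDual T σ)) :
    ∃ x : TreeBanachSpace T, Tendsto (fun n => ∑ i ∈ Finset.Ico 0 n,
      Φ (branchDualVec T σ i.succPNat) • branchVec T σ i.succPNat) atTop (𝓝 x) ∧
      ∀ f : branchDual T σ, Φ f = (f : StrongDual ℝ (TreeBanachSpace T)) x := by
  have hsum : ∀ (n : ℕ) (f : StrongDual ℝ (TreeBanachSpace T)), f (∑ i ∈ Finset.Ico 0 n,
      Φ (branchDualVec T σ i.succPNat) • branchVec T σ i.succPNat) =
        Φ (branchPartialSum σ n f) := fun n f => by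
    rw [branchPartialSum, map_sum, map_sum]
    refine Finset.sum_congr rfl fun i _ => ?_
    rw [map_smul, map_smul, smul_eq_mul, smul_eq_mul, mul_comm]
    rfl
  obtain ⟨x, hx⟩ := cauchySeq_tendsto_of_complete (cauchySeq_sum_branchVec σ hσ
    (a := fun i => Φ (branchDualVec T σ i)) (C := ‖Φ‖) fun n => by
      refine NormedSpace.norm_le_dual_bound ℝ _ (norm_nonneg Φ) fun f => ?_
      rw [hsum]
      exact (Φ.le_opNorm _).trans
        (mul_le_mul_of_nonneg_left (norm_branchPartialSum_le σ n f) (norm_nonneg Φ)))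
  refine ⟨x, hx, fun f => ?_⟩
  have h1 := ((Φ.continuous.tendsto f).comp (tendsto_branchPartialSum σ f))
  have h2 := (((f : StrongDual ℝ (TreeBanachSpace T)).continuous.tendsto x).comp hx)
  refine tendsto_nhds_unique h1 (h2.congr fun n => ?_)
  exact hsum n f

/-- An element `Ψ` of the bidual of `branchDual T σ` is represented by the functional
`x ↦ Ψ (evaluation at x)` on `E_T`, projected to `branchDual T σ`. -/
theorem isReflexiveSpace_branchDual (hσ : ¬ IllFounded (treeSection T σ)) :
    IsReflexiveSpace (branchDual T σ) := by
  intro Ψ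
  -- The evaluation map of `E_T` into the dual of `branchDual T σ`.
  let J : TreeBanachSpace T →L[ℝ] NormedDual (branchDual T σ) :=
    ((ContinuousLinearMap.compL ℝ (branchDual T σ) (StrongDual ℝ (TreeBanachSpace T)) ℝ).flip
      (branchDual T σ).subtypeL).comp (NormedSpace.inclusionInDoubleDual ℝ (TreeBanachSpace T))
  have hJ : ∀ x (f : branchDual T σ), J x f = (f : StrongDual ℝ (TreeBanachSpace T)) x :=
    fun x f => rfl
  refine ⟨toBranchDual T σ (Ψ.comp J), ContinuousLinearMap.ext fun Φ => ?_⟩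
  obtain ⟨x, -, hx⟩ := exists_forall_eq_apply σ hσ Φ
  have hΦ : J (branchProj T σ x) = Φ := ContinuousLinearMap.ext fun f => by
    rw [hJ, (mem_branchDual σ).1 f.2, hx]
  rw [NormedSpace.dual_def, hx, toBranchDual_apply, ContinuousLinearMap.comp_apply, hΦ]

/-- A subspace that contains an infinite biorthogonal system is infinite-dimensional. -/
theorem not_finiteDimensional_of_biorthogonal {X ι : Type*} [DecidableEq ι] [Infinite ι]
    [NormedAddCommGroup X] [NormedSpace ℝ X] {Z : Submodule ℝ X} (e : ι → Z)
    (F : ι → StrongDual ℝ X) (h : ∀ i j, F j (e i) = if i = j then 1 else 0) :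
    ¬ FiniteDimensional ℝ Z := by
  intro hfin
  have hli : LinearIndependent ℝ e := by
    rw [linearIndependent_iff']
    intro s g hg j hj
    have h1 := congrArg (fun f : Z => F j f) hg
    simpa [h, hj] using h1
  have := hli.finite
  exact not_finite ι

theorem not_finiteDimensional_branchDual : ¬ FiniteDimensional ℝ (branchDual T σ) :=
  not_finiteDimensional_of_biorthogonal (branchDualVec T σ)
    (fun j => NormedSpace.inclusionInDoubleDual ℝ _ (branchVec T σ j))
    fun i j => branchCoeff_branchVec σ i j

theorem weaklyTendsto_branchDualVec (hσ : ¬ IllFounded (treeSection T σ)) :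
    WeaklyTendsto (fun n : ℕ => branchDualVec T σ n.succPNat) 0 := by
  rw [weaklyTendsto_iff]
  intro Φ
  obtain ⟨x, hx, -⟩ := exists_forall_eq_apply σ hσ Φ
  rw [map_zero]
  have hdiff := ((hx.comp (tendsto_add_atTop_nat 1)).sub hx).norm
  rw [sub_self, norm_zero] at hdiff
  refine squeeze_zero_norm (fun n => ?_) hdiff
  -- The `n`-th coefficient is controlled by the difference of consecutive partial sums.
  have hsub : ∀ n, ∑ i ∈ Finset.Ico 0 (n + 1),
      Φ (branchDualVec T σ i.succPNat) • branchVec T σ i.succPNat -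
      ∑ i ∈ Finset.Ico 0 n, Φ (branchDualVec T σ i.succPNat) • branchVec T σ i.succPNat =
        Φ (branchDualVec T σ n.succPNat) • branchVec T σ n.succPNat := fun n => by
    rw [Finset.sum_Ico_succ_top (Nat.zero_le n), add_sub_cancel_left]
  have h1 : 1 ≤ ‖branchVec T σ n.succPNat‖ := by
    rw [branchVec, UniformSpace.Completion.norm_coe, norm_ofFinsupp]
    simpa using abs_apply_le_treeNorm (T := T)
      (Finsupp.single (branchNode σ n.succPNat) 1) (branchNode σ n.succPNat)
  rw [Function.comp_apply, hsub, norm_smul]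
  exact le_mul_of_one_le_right (norm_nonneg _) h1

theorem one_le_norm_branchDualVec_sub (n : ℕ) :
    1 ≤ ‖branchDualVec T σ n.succPNat - branchDualVec T σ (n + 1).succPNat‖ := by
  have hne : (n + 1).succPNat ≠ n.succPNat := fun h => by
    have := congrArg PNat.val h
    simp at this
  have h1 := ((branchDualVec T σ n.succPNat - branchDualVec T σ (n + 1).succPNat :
    branchDual T σ) : StrongDual ℝ (TreeBanachSpace T)).le_opNorm (branchVec T σ n.succPNat)
  rw [Submodule.coe_sub, sub_apply] at h1
  simp only [branchDualVec, branchCoeff_branchVec, if_true, if_neg hne, sub_zero, norm_one] at h1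
  exact h1.trans (mul_le_of_le_one_right (norm_nonneg _) (norm_branchVec_le σ _))

end BranchReflexive

end TreeSpace

end

theorem mainTheorem3 (T : Descriptive.tree (Bool × ℕ+)) :
    ((∀ σ : ℕ → Bool, TreeSpace.IllFounded (TreeSpace.treeSection T σ)) →
      TreeSpace.HasQuantitativeSchurProperty 6 (StrongDual ℝ (TreeSpace.TreeBanachSpace T)) ∧
      TreeSpace.HasSchurProperty (StrongDual ℝ (TreeSpace.TreeBanachSpace T)) ∧
      TreeSpace.HasDunfordPettisProperty.{0, v}
        (StrongDual ℝ (TreeSpace.TreeBanachSpace T))) ∧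
    ((¬ ∀ σ : ℕ → Bool, TreeSpace.IllFounded (TreeSpace.treeSection T σ)) →
      (∃ Z : Submodule ℝ (StrongDual ℝ (TreeSpace.TreeBanachSpace T)),
        Z.ClosedComplemented ∧ ¬ FiniteDimensional ℝ Z ∧ TreeSpace.IsReflexiveSpace Z) ∧
      ¬ TreeSpace.HasSchurProperty (StrongDual ℝ (TreeSpace.TreeBanachSpace T)) ∧
      ¬ TreeSpace.HasDunfordPettisProperty.{0, v}
        (StrongDual ℝ (TreeSpace.TreeBanachSpace T))) := by
  refine ⟨fun hT => ?_, fun hT => ?_⟩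
  · have h6 := TreeSpace.hasQuantitativeSchurProperty hT
    exact ⟨h6, h6.hasSchurProperty, h6.hasSchurProperty.hasDunfordPettisProperty⟩
  · obtain ⟨σ, hσ⟩ := not_forall.1 hT
    have hcompl := TreeSpace.closedComplemented_branchDual (T := T) σ
    have hrefl := TreeSpace.isReflexiveSpace_branchDual σ hσ
    exact ⟨⟨_, hcompl, TreeSpace.not_finiteDimensional_branchDual σ, hrefl⟩,
      TreeSpace.not_hasSchurProperty_and_not_hasDunfordPettisProperty hcompl hrefl
        (TreeSpace.completeSpace_branchDual σ) (TreeSpace.weaklyTendsto_branchDualVec σ hσ)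
        (TreeSpace.one_le_norm_branchDualVec_sub σ)⟩
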